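/- Let $k$ be an algebraically closed field (of arbitrary characteristic), let $q\in k^\times$ be a non-root of unity, and let $A=\mathcal O_q(M_2(k))$ be the $k$-algebra with generators $a,b,c,d$ and relations $$ab=q\,ba,\quad ac=q\,ca,\quad bd=q\,db,\quad cd=q\,dc,\quad bc=cb,\quad ad-da=(q-q^{-1})\,bc .$$ Let $\Delta=ad-q\,bc$, and write $X_{11},X_{12},X_{21},X_{22}$ for $a,b,c,d$. The torus $H=(k^\times)^4$ acts on $A$ by $k$-algebra automorphisms with $(\alpha_1,\alpha_2,\beta_1,\beta_2).X_{ij}=\alpha_i\beta_jX_{ij}$. An $H$-prime of $A$ is an $H$-stable prime ideal; $\langle S\rangle$ denotes the two-sided ideal generated by $S$. An element $u$ of a ring $R$ is normal if $uR=Ru$. A noncommutative UFD is a domain $R$ in which each nonzero prime ideal contains a nonzero normal element $p$ such that $R/Rp$ is a domain. A polynormal regular sequence in $R$ is a finite sequence $u_1,\dots,u_n$ such that each $u_i$ is regular (a non-zero-divisor on both sides) and normal modulo $\langle u_1,\dots,u_{i-1}\rangle$. The height of a prime ideal $P$ is the supremum of the lengths of chains of prime ideals descending from $P$. Then $\langle\Delta\rangle$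 is an $H$-prime of $A$, and the following hold. (a) Let $J\subsetneq K$ be $H$-primes of $A$ such that $K/J$ has height $1$ in $A/J$. Then the ideal $K/J$ is generated by a normal element of $A/J$ if and only if $J\neq\langle\Delta\rangle$. (b) $A/J$ is a noncommutative UFD for every $H$-prime $J\ne\langle\Delta\rangle$. (c) Every $H$-prime of $A$ is generated by a polynormal regular sequence. (d) The prime ideals $P$ of $A$ such that $\bigcap_{h\in H}h.P=\langle\Delta\rangle$ and $P/\langle\Delta\rangle$ has height $1$ are exactly the ideals $\langle\Delta,\,b-\lambda c\rangle$ with $\lambda\in k^\times$, and for each of these $P/\langle\Delta\rangle$ is generated by a normal element of $A/\langle\Delta\rangle$. (e) The ideals $\langle a,b\rangle$, $\langle b,d\rangle$, $\langle a,c\rangle$, $\langle c,d\rangle$ are $H$-primes properly containing $\langle\Delta\rangle$, and the height $1$ prime ideals of $A/\langle\Delta\rangle$ are exactly the ideals $\langle\Delta,\,b-\lambda c\rangle/\langle\Delta\rangle$ $(\lambda\in k^\times)$ together with $\langle a,b\rangle/\langle\Delta\rangle$, $\langle b,d\rangle/\langle\Delta\rangle$, $\langle a,c\rangle/\langle\Delta\rangle$,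 $\langle c,d\rangle/\langle\Delta\rangle$. (f) $A/\langle\Delta\rangle$ has infinitely many height $1$ prime ideals, and those which are not principal, i.e. not generated by a normal element, are exactly the last four ideals in (e); these four are pairwise distinct. -/

import Mathlib

noncomputable section

/-! ### Ring-theoretic notions for noncommutative rings -/

namespace NCRing

variable {R : Type*} [Ring R]

/-- `u` is a normal element of `R`: `u R = R u`. -/
def IsNormalElement (u : R) : Prop :=
  Set.range (fun r : R => u * r) = Set.range (fun r : R => r * u)

/-- Prime ideals of a noncommutative ring: `P` is proper, and `x R y ⊆ P` implies
`x ∈ P` or `y ∈ P`. -/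
def IsPrimeIdeal (P : TwoSidedIdeal R) : Prop :=
  P ≠ ⊤ ∧ ∀ x y : R, (∀ r : R, x * r * y ∈ P) → x ∈ P ∨ y ∈ P

variable (R) in
/-- The prime spectrum of `R`, ordered by inclusion. -/
abbrev PrimeSpec : Type _ := {P : TwoSidedIdeal R // IsPrimeIdeal P}

/-- The height of an ideal: the least height of a prime ideal containing it, where the height of
a prime `P` is the supremum of the lengths of chains of primes `P₀ < ⋯ < Pₙ = P`. -/
def height (I : TwoSidedIdeal R) : ℕ∞ :=
  ⨅ (P : PrimeSpec R) (_ : I ≤ P.1), Order.height P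

/-- For a prime ideal, `height` is its height in the poset of prime ideals. -/
theorem height_eq (P : PrimeSpec R) : height P.1 = Order.height P :=
  le_antisymm (iInf₂_le P le_rfl) (le_iInf₂ fun _ hQ => Order.height_mono hQ)

variable (R) in
/-- The set of prime ideals of height one. -/
def heightOnePrimes : Set (TwoSidedIdeal R) :=
  {P | IsPrimeIdeal P ∧ height P = 1}

/-- The factor ring `R / J`. -/
abbrev Factor (J : TwoSidedIdeal R) : Type _ := J.ringCon.Quotient

/-- The ideal `K / J` of `R / J` (for `J ⊆ K`): the image of `K` in `R / J`. -/
def factorIdeal (J K : TwoSidedIdeal R) : TwoSidedIdeal (Factor J) :=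
  TwoSidedIdeal.map J.ringCon.mk' K

/-- The ideal `I` can be generated by one normal element. -/
def IsGeneratedByNormal (I : TwoSidedIdeal R) : Prop :=
  ∃ u : R, IsNormalElement u ∧ TwoSidedIdeal.span {u} = I

/-- A prime element of `R`: a nonzero normal element `p` such that `R / R p` is a domain.
As `p` is normal, `R p` is the two-sided ideal generated by `p`. -/
def IsPrimeElement (p : R) : Prop :=
  p ≠ 0 ∧ IsNormalElement p ∧ IsDomain (Factor (TwoSidedIdeal.span {p}))

variable (R) in
/-- Noncommutative unique factorization domains in the sense of Chatters: domains in which each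
nonzero prime ideal contains a prime element. -/
def IsNoncommUFD : Prop :=
  IsDomain R ∧ ∀ P : TwoSidedIdeal R, IsPrimeIdeal P → P ≠ ⊥ → ∃ p ∈ P, IsPrimeElement p

/-- `u₁, …, uₙ` is a polynormal regular sequence: each `uᵢ` is regular and normal modulo the
ideal generated by its predecessors. -/
def IsPolynormalRegularSeq {n : ℕ} (u : Fin n → R) : Prop :=
  ∀ i : Fin n,
    IsRegular ((TwoSidedIdeal.span (u '' {j | j < i})).ringCon.mk' (u i)) ∧
    IsNormalElement ((TwoSidedIdeal.span (u '' {j | j < i})).ringCon.mk' (u i))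

end NCRing

/-! ### The quantized coordinate ring of `2 × 2` matrices -/

/-- The defining relations of `O_q(M₂(k))` in the free algebra on `X i j`, where
`X 0 0, X 0 1, X 1 0, X 1 1` are the generators `a, b, c, d`. -/
inductive OqM2Rel {k : Type*} [Field k] (q : k) :
    FreeAlgebra k (Fin 2 × Fin 2) → FreeAlgebra k (Fin 2 × Fin 2) → Prop
  | ab : OqM2Rel q (FreeAlgebra.ι k (0, 0) * FreeAlgebra.ι k (0, 1))
      (q • (FreeAlgebra.ι k (0, 1) * FreeAlgebra.ι k (0, 0)))
  | ac : OqM2Rel q (FreeAlgebra.ι k (0, 0) * FreeAlgebra.ι k (1, 0))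
      (q • (FreeAlgebra.ι k (1, 0) * FreeAlgebra.ι k (0, 0)))
  | bd : OqM2Rel q (FreeAlgebra.ι k (0, 1) * FreeAlgebra.ι k (1, 1))
      (q • (FreeAlgebra.ι k (1, 1) * FreeAlgebra.ι k (0, 1)))
  | cd : OqM2Rel q (FreeAlgebra.ι k (1, 0) * FreeAlgebra.ι k (1, 1))
      (q • (FreeAlgebra.ι k (1, 1) * FreeAlgebra.ι k (1, 0)))
  | bc : OqM2Rel q (FreeAlgebra.ι k (0, 1) * FreeAlgebra.ι k (1, 0))
      (FreeAlgebra.ι k (1, 0) * FreeAlgebra.ι k (0, 1))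
  | ad : OqM2Rel q
      (FreeAlgebra.ι k (0, 0) * FreeAlgebra.ι k (1, 1)
        - FreeAlgebra.ι k (1, 1) * FreeAlgebra.ι k (0, 0))
      ((q - q⁻¹) • (FreeAlgebra.ι k (0, 1) * FreeAlgebra.ι k (1, 0)))

/-- The algebra `O_q(M₂(k))`. -/
abbrev OqM2 {k : Type*} [Field k] (q : k) : Type _ := RingQuot (OqM2Rel q)

namespace OqM2

open NCRing

variable {k : Type*} [Field k] (q : k)

/-- The generators of `O_q(M₂(k))`. -/
def X (i j : Fin 2) : OqM2 q := RingQuot.mkAlgHom k (OqM2Rel q) (FreeAlgebra.ι k (i, j))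

/-- The generator `a`. -/
abbrev a : OqM2 q := X q 0 0
/-- The generator `b`. -/
abbrev b : OqM2 q := X q 0 1
/-- The generator `c`. -/
abbrev c : OqM2 q := X q 1 0
/-- The generator `d`. -/
abbrev d : OqM2 q := X q 1 1

/-- The quantum determinant `Δ = ad - q bc`. -/
def Δ : OqM2 q := a q * d q - q • (b q * c q)

/-- The ideal `⟨Δ⟩`. -/
def detIdeal : TwoSidedIdeal (OqM2 q) := TwoSidedIdeal.span {Δ q}

variable (k) in
/-- The torus `H = (kˣ)⁴`, with elements `(α₁, α₂, β₁, β₂)` written as pairs `(α, β)`. -/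
abbrev Torus : Type _ := (Fin 2 → kˣ) × (Fin 2 → kˣ)

/-- The algebra endomorphism of `O_q(M₂(k))` with `X i j ↦ α i β j X i j`. -/
def torusEnd (h : Torus k) : OqM2 q →ₐ[k] OqM2 q :=
  RingQuot.liftAlgHom k ⟨FreeAlgebra.lift k
      fun p : Fin 2 × Fin 2 => ((h.1 p.1 : k) * (h.2 p.2 : k)) • X q p.1 p.2, by
    intro x y hxy
    have key : ∀ {x y : FreeAlgebra k (Fin 2 × Fin 2)}, OqM2Rel q x y →
        RingQuot.mkAlgHom k (OqM2Rel q) x = RingQuot.mkAlgHom k (OqM2Rel q) y :=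
      fun h => RingQuot.mkAlgHom_rel k h
    have hab := key (OqM2Rel.ab (q := q))
    have hac := key (OqM2Rel.ac (q := q))
    have hbd := key (OqM2Rel.bd (q := q))
    have hcd := key (OqM2Rel.cd (q := q))
    have hbc := key (OqM2Rel.bc (q := q))
    have had := key (OqM2Rel.ad (q := q))
    simp only [map_mul, map_smul, map_sub] at hab hac hbd hcd hbc had
    cases hxy <;>
      simp only [map_mul, map_smul, map_sub, FreeAlgebra.lift_ι_apply, X,
        smul_mul_smul_comm, hab, hac, hbd, hcd, hbc]
    · module
    · module
    · module
    · module
    · module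
    · rw [sub_eq_iff_eq_add] at had
      rw [had, hbc]
      module⟩

@[simp] theorem torusEnd_X (h : Torus k) (i j : Fin 2) :
    torusEnd q h (X q i j) = ((h.1 i : k) * (h.2 j : k)) • X q i j := by
  conv_lhs => rw [X]
  simp [torusEnd]

theorem hom_ext {f g : OqM2 q →ₐ[k] OqM2 q} (h : ∀ i j, f (X q i j) = g (X q i j)) : f = g := by
  apply RingQuot.ringQuot_ext'
  apply FreeAlgebra.hom_ext
  funext p
  exact h p.1 p.2

/-- The action of the torus `H = (kˣ)⁴` on `O_q(M₂(k))` by algebra automorphisms,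
`(α, β) . X i j = α i β j X i j`. -/
def torusAction : Torus k →* (OqM2 q ≃ₐ[k] OqM2 q) :=
  (AlgEquiv.algHomUnitsEquiv k (OqM2 q)).toMonoidHom.comp <| MonoidHom.toHomUnits
    { toFun := torusEnd q
      map_one' := hom_ext q fun i j => by simp
      map_mul' := fun g h => hom_ext q fun i j => by
        simp only [torusEnd_X, AlgHom.mul_apply, map_smul, smul_smul, Prod.fst_mul, Prod.snd_mul,
          Pi.mul_apply, Units.val_mul]
        congr 1
        ring }

theorem torusAction_X (h : Torus k) (i j : Fin 2) :
    torusAction q h (X q i j) = ((h.1 i : k) * (h.2 j : k)) • X q i j :=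
  torusEnd_X q h i j

variable {q}

/-- The `H`-primes: prime ideals stable under the torus `H`. -/
def IsHPrime (P : TwoSidedIdeal (OqM2 q)) : Prop :=
  IsPrimeIdeal P ∧ ∀ h : Torus k, ∀ x ∈ P, torusAction q h x ∈ P

/-- The `J`-stratum: the prime ideals `P` such that the intersection of all `h . P`, for
`h ∈ H`, equals `J`. -/
def stratum (J : TwoSidedIdeal (OqM2 q)) : Set (TwoSidedIdeal (OqM2 q)) :=
  {P | IsPrimeIdeal P ∧ ⨅ h : Torus k, P.comap (torusAction q h⁻¹) = J}

end OqM2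

end

/-!
Write `A` for `O_q(M₂(k))`. Everything rests on a description of the primes of `A`, which is obtained
from the commutation rules and from homomorphisms to quantum planes.

*Completely prime ideals.* The quantum plane `D⟨x^{±1}, y⟩`, `x y = q y x`, over a commutative
domain `D` is a domain. There is a homomorphism from `A` to it with `a ↦ x`, `b ↦ Y y`, `c ↦ y` and
`Δ ↦ δ`, for any `δ, Y ∈ D` (`evalPlane`). Each element of `A` is a sum of terms
`homog m h * gwaGen i`, where `gwaGen i` is a power of `a` or of `d`, and `homog m h` is the
homogenization, of degree `m` in `b` and `c`, of a polynomial `h ∈ k[Δ][Y]` (`exists_normalForm`).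
Unless `δ = Y = 0`, such a sum is in the kernel if and only if all the `h` vanish at `(δ, Y)`
(`evalPlane_normalForm_eq_zero`). This identifies as kernels
the zero ideal, the ideals generated by the homogenization of an irreducible polynomial, `⟨Δ⟩`,
`⟨Δ, b - t c⟩` and `⟨b, Δ - t⟩` for `t ≠ 0`. The ideals `genIdeal q G` generated by a set `G` of
generators, one of them `b` or `c`, are kernels of similar homomorphisms
(`exists_toPlane_ker_eq_genIdeal`).

*Primes that contain neither `b` nor `c`.* Such a prime `P` contains, with an element, all the
coefficients `homog m h` of its normal form (`homog_mem_of_sum_mem`): the commutation with `c`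
separates the powers of `a` and `d`, that with `a` or `d` separates the degrees `m`, since `q` is not
a root of unity. So `P` is zero or contains the homogenization of an irreducible polynomial; if
`P` is strictly above `⟨Δ⟩`, it contains some `b - t c`, as `k` is algebraically closed; if `P` is
stable under the torus, it is `0` or `⟨Δ⟩` (`IsHPrime.eq_bot_or_eq_detIdeal`).

*Primes that contain `b` or `c`.* Modulo such a prime all four generators are normal. If in addition
`P` is stable under the torus, the weights of the torus separate the monomials in the
generators outside `P`, so `P` is generated by generators of `A` (`IsHPrime.eq_genIdeal`). Hence the
`H`-primes are `0`, `⟨Δ⟩` and the `genIdeal q G`.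

*Unique factorization.* For `J ≠ ⟨Δ⟩` each prime strictly above `J` contains an element that is
normal modulo `J` and generates a completely prime ideal together with `J`: if `J = 0`, one of
`b`, `c` or the homogenization of an irreducible polynomial (`isNoncommUFD_factor_bot`) and, if
`J = genIdeal q G`, a generator of `A`, a lift of a prime element of a commutative polynomial ring
`A / J`, or some `Δ - t` (`isNoncommUFD_factor_genIdeal`). In a
noncommutative UFD the primes of height one are generated by normal elements.

*Over the determinant.* A prime strictly above `⟨Δ⟩` contains some `⟨Δ, b - t c⟩` or, because
`a d = Δ + q b c`, one of the four ideals generated by a row or a column. These ideals form an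
antichain, so they are the primes of height one modulo `⟨Δ⟩`
(`heightOnePrimes_factor_detIdeal`). The former are generated by the normal elements
`b - t c`. The latter are not generated by a normal element modulo `⟨Δ⟩`, because two of the
generators have independent linear terms, whereas `Δ` has none
(`not_isGeneratedByNormal_genIdeal_pair`). The torus moves `b - t c` to multiples of all the other
`b - s c`, and the intersection of the ideals `⟨Δ, b - s c⟩` is `⟨Δ⟩`.
-/

noncomputable section

/-! ### Ideals, normal elements and heights in noncommutative rings -/

namespace NCRing

variable {R : Type*} [Ring R]

/-- A completely prime ideal: the factor ring is a domain. -/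
def IsCompletelyPrime (I : TwoSidedIdeal R) : Prop :=
  I ≠ ⊤ ∧ ∀ x y : R, x * y ∈ I → x ∈ I ∨ y ∈ I

/-- `u` is normal modulo `J`: the image of `u` in `R / J` is a normal element. -/
def IsNormalModulo (J : TwoSidedIdeal R) (u : R) : Prop :=
  ∀ r, (∃ r', u * r - r' * u ∈ J) ∧ ∃ r', r * u - u * r' ∈ J

theorem mk'_eq_zero {J : TwoSidedIdeal R} {x : R} : J.ringCon.mk' x = 0 ↔ x ∈ J := by
  rw [← TwoSidedIdeal.mem_ker, TwoSidedIdeal.ker_ringCon_mk']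

theorem IsCompletelyPrime.isPrimeIdeal {I : TwoSidedIdeal R} (h : IsCompletelyPrime I) :
    IsPrimeIdeal I :=
  ⟨h.1, fun x y hxy => h.2 x y (by simpa using hxy 1)⟩

theorem isCompletelyPrime_ker {S : Type*} [Ring S] [IsDomain S] (f : R →+* S) :
    IsCompletelyPrime (TwoSidedIdeal.ker f) := by
  refine ⟨fun h => ?_, fun x y hxy => ?_⟩
  · have : (1 : R) ∈ TwoSidedIdeal.ker f := h ▸ trivial
    simp [TwoSidedIdeal.mem_ker] at this
  · simpa [TwoSidedIdeal.mem_ker] using hxy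

theorem isDomain_factor_iff {I : TwoSidedIdeal R} :
    IsDomain (Factor I) ↔ IsCompletelyPrime I := by
  constructor
  · intro h
    have := isCompletelyPrime_ker I.ringCon.mk'
    rwa [TwoSidedIdeal.ker_ringCon_mk'] at this
  · rintro ⟨h1, h2⟩
    have : Nontrivial (Factor I) := by
      refine ⟨⟨I.ringCon.mk' 1, 0, fun h => h1 ?_⟩⟩
      rw [mk'_eq_zero] at h
      exact (TwoSidedIdeal.one_mem_iff I).1 h
    have : NoZeroDivisors (Factor I) := by
      refine ⟨fun {x y} hxy => ?_⟩
      obtain ⟨x, rfl⟩ := I.ringCon.mk'_surjective x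
      obtain ⟨y, rfl⟩ := I.ringCon.mk'_surjective y
      rw [← map_mul] at hxy
      simp only [mk'_eq_zero] at hxy ⊢
      exact h2 x y hxy
    exact NoZeroDivisors.to_isDomain _

theorem comap_factorIdeal {J K : TwoSidedIdeal R} (h : J ≤ K) :
    (factorIdeal J K).comap J.ringCon.mk' = K := by
  apply le_antisymm
  · intro x hx
    rw [TwoSidedIdeal.mem_comap, factorIdeal, TwoSidedIdeal.map] at hx
    -- the image of `K` under the surjection `R → R / J` is already an ideal
    let I : TwoSidedIdeal (Factor J) := TwoSidedIdeal.mk' (J.ringCon.mk' '' (K : Set R))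
      ⟨0, K.zero_mem, map_zero _⟩
      (by rintro _ _ ⟨a, ha, rfl⟩ ⟨b, hb, rfl⟩; exact ⟨a + b, K.add_mem ha hb, map_add _ _ _⟩)
      (by rintro _ ⟨a, ha, rfl⟩; exact ⟨-a, K.neg_mem ha, map_neg _ _⟩)
      (by
        rintro r _ ⟨a, ha, rfl⟩
        obtain ⟨r, rfl⟩ := J.ringCon.mk'_surjective r
        exact ⟨r * a, K.mul_mem_left _ _ ha, map_mul _ _ _⟩)
      (by
        rintro _ r ⟨a, ha, rfl⟩
        obtain ⟨r, rfl⟩ := J.ringCon.mk'_surjective r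
        exact ⟨a * r, K.mul_mem_right _ _ ha, map_mul _ _ _⟩)
    have hI := (TwoSidedIdeal.mem_span_iff.1 hx) I (by
      intro y hy
      simpa [I, TwoSidedIdeal.mem_mk'] using! hy)
    obtain ⟨a, ha, hax⟩ := (TwoSidedIdeal.mem_mk' _ _ _ _ _ _ _).1 hI
    have hd : a - x ∈ J := by rw [← mk'_eq_zero, map_sub, hax, sub_self]
    have := K.sub_mem ha (h hd)
    simpa using this
  · intro x hx
    exact TwoSidedIdeal.subset_span ⟨x, hx, rfl⟩

theorem mk'_mem_factorIdeal {J K : TwoSidedIdeal R} (h : J ≤ K) {x : R} :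
    J.ringCon.mk' x ∈ factorIdeal J K ↔ x ∈ K := by
  rw [← TwoSidedIdeal.mem_comap J.ringCon.mk', comap_factorIdeal h]

theorem le_comap_mk' {J : TwoSidedIdeal R} (Q : TwoSidedIdeal (Factor J)) :
    J ≤ Q.comap J.ringCon.mk' := by
  intro x hx
  rw [TwoSidedIdeal.mem_comap, mk'_eq_zero.2 hx]
  exact Q.zero_mem

theorem factorIdeal_comap {J : TwoSidedIdeal R} (Q : TwoSidedIdeal (Factor J)) :
    factorIdeal J (Q.comap J.ringCon.mk') = Q := by
  apply TwoSidedIdeal.ext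
  intro x
  obtain ⟨x, rfl⟩ := J.ringCon.mk'_surjective x
  rw [mk'_mem_factorIdeal (le_comap_mk' Q), TwoSidedIdeal.mem_comap]

theorem factorIdeal_le_iff {J K L : TwoSidedIdeal R} (hK : J ≤ K) (hL : J ≤ L) :
    factorIdeal J K ≤ factorIdeal J L ↔ K ≤ L := by
  constructor
  · intro h x hx
    exact (mk'_mem_factorIdeal hL).1 (h ((mk'_mem_factorIdeal hK).2 hx))
  · intro h x hx
    obtain ⟨x, rfl⟩ := J.ringCon.mk'_surjective x
    exact (mk'_mem_factorIdeal hL).2 (h ((mk'_mem_factorIdeal hK).1 hx))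

theorem factorIdeal_inj {J K L : TwoSidedIdeal R} (hK : J ≤ K) (hL : J ≤ L)
    (h : factorIdeal J K = factorIdeal J L) : K = L :=
  le_antisymm ((factorIdeal_le_iff hK hL).1 h.le) ((factorIdeal_le_iff hL hK).1 h.ge)

theorem factorIdeal_eq_bot_iff {J K : TwoSidedIdeal R} (h : J ≤ K) :
    factorIdeal J K = ⊥ ↔ K = J := by
  constructor
  · intro hb
    refine le_antisymm (fun x hx => ?_) h
    rw [← mk'_mem_factorIdeal h, hb, TwoSidedIdeal.mem_bot, mk'_eq_zero] at hx
    exact hx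
  · rintro rfl
    apply le_antisymm _ bot_le
    intro x hx
    obtain ⟨x, rfl⟩ := K.ringCon.mk'_surjective x
    rw [mk'_mem_factorIdeal le_rfl] at hx
    rw [TwoSidedIdeal.mem_bot, mk'_eq_zero]
    exact hx

theorem isPrimeIdeal_comap_mk' {J : TwoSidedIdeal R} {Q : TwoSidedIdeal (Factor J)} :
    IsPrimeIdeal (Q.comap J.ringCon.mk') ↔ IsPrimeIdeal Q := by
  have key : Q.comap J.ringCon.mk' = ⊤ ↔ Q = ⊤ := by
    rw [← TwoSidedIdeal.one_mem_iff, ← TwoSidedIdeal.one_mem_iff, TwoSidedIdeal.mem_comap, map_one]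
  refine and_congr (not_congr key) ⟨fun h x y hxy => ?_, fun h x y hxy => ?_⟩
  · obtain ⟨x, rfl⟩ := J.ringCon.mk'_surjective x
    obtain ⟨y, rfl⟩ := J.ringCon.mk'_surjective y
    exact h x y fun r => by simpa [TwoSidedIdeal.mem_comap] using! hxy (J.ringCon.mk' r)
  · simp only [TwoSidedIdeal.mem_comap] at hxy ⊢
    refine h _ _ fun r => ?_
    obtain ⟨r, rfl⟩ := J.ringCon.mk'_surjective r
    simpa using hxy r

theorem isPrimeIdeal_factorIdeal {J K : TwoSidedIdeal R} (h : J ≤ K) :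
    IsPrimeIdeal (factorIdeal J K) ↔ IsPrimeIdeal K := by
  rw [← isPrimeIdeal_comap_mk', comap_factorIdeal h]

theorem isCompletelyPrime_comap_mk' {J : TwoSidedIdeal R} {Q : TwoSidedIdeal (Factor J)} :
    IsCompletelyPrime (Q.comap J.ringCon.mk') ↔ IsCompletelyPrime Q := by
  have key : Q.comap J.ringCon.mk' = ⊤ ↔ Q = ⊤ := by
    rw [← TwoSidedIdeal.one_mem_iff, ← TwoSidedIdeal.one_mem_iff, TwoSidedIdeal.mem_comap, map_one]
  refine and_congr (not_congr key) ⟨fun h x y hxy => ?_, fun h x y hxy => ?_⟩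
  · obtain ⟨x, rfl⟩ := J.ringCon.mk'_surjective x
    obtain ⟨y, rfl⟩ := J.ringCon.mk'_surjective y
    exact h x y (by simpa [TwoSidedIdeal.mem_comap] using! hxy)
  · simp only [TwoSidedIdeal.mem_comap] at hxy ⊢
    exact h _ _ (by simpa using hxy)

theorem IsCompletelyPrime.comap {S : Type*} [Ring S] {I : TwoSidedIdeal S}
    (h : IsCompletelyPrime I) (f : R →+* S) : IsCompletelyPrime (I.comap f) := by
  refine ⟨fun hI => h.1 ?_, fun x y hxy => ?_⟩
  · rw [← TwoSidedIdeal.one_mem_iff] at hI ⊢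
    rwa [TwoSidedIdeal.mem_comap, map_one] at hI
  · simp only [TwoSidedIdeal.mem_comap, map_mul] at hxy ⊢
    exact h.2 _ _ hxy

theorem IsPrimeIdeal.comap {S : Type*} [Ring S] {I : TwoSidedIdeal S}
    (h : IsPrimeIdeal I) (f : R →+* S) (hf : Function.Surjective f) :
    IsPrimeIdeal (I.comap f) := by
  refine ⟨fun hI => h.1 ?_, fun x y hxy => ?_⟩
  · rw [← TwoSidedIdeal.one_mem_iff] at hI ⊢
    rwa [TwoSidedIdeal.mem_comap, map_one] at hI
  · simp only [TwoSidedIdeal.mem_comap, map_mul] at hxy ⊢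
    refine h.2 _ _ fun r => ?_
    obtain ⟨r, rfl⟩ := hf r
    exact hxy r

theorem span_singleton_sup_span_singleton (x y : R) :
    TwoSidedIdeal.span {x} ⊔ TwoSidedIdeal.span {y} = TwoSidedIdeal.span {x, y} := by
  apply le_antisymm
  · exact sup_le (TwoSidedIdeal.span_mono (by simp)) (TwoSidedIdeal.span_mono (by simp))
  · refine TwoSidedIdeal.span_le.2 ?_
    rintro _ (rfl | rfl)
    · exact TwoSidedIdeal.mem_sup_left (TwoSidedIdeal.subset_span rfl)
    · exact TwoSidedIdeal.mem_sup_right (TwoSidedIdeal.subset_span rfl)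

theorem comap_span_mk' (J : TwoSidedIdeal R) (p : R) :
    (TwoSidedIdeal.span {J.ringCon.mk' p}).comap J.ringCon.mk' = J ⊔ TwoSidedIdeal.span {p} := by
  have hJ : J ≤ J ⊔ TwoSidedIdeal.span {p} := le_sup_left
  apply le_antisymm
  · rw [← comap_factorIdeal hJ]
    apply TwoSidedIdeal.comap_le_comap
    rw [TwoSidedIdeal.span_le]
    rintro _ rfl
    exact (mk'_mem_factorIdeal hJ).2
      ((le_sup_right : _ ≤ J ⊔ TwoSidedIdeal.span {p}) (TwoSidedIdeal.subset_span rfl))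
  · refine sup_le (le_comap_mk' _) ?_
    rw [TwoSidedIdeal.span_le]
    rintro _ rfl
    exact TwoSidedIdeal.subset_span rfl

theorem factorIdeal_sup_span (J : TwoSidedIdeal R) (p : R) :
    factorIdeal J (J ⊔ TwoSidedIdeal.span {p}) = TwoSidedIdeal.span {J.ringCon.mk' p} := by
  rw [← comap_span_mk', factorIdeal_comap]

theorem IsNormalElement.exists_right {u : R} (h : IsNormalElement u) (r : R) :
    ∃ r', r * u = u * r' := by
  have : r * u ∈ Set.range (fun r : R => u * r) := h ▸ ⟨r, rfl⟩
  obtain ⟨r', h'⟩ := this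
  exact ⟨r', h'.symm⟩

theorem isNormalElement_of {u : R} (h1 : ∀ r, ∃ r', u * r = r' * u)
    (h2 : ∀ r, ∃ r', r * u = u * r') : IsNormalElement u := by
  apply Set.Subset.antisymm
  · rintro _ ⟨r, rfl⟩
    obtain ⟨r', h⟩ := h1 r
    exact ⟨r', h.symm⟩
  · rintro _ ⟨r, rfl⟩
    obtain ⟨r', h⟩ := h2 r
    exact ⟨r', h.symm⟩

theorem isNormalElement_mk' {J : TwoSidedIdeal R} {u : R} (h : IsNormalModulo J u) :
    IsNormalElement (J.ringCon.mk' u) := by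
  apply isNormalElement_of
  · intro r
    obtain ⟨r, rfl⟩ := J.ringCon.mk'_surjective r
    obtain ⟨r', h'⟩ := (h r).1
    refine ⟨J.ringCon.mk' r', ?_⟩
    rw [← mk'_eq_zero] at h'
    simpa [sub_eq_zero] using h'
  · intro r
    obtain ⟨r, rfl⟩ := J.ringCon.mk'_surjective r
    obtain ⟨r', h'⟩ := (h r).2
    refine ⟨J.ringCon.mk' r', ?_⟩
    rw [← mk'_eq_zero] at h'
    simpa [sub_eq_zero] using h'

theorem IsNormalModulo.mono {J K : TwoSidedIdeal R} {u : R} (h : IsNormalModulo J u) (hJK : J ≤ K) :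
    IsNormalModulo K u := fun r =>
  ⟨(h r).1.imp fun _ h => hJK h, (h r).2.imp fun _ h => hJK h⟩

/-- The elements of the ideal generated by a normal element `u` are the multiples `u r`. -/
theorem IsNormalElement.exists_of_mem_span {u x : R} (hu : IsNormalElement u)
    (hx : x ∈ TwoSidedIdeal.span {u}) : ∃ r, x = u * r := by
  induction hx using TwoSidedIdeal.span_induction with
  | mem x h => exact ⟨1, by simpa using h⟩
  | zero => exact ⟨0, by simp⟩
  | add x y _ _ hx hy =>
    obtain ⟨r, rfl⟩ := hx
    obtain ⟨s, rfl⟩ := hy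
    exact ⟨r + s, by rw [mul_add]⟩
  | neg x _ hx =>
    obtain ⟨r, rfl⟩ := hx
    exact ⟨-r, by simp⟩
  | left_absorb a x _ hx =>
    obtain ⟨r, rfl⟩ := hx
    obtain ⟨s, hs⟩ := hu.exists_right a
    exact ⟨s * r, by rw [← mul_assoc, hs, mul_assoc]⟩
  | right_absorb a x _ hx =>
    obtain ⟨r, rfl⟩ := hx
    exact ⟨r * a, by rw [mul_assoc]⟩

/-- An element that is normal modulo a prime ideal `P` and lies outside `P` can be cancelled on the
left, modulo `P`. -/
theorem IsNormalModulo.mem_of_mul_mem_left {P : TwoSidedIdeal R} (hP : IsPrimeIdeal P) {u w : R}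
    (hu : IsNormalModulo P u) (huP : u ∉ P) (h : u * w ∈ P) : w ∈ P := by
  refine (hP.2 u w fun r => ?_).resolve_left huP
  obtain ⟨r', hr⟩ := (hu r).1
  have := P.add_mem (P.mul_mem_right _ w hr) (P.mul_mem_left r' _ h)
  simpa [sub_mul, mul_assoc] using this

/-- An element that is normal modulo a prime ideal `P` and lies outside `P` can be cancelled on the
right, modulo `P`. -/
theorem IsNormalModulo.mem_of_mul_mem_right {P : TwoSidedIdeal R} (hP : IsPrimeIdeal P) {u w : R}
    (hu : IsNormalModulo P u) (huP : u ∉ P) (h : w * u ∈ P) : w ∈ P := by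
  refine (hP.2 w u fun r => ?_).resolve_right huP
  obtain ⟨r', hr⟩ := (hu r).2
  have := P.add_mem (P.mul_mem_left w _ hr) (P.mul_mem_right _ r' h)
  simpa [mul_sub, mul_assoc] using this

theorem isPrimeIdeal_bot_factor {J : TwoSidedIdeal R} (hJ : IsPrimeIdeal J) :
    IsPrimeIdeal (⊥ : TwoSidedIdeal (Factor J)) := by
  rw [← (factorIdeal_eq_bot_iff (le_refl J)).2 rfl, isPrimeIdeal_factorIdeal le_rfl]
  exact hJ

/-- A prime of height one in a prime ring contains no other nonzero prime. -/
theorem eq_of_le_of_height_eq_one (h0 : IsPrimeIdeal (⊥ : TwoSidedIdeal R))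
    {P Q : TwoSidedIdeal R} (hP : IsPrimeIdeal P) (hQ : IsPrimeIdeal Q) (hht : height P = 1)
    (hQ0 : Q ≠ ⊥) (hQP : Q ≤ P) : Q = P := by
  by_contra hne
  have h1 := Order.height_add_one_le (a := (⟨⊥, h0⟩ : PrimeSpec R)) (b := ⟨Q, hQ⟩)
    (Subtype.mk_lt_mk.2 (bot_lt_iff_ne_bot.2 hQ0))
  have h2 := Order.height_add_one_le (a := (⟨Q, hQ⟩ : PrimeSpec R)) (b := ⟨P, hP⟩)
    (Subtype.mk_lt_mk.2 (lt_of_le_of_ne hQP hne))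
  rw [← height_eq ⟨P, hP⟩, hht] at h2
  have h3 : (1 : ℕ∞) + 1 ≤ 1 :=
    le_trans (add_le_add_left (le_trans (by simp) h1) 1) h2
  exact absurd h3 (by decide)

/-- A nonzero prime of a prime ring that contains no other nonzero prime has height one. -/
theorem height_eq_one_of_minimal (h0 : IsPrimeIdeal (⊥ : TwoSidedIdeal R))
    {P : TwoSidedIdeal R} (hP : IsPrimeIdeal P) (hP0 : P ≠ ⊥)
    (hmin : ∀ Q, IsPrimeIdeal Q → Q ≠ ⊥ → Q ≤ P → Q = P) : height P = 1 := by
  rw [height_eq ⟨P, hP⟩]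
  apply le_antisymm
  · refine Order.height_le_coe_iff.2 fun Q hQ => ?_
    have hQ0 : Q.1 = ⊥ := by
      by_contra hne
      exact hQ.ne (Subtype.ext (hmin Q.1 Q.2 hne hQ.le))
    have : Order.height Q = 0 := by
      rw [Order.height_eq_zero]
      intro T _
      change Q.1 ≤ T.1
      rw [hQ0]
      exact bot_le
    rw [this]
    exact zero_lt_one
  · have h1 := Order.height_add_one_le (a := (⟨⊥, h0⟩ : PrimeSpec R)) (b := ⟨P, hP⟩)
      (Subtype.mk_lt_mk.2 (bot_lt_iff_ne_bot.2 hP0))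
    exact le_trans (by simp) h1

/-- In a prime ring, an antichain of nonzero primes such that each nonzero prime contains one of
its members is the set of all primes of height one. -/
theorem heightOnePrimes_eq (h0 : IsPrimeIdeal (⊥ : TwoSidedIdeal R)) (𝓛 : Set (TwoSidedIdeal R))
    (hprime : ∀ P ∈ 𝓛, IsPrimeIdeal P) (hne : ∀ P ∈ 𝓛, P ≠ ⊥)
    (hanti : ∀ P ∈ 𝓛, ∀ Q ∈ 𝓛, P ≤ Q → P = Q)
    (hcof : ∀ P, IsPrimeIdeal P → P ≠ ⊥ → ∃ Q ∈ 𝓛, Q ≤ P) : heightOnePrimes R = 𝓛 := by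
  ext P
  constructor
  · rintro ⟨hP, hht⟩
    have hP0 : P ≠ ⊥ := by
      rintro rfl
      have : Order.height (⟨⊥, h0⟩ : PrimeSpec R) = 0 :=
        Order.height_eq_zero.2 fun T _ => show (⊥ : TwoSidedIdeal R) ≤ T.1 from bot_le
      rw [height_eq ⟨⊥, h0⟩, this] at hht
      exact absurd hht (by decide)
    obtain ⟨Q, hQ, hQP⟩ := hcof P hP hP0
    rwa [← eq_of_le_of_height_eq_one h0 hP (hprime Q hQ) hht (hne Q hQ) hQP]
  · intro hP
    refine ⟨hprime P hP, height_eq_one_of_minimal h0 (hprime P hP) (hne P hP) fun Q hQ hQ0 hQP => ?_⟩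
    obtain ⟨T, hT, hTQ⟩ := hcof Q hQ hQ0
    have := hanti T hT P hP (hTQ.trans hQP)
    exact le_antisymm hQP (this ▸ hTQ)

/-- The primes of height one over a prime `J` are the members of any antichain of primes above `J`
that is coinitial among the primes strictly above `J`. -/
theorem heightOnePrimes_factor_eq {J : TwoSidedIdeal R} (hJ : IsPrimeIdeal J)
    (𝓚 : Set (TwoSidedIdeal R)) (hprime : ∀ K ∈ 𝓚, IsPrimeIdeal K) (hlt : ∀ K ∈ 𝓚, J < K)
    (hanti : ∀ K ∈ 𝓚, ∀ L ∈ 𝓚, K ≤ L → K = L)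
    (hcof : ∀ P, IsPrimeIdeal P → J < P → ∃ K ∈ 𝓚, K ≤ P) :
    heightOnePrimes (Factor J) = factorIdeal J '' 𝓚 := by
  refine heightOnePrimes_eq (isPrimeIdeal_bot_factor hJ) _ ?_ ?_ ?_ ?_
  · rintro _ ⟨K, hK, rfl⟩
    exact (isPrimeIdeal_factorIdeal (hlt K hK).le).2 (hprime K hK)
  · rintro _ ⟨K, hK, rfl⟩
    rw [Ne, factorIdeal_eq_bot_iff (hlt K hK).le]
    exact (hlt K hK).ne'
  · rintro _ ⟨K, hK, rfl⟩ _ ⟨L, hL, rfl⟩ h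
    rw [hanti K hK L hL ((factorIdeal_le_iff (hlt K hK).le (hlt L hL).le).1 h)]
  · intro Q hQ hQ0
    have hle := le_comap_mk' Q
    obtain ⟨K, hK, hKQ⟩ := hcof _ (isPrimeIdeal_comap_mk'.2 hQ) (lt_of_le_of_ne hle fun h => hQ0 (by
      rw [← factorIdeal_comap Q, factorIdeal_eq_bot_iff hle, ← h]))
    refine ⟨_, ⟨K, hK, rfl⟩, ?_⟩
    rw [← factorIdeal_comap Q]
    exact (factorIdeal_le_iff (hlt K hK).le hle).2 hKQ

/-- A criterion for `R / J` to be a noncommutative UFD, in terms of ideals of `R`. -/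
theorem isNoncommUFD_factor {J : TwoSidedIdeal R} (hJ : IsCompletelyPrime J)
    (h : ∀ P, IsPrimeIdeal P → J < P →
      ∃ p ∈ P, p ∉ J ∧ IsNormalModulo J p ∧ IsCompletelyPrime (J ⊔ TwoSidedIdeal.span {p})) :
    IsNoncommUFD (Factor J) := by
  refine ⟨isDomain_factor_iff.2 hJ, fun Q hQ hQ0 => ?_⟩
  have hlt : J < Q.comap J.ringCon.mk' := by
    refine lt_of_le_of_ne (le_comap_mk' Q) fun he => hQ0 ?_
    rw [← factorIdeal_comap Q, ← he]
    exact (factorIdeal_eq_bot_iff le_rfl).2 rfl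
  obtain ⟨p, hpQ, hpJ, hpn, hpc⟩ := h _ (isPrimeIdeal_comap_mk'.2 hQ) hlt
  refine ⟨J.ringCon.mk' p, hpQ, fun h => hpJ (mk'_eq_zero.1 h), isNormalElement_mk' hpn, ?_⟩
  rw [isDomain_factor_iff, ← isCompletelyPrime_comap_mk', comap_span_mk']
  exact hpc

/-- In a noncommutative UFD, the primes of height one are generated by normal elements. -/
theorem IsNoncommUFD.isGeneratedByNormal (hR : IsNoncommUFD R) {P : TwoSidedIdeal R}
    (hP : IsPrimeIdeal P) (hP0 : P ≠ ⊥) (hht : height P = 1) : IsGeneratedByNormal P := by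
  have h0 : IsPrimeIdeal (⊥ : TwoSidedIdeal R) := by
    have := hR.1
    refine ⟨fun h => one_ne_zero (α := R) ?_, fun x y hxy => ?_⟩
    · rw [← TwoSidedIdeal.mem_bot, h]
      trivial
    · simpa [TwoSidedIdeal.mem_bot] using hxy 1
  obtain ⟨p, hpP, hp0, hpn, hpd⟩ := hR.2 P hP hP0
  refine ⟨p, hpn, eq_of_le_of_height_eq_one h0 hP (isDomain_factor_iff.1 hpd).isPrimeIdeal hht
    (fun h => hp0 ?_) ?_⟩
  · rw [← TwoSidedIdeal.mem_bot, ← h]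
    exact TwoSidedIdeal.subset_span rfl
  · rw [TwoSidedIdeal.span_le]
    rintro _ rfl
    exact hpP

/-- `J` is generated by a polynormal regular sequence. -/
def HasPolynormalRegularSeq (J : TwoSidedIdeal R) : Prop :=
  ∃ (n : ℕ) (u : Fin n → R), IsPolynormalRegularSeq u ∧ TwoSidedIdeal.span (Set.range u) = J

theorem hasPolynormalRegularSeq_bot : HasPolynormalRegularSeq (⊥ : TwoSidedIdeal R) := by
  refine ⟨0, Fin.elim0, fun i => i.elim0, ?_⟩
  rw [eq_bot_iff, TwoSidedIdeal.span_le]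
  rintro _ ⟨i, _⟩
  exact i.elim0

/-- A polynormal regular sequence generating a completely prime ideal `J` can be prolonged by any
element outside `J` that is normal modulo `J`: it is regular, as `R / J` is a domain. -/
theorem HasPolynormalRegularSeq.sup_span {J : TwoSidedIdeal R} (h : HasPolynormalRegularSeq J)
    (hJ : IsCompletelyPrime J) {v : R} (hv : v ∉ J) (hvn : IsNormalModulo J v) :
    HasPolynormalRegularSeq (J ⊔ TwoSidedIdeal.span {v}) := by
  obtain ⟨n, u, hu, hJu⟩ := h
  have himg : ∀ i : Fin n, (Fin.snoc u v : Fin (n + 1) → R) '' {j | j < i.castSucc} =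
      u '' {j | j < i} := by
    intro i
    ext x
    constructor
    · rintro ⟨j, hj, rfl⟩
      have hj' : j.val < n := lt_trans (Fin.lt_def.1 hj) i.2
      obtain ⟨j, rfl⟩ : ∃ j' : Fin n, j = j'.castSucc := ⟨⟨j, hj'⟩, rfl⟩
      exact ⟨j, by simpa using! hj, by simp⟩
    · rintro ⟨j, hj, rfl⟩
      exact ⟨j.castSucc, by simpa using! hj, by simp⟩
  have hlast : (Fin.snoc u v : Fin (n + 1) → R) '' {j | j < Fin.last n} = Set.range u := by
    ext x
    constructor
    · rintro ⟨j, hj, rfl⟩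
      obtain ⟨j, rfl⟩ : ∃ j' : Fin n, j = j'.castSucc := ⟨⟨j, Fin.lt_def.1 hj⟩, rfl⟩
      exact ⟨j, by simp⟩
    · rintro ⟨j, rfl⟩
      exact ⟨j.castSucc, Fin.castSucc_lt_last j, by simp⟩
  refine ⟨n + 1, Fin.snoc u v, fun i => ?_, ?_⟩
  · induction i using Fin.lastCases with
    | cast i =>
      rw [himg i, Fin.snoc_castSucc]
      exact hu i
    | last =>
      rw [hlast, Fin.snoc_last, hJu]
      have := isDomain_factor_iff.2 hJ
      exact ⟨IsRegular.of_ne_zero fun h => hv (mk'_eq_zero.1 h), isNormalElement_mk' hvn⟩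
  · rw [← hJu]
    apply le_antisymm
    · rw [TwoSidedIdeal.span_le]
      rintro _ ⟨i, rfl⟩
      induction i using Fin.lastCases with
      | cast i =>
        rw [Fin.snoc_castSucc]
        exact TwoSidedIdeal.mem_sup_left (TwoSidedIdeal.subset_span ⟨i, rfl⟩)
      | last =>
        rw [Fin.snoc_last]
        exact TwoSidedIdeal.mem_sup_right (TwoSidedIdeal.subset_span rfl)
    · refine sup_le (TwoSidedIdeal.span_mono ?_) (TwoSidedIdeal.span_mono ?_)
      · rintro _ ⟨i, rfl⟩
        exact ⟨i.castSucc, by simp⟩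
      · rintro _ rfl
        exact ⟨Fin.last n, by simp⟩

/-- If `R` maps onto a commutative UFD with kernel `J`, then each prime ideal strictly above `J`
contains an element as in `isNoncommUFD_factor`. -/
theorem exists_prime_of_surjective_commUFD {S : Type*} [CommRing S] [IsDomain S]
    [UniqueFactorizationMonoid S] (f : R →+* S) (hf : Function.Surjective f) {J : TwoSidedIdeal R}
    (hJ : TwoSidedIdeal.ker f = J) {P : TwoSidedIdeal R} (hP : IsPrimeIdeal P) (hJP : J < P) :
    ∃ p ∈ P, p ∉ J ∧ IsNormalModulo J p ∧ IsCompletelyPrime (J ⊔ TwoSidedIdeal.span {p}) := by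
  have hker : ∀ {x}, x ∈ J ↔ f x = 0 := by
    intro x
    rw [← hJ, TwoSidedIdeal.mem_ker]
  have hmem : ∀ {x y}, f x = f y → x ∈ P → y ∈ P := by
    intro x y hxy hx
    have : x - y ∈ J := hker.2 (by rw [map_sub, hxy, sub_self])
    simpa using P.sub_mem hx (hJP.le this)
  have hIn : ∀ {x : R}, f x ∈ Ideal.map f P.asIdeal ↔ x ∈ P := by
    intro x
    rw [Ideal.mem_map_iff_of_surjective f hf]
    exact ⟨fun ⟨y, hy, hxy⟩ => hmem hxy (TwoSidedIdeal.mem_asIdeal.1 hy),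
      fun h => ⟨x, TwoSidedIdeal.mem_asIdeal.2 h, rfl⟩⟩
  have hIp : (Ideal.map f P.asIdeal).IsPrime := by
    refine ⟨fun h => hP.1 ?_, fun {s t} hst => ?_⟩
    · rw [← TwoSidedIdeal.one_mem_iff, ← hIn, h]
      trivial
    · obtain ⟨x, rfl⟩ := hf s
      obtain ⟨y, rfl⟩ := hf t
      rw [hIn, hIn]
      refine hP.2 x y fun r => hIn.1 ?_
      rw [map_mul, map_mul, mul_right_comm]
      exact Ideal.mul_mem_right _ _ hst
  have hI0 : Ideal.map f P.asIdeal ≠ ⊥ := by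
    intro h
    obtain ⟨x, hxP, hxJ⟩ := SetLike.exists_of_lt hJP
    exact hxJ (hker.2 (by have := hIn.2 hxP; rwa [h] at this))
  obtain ⟨s, hs, hsp⟩ := hIp.exists_mem_prime_of_ne_bot hI0
  obtain ⟨p, rfl⟩ := hf s
  have hsup : ∀ {x}, x ∈ J ⊔ TwoSidedIdeal.span {p} ↔ f p ∣ f x := by
    intro x
    constructor
    · intro hx
      obtain ⟨g, hg⟩ : ∃ g : R →+* S ⧸ Ideal.span {f p}, ∀ y, g y = 0 ↔ f p ∣ f y :=
        ⟨(Ideal.Quotient.mk (Ideal.span {f p})).comp f, fun y => by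
          rw [RingHom.comp_apply, Ideal.Quotient.eq_zero_iff_mem, Ideal.mem_span_singleton]⟩
      have hle : J ⊔ TwoSidedIdeal.span {p} ≤ TwoSidedIdeal.ker g := by
        refine sup_le (fun y hy => ?_) (TwoSidedIdeal.span_le.2 ?_)
        · rw [TwoSidedIdeal.mem_ker, hg, hker.1 hy]
          exact dvd_zero _
        · rintro y hy
          rw [Set.mem_singleton_iff.1 hy, SetLike.mem_coe, TwoSidedIdeal.mem_ker, hg]
      exact (hg x).1 ((TwoSidedIdeal.mem_ker g).1 (hle hx))
    · rintro ⟨t, ht⟩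
      obtain ⟨y, rfl⟩ := hf t
      have h1 : x - p * y ∈ J := hker.2 (by rw [map_sub, map_mul, ht, sub_self])
      have h2 : p * y ∈ TwoSidedIdeal.span {p} :=
        TwoSidedIdeal.mul_mem_right _ _ _ (TwoSidedIdeal.subset_span rfl)
      rw [← sub_add_cancel x (p * y)]
      exact TwoSidedIdeal.add_mem _ (TwoSidedIdeal.mem_sup_left h1) (TwoSidedIdeal.mem_sup_right h2)
  refine ⟨p, hIn.1 hs, fun h => hsp.ne_zero (hker.1 h), fun r => ⟨⟨r, ?_⟩, ⟨r, ?_⟩⟩, ?_, ?_⟩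
  · rw [hker, map_sub, map_mul, map_mul, mul_comm, sub_self]
  · rw [hker, map_sub, map_mul, map_mul, mul_comm, sub_self]
  · rw [Ne, ← TwoSidedIdeal.one_mem_iff, hsup, map_one]
    exact fun h => hsp.not_isUnit (isUnit_of_dvd_one h)
  · intro x y hxy
    rw [hsup, map_mul] at hxy
    rw [hsup, hsup]
    exact hsp.dvd_or_dvd hxy

end NCRing

/-! ### Quantum planes over a commutative domain -/

namespace SkewMonoidAlgebra

/-- A skew monoid algebra of a group with unique products over a domain has no zero divisors:
the product of the coefficients at a unique product is a coefficient of the product. -/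
theorem noZeroDivisors_of_uniqueProds {K G : Type*} [Ring K] [NoZeroDivisors K] [Group G]
    [UniqueProds G] [MulSemiringAction G K] : NoZeroDivisors (SkewMonoidAlgebra K G) where
  eq_zero_or_eq_zero_of_mul_eq_zero {f g} hfg := by
    classical
    by_contra! h
    obtain ⟨hf, hg⟩ := h
    have hf' : f.support.Nonempty := by
      rw [Finset.nonempty_iff_ne_empty, Ne, support_eq_empty]; exact hf
    have hg' : g.support.Nonempty := by
      rw [Finset.nonempty_iff_ne_empty, Ne, support_eq_empty]; exact hg
    obtain ⟨a, ha, b, hb, hu⟩ := UniqueProds.uniqueMul_of_nonempty hf' hg'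
    have hc : (f * g).coeff (a * b) = f.coeff a * a • g.coeff b := by
      rw [coeff_mul, sum_def', Finset.sum_eq_single a]
      · rw [sum_def', Finset.sum_eq_single b]
        · simp
        · intro b' hb' hne
          rw [if_neg]
          intro h
          exact hne (hu ha hb' h).2
        · intro h
          exact absurd hb h
      · intro a' ha' hne
        rw [sum_def']
        refine Finset.sum_eq_zero fun b' hb' => if_neg fun h => hne (hu ha' hb' h).1
      · intro h
        exact absurd ha h
    rw [hfg, coeff_zero, Finsupp.zero_apply, eq_comm, mul_eq_zero] at hc
    rcases hc with h | h
    · exact mem_support_iff.1 ha h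
    · exact mem_support_iff.1 hb ((smul_eq_zero_iff_eq a).1 h)

end SkewMonoidAlgebra

namespace QPlane

open Polynomial

variable {D : Type*} [CommRing D]

/-- The automorphism `y ↦ v y` of `D[y]`. -/
def scaleEquiv (v : Dˣ) : D[X] ≃ₐ[D] D[X] :=
  AlgEquiv.ofAlgHom (aeval (C (v : D) * X)) (aeval (C ((v⁻¹ : Dˣ) : D) * X))
    (by ext; simp [← mul_assoc, ← C_mul]) (by ext; simp [← mul_assoc, ← C_mul])

/-- The polynomial ring `D[y]`, on which `ℤ` acts by the powers of `y ↦ v y`. -/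
def Coeff (_ : Dˣ) : Type _ := D[X]

instance (v : Dˣ) : CommRing (Coeff v) := inferInstanceAs (CommRing D[X])

instance (v : Dˣ) [IsDomain D] : IsDomain (Coeff v) := inferInstanceAs (IsDomain D[X])

instance (v : Dˣ) {k : Type*} [CommSemiring k] [Algebra k D] : Algebra k (Coeff v) :=
  inferInstanceAs (Algebra k D[X])

instance (v : Dˣ) : MulSemiringAction (D[X] ≃ₐ[D] D[X]) (Coeff v) :=
  inferInstanceAs (MulSemiringAction (D[X] ≃ₐ[D] D[X]) D[X])

instance (v : Dˣ) : MulSemiringAction (Multiplicative ℤ) (Coeff v) :=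
  MulSemiringAction.compHom (Coeff v) (zpowersHom (D[X] ≃ₐ[D] D[X]) (scaleEquiv v))

theorem scaleEquiv_zpow_C_mul_X_pow (v : Dˣ) (n : ℤ) (s : D) (m : ℕ) :
    (scaleEquiv v ^ n) (C s * X ^ m) = C (s * ((v ^ n) ^ m : Dˣ)) * X ^ m := by
  have h1 : ∀ w : Dˣ, scaleEquiv w X = C (w : D) * X := fun w => by simp [scaleEquiv]
  have h2 : ∀ n : ℤ, scaleEquiv v ^ n = scaleEquiv (v ^ n) := by
    intro n
    have hmul : ∀ w w' : Dˣ, scaleEquiv (w * w') = scaleEquiv w * scaleEquiv w' := by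
      intro w w'
      apply AlgEquiv.ext
      intro p
      refine congrArg (fun f : D[X] →ₐ[D] D[X] => f p) (Polynomial.algHom_ext
        (f := (scaleEquiv (w * w') : D[X] →ₐ[D] D[X]))
        (g := ((scaleEquiv w * scaleEquiv w' : D[X] ≃ₐ[D] D[X]) : D[X] →ₐ[D] D[X])) ?_)
      have hC : ∀ z, scaleEquiv w (C z) = C z := fun z => (scaleEquiv w).commutes z
      simp only [AlgEquiv.coe_toAlgHom, AlgEquiv.mul_apply, h1, map_mul, hC, Units.val_mul]
      ring
    let φ : Dˣ →* (D[X] ≃ₐ[D] D[X]) := MonoidHom.mk' scaleEquiv hmul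
    exact (map_zpow φ v n).symm
  have hC : ∀ z, scaleEquiv (v ^ n) (C z) = C z := fun z => (scaleEquiv (v ^ n)).commutes z
  rw [h2, map_mul, map_pow, h1, hC, mul_pow, ← mul_assoc, ← C_pow, ← C_mul, Units.val_pow_eq_pow_val]

instance (v : Dˣ) {k : Type*} [CommSemiring k] [Algebra k D] :
    SMulCommClass (Multiplicative ℤ) k (Coeff v) where
  smul_comm g s p := by
    have h : ∀ p : Coeff v, s • p = (algebraMap k D s • p : Coeff v) := fun p =>
      (algebraMap_smul (A := D) (M := D[X]) s p).symm
    rw [h, h]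
    exact map_smul (scaleEquiv v ^ g.toAdd) (algebraMap k D s) p

end QPlane

open Polynomial in
/-- The quantum plane `D⟨x^{±1}, y⟩` with `x y = v y x` over the commutative ring `D`: the skew
group algebra of `ℤ` over `D[y]`. The coefficients `p ∈ D[y]` stand to the left of the powers
of `x`. -/
abbrev QPlane {D : Type*} [CommRing D] (v : Dˣ) : Type _ :=
  SkewMonoidAlgebra (QPlane.Coeff v) (Multiplicative ℤ)

namespace QPlane

open Polynomial

variable {D : Type*} [CommRing D] {v : Dˣ}

instance [IsDomain D] : IsDomain (QPlane v) :=
  have : NoZeroDivisors (QPlane v) := SkewMonoidAlgebra.noZeroDivisors_of_uniqueProds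
  NoZeroDivisors.to_isDomain _

variable (v) in
/-- The element `p(y) xⁿ` of the quantum plane. -/
def mono (n : ℤ) (p : D[X]) : QPlane v :=
  SkewMonoidAlgebra.single (Multiplicative.ofAdd n) (show Coeff v from p)

theorem one_eq_mono : (1 : QPlane v) = mono v 0 1 := rfl

theorem mono_mul_mono (n m : ℤ) (p r : D[X]) :
    mono v n p * mono v m r = mono v (n + m) (p * (scaleEquiv v ^ n) r) :=
  SkewMonoidAlgebra.single_mul_single

theorem mono_zero_mul_mono (m : ℤ) (p r : D[X]) :
    mono v 0 p * mono v m r = mono v m (p * r) := by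
  rw [mono_mul_mono, zero_add, zpow_zero]
  rfl

theorem mono_add (n : ℤ) (p r : D[X]) : mono v n (p + r) = mono v n p + mono v n r :=
  SkewMonoidAlgebra.single_add _ _ _

theorem mono_eq_zero {n : ℤ} {p : D[X]} : mono v n p = 0 ↔ p = 0 :=
  SkewMonoidAlgebra.single_eq_zero

theorem mono_C_pow (n : ℤ) (s : D) (i : ℕ) :
    mono v n (C s) ^ i = mono v (n * i) (C (s ^ i)) := by
  induction i with
  | zero => simp [one_eq_mono]
  | succ i ih =>
    rw [pow_succ, ih, mono_mul_mono]
    have := scaleEquiv_zpow_C_mul_X_pow v (n * i) s 0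
    rw [pow_zero, mul_one, pow_zero, Units.val_one, mul_one] at this
    rw [this, ← C_mul, mul_one, ← pow_succ]
    push_cast
    ring_nf

theorem mono_zero_pow (p : D[X]) (i : ℕ) : mono v 0 p ^ i = mono v 0 (p ^ i) := by
  induction i with
  | zero => simp [one_eq_mono]
  | succ i ih => rw [pow_succ, ih, mono_zero_mul_mono, pow_succ]

/-- The coefficient of `xⁿ`, as an additive map to `D[y]`. -/
def coeffX (n : ℤ) : QPlane v →+ D[X] where
  toFun f := f.coeff (Multiplicative.ofAdd n)
  map_zero' := rfl
  map_add' f g := by rw [SkewMonoidAlgebra.coeff_add]; rfl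

theorem coeffX_mono (n m : ℤ) (p : D[X]) : coeffX n (mono v m p) = if m = n then p else 0 := by
  classical
  have h : coeffX n (mono v m p) = if Multiplicative.ofAdd m = Multiplicative.ofAdd n then p else 0 :=
    SkewMonoidAlgebra.coeff_single_apply
  rw [h]
  simp only [EmbeddingLike.apply_eq_iff_eq]

theorem smul_mono {k : Type*} [CommSemiring k] [Algebra k D] (s : k) (n : ℤ) (p : D[X]) :
    s • mono v n p = mono v n (C (algebraMap k D s) * p) := by
  rw [← smul_eq_C_mul, algebraMap_smul]
  exact SkewMonoidAlgebra.smul_single _ _ _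

theorem algebraMap_eq_mono {k : Type*} [CommSemiring k] [Algebra k D] (s : k) :
    algebraMap k (QPlane v) s = mono v 0 (C (algebraMap k D s)) := by
  rw [Algebra.algebraMap_eq_smul_one, one_eq_mono, smul_mono, mul_one]

end QPlane

/-! ### Generators and relations of `O_q(M₂)` -/

theorem pow_mul_of_skew {k A : Type*} [CommSemiring k] [Semiring A] [Algebra k A] {x y : A} {s : k}
    (h : x * y = s • (y * x)) (n : ℕ) : x ^ n * y = s ^ n • (y * x ^ n) := by
  induction n with
  | zero => simp
  | succ n ih =>
    rw [pow_succ, mul_assoc, h, mul_smul_comm, ← mul_assoc, ih, smul_mul_assoc, smul_smul,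
      mul_assoc, ← pow_succ']

theorem mul_pow_of_skew {k A : Type*} [CommSemiring k] [Semiring A] [Algebra k A] {x y : A} {s : k}
    (h : x * y = s • (y * x)) (n : ℕ) : x * y ^ n = s ^ n • (y ^ n * x) := by
  induction n with
  | zero => simp
  | succ n ih =>
    rw [pow_succ, ← mul_assoc, ih, smul_mul_assoc, mul_assoc, h, mul_smul_comm, smul_smul,
      ← mul_assoc, ← pow_succ]

theorem mul_mul_of_skew {k A : Type*} [CommSemiring k] [Semiring A] [Algebra k A] {x y z : A}
    {s t : k} (hy : x * y = s • (y * x)) (hz : x * z = t • (z * x)) :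
    x * (y * z) = (s * t) • (y * z * x) := by
  rw [← mul_assoc, hy, smul_mul_assoc, mul_assoc, hz, mul_smul_comm, smul_smul, ← mul_assoc]

theorem TwoSidedIdeal.smul_mem_of_algebra {k A : Type*} [CommSemiring k] [Ring A] [Algebra k A]
    (J : TwoSidedIdeal A) (s : k) {x : A} (h : x ∈ J) : s • x ∈ J := by
  rw [Algebra.smul_def]
  exact J.mul_mem_left _ _ h

theorem TwoSidedIdeal.mem_of_smul_mem {k A : Type*} [Field k] [Ring A] [Algebra k A]
    (J : TwoSidedIdeal A) {s : k} (hs : s ≠ 0) {x : A} (h : s • x ∈ J) : x ∈ J := by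
  have := J.smul_mem_of_algebra s⁻¹ h
  rwa [smul_smul, inv_mul_cancel₀ hs, one_smul] at this

namespace OqM2

open NCRing

variable {k : Type*} [Field k] (q : k)

theorem a_mul_b : a q * b q = q • (b q * a q) := by
  simpa only [map_mul, map_smul] using! RingQuot.mkAlgHom_rel k (OqM2Rel.ab (q := q))

theorem a_mul_c : a q * c q = q • (c q * a q) := by
  simpa only [map_mul, map_smul] using! RingQuot.mkAlgHom_rel k (OqM2Rel.ac (q := q))

theorem b_mul_d : b q * d q = q • (d q * b q) := by
  simpa only [map_mul, map_smul] using! RingQuot.mkAlgHom_rel k (OqM2Rel.bd (q := q))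

theorem c_mul_d : c q * d q = q • (d q * c q) := by
  simpa only [map_mul, map_smul] using! RingQuot.mkAlgHom_rel k (OqM2Rel.cd (q := q))

theorem b_mul_c : b q * c q = c q * b q := by
  simpa only [map_mul, map_smul] using! RingQuot.mkAlgHom_rel k (OqM2Rel.bc (q := q))

theorem a_mul_d_sub : a q * d q - d q * a q = (q - q⁻¹) • (b q * c q) := by
  simpa only [map_mul, map_smul, map_sub] using! RingQuot.mkAlgHom_rel k (OqM2Rel.ad (q := q))

/-- The algebra homomorphism out of `O_q(M₂)` given by four elements satisfying the defining
relations. -/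
def lift {B : Type*} [Ring B] [Algebra k B] (f : Fin 2 → Fin 2 → B)
    (hab : f 0 0 * f 0 1 = q • (f 0 1 * f 0 0)) (hac : f 0 0 * f 1 0 = q • (f 1 0 * f 0 0))
    (hbd : f 0 1 * f 1 1 = q • (f 1 1 * f 0 1)) (hcd : f 1 0 * f 1 1 = q • (f 1 1 * f 1 0))
    (hbc : f 0 1 * f 1 0 = f 1 0 * f 0 1)
    (had : f 0 0 * f 1 1 - f 1 1 * f 0 0 = (q - q⁻¹) • (f 0 1 * f 1 0)) : OqM2 q →ₐ[k] B :=
  RingQuot.liftAlgHom k ⟨FreeAlgebra.lift k fun p : Fin 2 × Fin 2 => f p.1 p.2, by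
    intro x y hxy
    cases hxy <;> simpa only [map_mul, map_smul, map_sub, FreeAlgebra.lift_ι_apply]⟩

@[simp] theorem lift_X {B : Type*} [Ring B] [Algebra k B] (f : Fin 2 → Fin 2 → B)
    (hab hac hbd hcd hbc had) (i j : Fin 2) :
    lift q f hab hac hbd hcd hbc had (X q i j) = f i j := by
  rw [X, lift]
  simp

variable {q}

@[elab_as_elim]
theorem induction {p : OqM2 q → Prop} (algebraMap : ∀ s : k, p (algebraMap k _ s))
    (X : ∀ i j, p (X q i j)) (mul : ∀ x y, p x → p y → p (x * y))
    (add : ∀ x y, p x → p y → p (x + y)) (x : OqM2 q) : p x := by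
  obtain ⟨x, rfl⟩ := RingQuot.mkAlgHom_surjective k (OqM2Rel q) x
  induction x using FreeAlgebra.induction with
  | grade0 s => simpa using algebraMap s
  | grade1 x => exact X x.1 x.2
  | mul x y hx hy => rw [map_mul]; exact mul _ _ hx hy
  | add x y hx hy => rw [map_add]; exact add _ _ hx hy

/-- A subspace containing `1` and stable under left multiplication by the generators is
everything. -/
theorem submodule_eq_top {W : Submodule k (OqM2 q)} (h1 : 1 ∈ W)
    (hX : ∀ i j, ∀ w ∈ W, X q i j * w ∈ W) : W = ⊤ := by
  rw [eq_top_iff]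
  rintro x -
  have : ∀ w ∈ W, x * w ∈ W := by
    induction x using induction with
    | algebraMap s =>
      intro w hw
      rw [← Algebra.smul_def]
      exact W.smul_mem s hw
    | X i j => exact hX i j
    | mul x y hx hy =>
      intro w hw
      rw [mul_assoc]
      exact hx _ (hy w hw)
    | add x y hx hy =>
      intro w hw
      rw [add_mul]
      exact W.add_mem (hx w hw) (hy w hw)
  simpa using this 1 h1

/-- An element that commutes up to nonzero scalars with the generators modulo `J` is normal
modulo `J`. -/
theorem isNormalModulo_of_skew {J : TwoSidedIdeal (OqM2 q)} {w : OqM2 q}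
    (h : ∀ i j, ∃ s : k, s ≠ 0 ∧ w * X q i j - s • (X q i j * w) ∈ J) : IsNormalModulo J w := by
  intro r
  constructor
  · induction r using induction with
    | algebraMap s =>
      exact ⟨algebraMap k _ s, by rw [Algebra.commutes, sub_self]; exact J.zero_mem⟩
    | X i j =>
      obtain ⟨s, -, hs⟩ := h i j
      exact ⟨s • X q i j, by rwa [smul_mul_assoc]⟩
    | mul x y hx hy =>
      obtain ⟨x', hx⟩ := hx
      obtain ⟨y', hy⟩ := hy
      refine ⟨x' * y', ?_⟩
      have := J.add_mem (J.mul_mem_right _ y hx) (J.mul_mem_left x' _ hy)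
      convert this using 1
      simp only [mul_sub, sub_mul, mul_assoc]
      abel
    | add x y hx hy =>
      obtain ⟨x', hx⟩ := hx
      obtain ⟨y', hy⟩ := hy
      refine ⟨x' + y', ?_⟩
      convert J.add_mem hx hy using 1
      noncomm_ring
  · induction r using induction with
    | algebraMap s =>
      exact ⟨algebraMap k _ s, by rw [Algebra.commutes, sub_self]; exact J.zero_mem⟩
    | X i j =>
      obtain ⟨s, hs0, hs⟩ := h i j
      refine ⟨s⁻¹ • X q i j, ?_⟩
      have := J.smul_mem_of_algebra (-s⁻¹) hs
      convert this using 1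
      rw [smul_sub, smul_smul, neg_mul, inv_mul_cancel₀ hs0, mul_smul_comm]
      module
    | mul x y hx hy =>
      obtain ⟨x', hx⟩ := hx
      obtain ⟨y', hy⟩ := hy
      refine ⟨x' * y', ?_⟩
      have := J.add_mem (J.mul_mem_right _ y' hx) (J.mul_mem_left x _ hy)
      convert this using 1
      simp only [mul_sub, sub_mul, mul_assoc]
      abel
    | add x y hx hy =>
      obtain ⟨x', hx⟩ := hx
      obtain ⟨y', hy⟩ := hy
      refine ⟨x' + y', ?_⟩
      convert J.add_mem hx hy using 1
      noncomm_ring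

theorem c_mul_a (hq0 : q ≠ 0) : c q * a q = q⁻¹ • (a q * c q) := by
  rw [a_mul_c, smul_smul, inv_mul_cancel₀ hq0, one_smul]

theorem d_mul_b (hq0 : q ≠ 0) : d q * b q = q⁻¹ • (b q * d q) := by
  rw [b_mul_d, smul_smul, inv_mul_cancel₀ hq0, one_smul]

theorem d_mul_c (hq0 : q ≠ 0) : d q * c q = q⁻¹ • (c q * d q) := by
  rw [c_mul_d, smul_smul, inv_mul_cancel₀ hq0, one_smul]

theorem a_mul_d : a q * d q = Δ q + q • (b q * c q) := by
  rw [Δ, sub_add_cancel]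

theorem d_mul_a : d q * a q = Δ q + q⁻¹ • (b q * c q) := by
  have := a_mul_d_sub q
  rw [sub_eq_iff_eq_add] at this
  rw [Δ, this]
  module

theorem a_mul_bc : a q * (b q * c q) = (q * q) • (b q * c q * a q) :=
  mul_mul_of_skew (a_mul_b q) (a_mul_c q)

theorem d_mul_bc (hq0 : q ≠ 0) : d q * (b q * c q) = (q⁻¹ * q⁻¹) • (b q * c q * d q) :=
  mul_mul_of_skew (d_mul_b hq0) (d_mul_c hq0)

/-- The quantum determinant is central. -/
theorem commute_Δ (hq0 : q ≠ 0) (x : OqM2 q) : Commute (Δ q) x := by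
  induction x using induction with
  | algebraMap s => exact (Algebra.commutes s (Δ q)).symm
  | mul x y hx hy => exact hx.mul_right hy
  | add x y hx hy => exact hx.add_right hy
  | X i j =>
    have ha : Commute (Δ q) (a q) := by
      have h1 : Δ q * a q = a q * (d q * a q) - q • (b q * c q * a q) := by
        rw [Δ, sub_mul, smul_mul_assoc, mul_assoc]
      rw [d_mul_a, mul_add, mul_smul_comm, a_mul_bc, smul_smul, ← mul_assoc q⁻¹,
        inv_mul_cancel₀ hq0, one_mul, add_sub_cancel_right] at h1
      exact h1
    have hd : Commute (Δ q) (d q) := by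
      have h1 : d q * Δ q = d q * a q * d q - q • (d q * (b q * c q)) := by
        rw [Δ, mul_sub, mul_smul_comm, mul_assoc]
      rw [d_mul_a, add_mul, smul_mul_assoc, d_mul_bc hq0, smul_smul, ← mul_assoc q,
        mul_inv_cancel₀ hq0, one_mul, add_sub_cancel_right] at h1
      exact h1.symm
    have hb : Commute (Δ q) (b q) := by
      have h1 : a q * d q * b q = b q * (a q * d q) := by
        rw [mul_assoc, d_mul_b hq0, mul_smul_comm, ← mul_assoc, a_mul_b, smul_mul_assoc, smul_smul,
          inv_mul_cancel₀ hq0, one_smul, mul_assoc]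
      rw [Δ, commute_iff_eq, sub_mul, h1, mul_sub, smul_mul_assoc, mul_smul_comm, mul_assoc,
        ← b_mul_c]
    have hc : Commute (Δ q) (c q) := by
      have h1 : a q * d q * c q = c q * (a q * d q) := by
        rw [mul_assoc, d_mul_c hq0, mul_smul_comm, ← mul_assoc, a_mul_c, smul_mul_assoc, smul_smul,
          inv_mul_cancel₀ hq0, one_smul, mul_assoc]
      rw [Δ, commute_iff_eq, sub_mul, h1, mul_sub, smul_mul_assoc, mul_smul_comm,
        ← mul_assoc (c q) (b q), ← b_mul_c]
    fin_cases i <;> fin_cases j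
    exacts [ha, hb, hc, hd]

theorem a_mul_bc_pow (j m : ℕ) :
    a q * (b q ^ j * c q ^ m) = q ^ (j + m) • (b q ^ j * c q ^ m * a q) := by
  rw [mul_mul_of_skew (mul_pow_of_skew (a_mul_b q) j) (mul_pow_of_skew (a_mul_c q) m), ← pow_add]

theorem d_mul_bc_pow (hq0 : q ≠ 0) (j m : ℕ) :
    d q * (b q ^ j * c q ^ m) = q⁻¹ ^ (j + m) • (b q ^ j * c q ^ m * d q) := by
  rw [mul_mul_of_skew (mul_pow_of_skew (d_mul_b hq0) j) (mul_pow_of_skew (d_mul_c hq0) m),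
    ← pow_add]

theorem commute_b_c : Commute (b q) (c q) := b_mul_c q

/-- `d aⁿ⁺¹ - aⁿ⁺¹ d` is a scalar multiple of `bc aⁿ`; the scalar does not vanish. -/
theorem d_mul_a_pow_succ (hq0 : q ≠ 0) (n : ℕ) :
    d q * a q ^ (n + 1) =
      a q ^ (n + 1) * d q + (q⁻¹ - q ^ (2 * n + 1)) • (b q * c q * a q ^ n) := by
  have h1 : a q ^ n * (b q * c q) = (q ^ (2 * n)) • (b q * c q * a q ^ n) := by
    rw [pow_mul_of_skew a_mul_bc, ← pow_two, pow_mul]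
  rw [pow_succ', ← mul_assoc, d_mul_a, ← pow_succ', pow_succ, mul_assoc (a q ^ n), a_mul_d, add_mul,
    mul_add, (commute_Δ hq0 (a q ^ n)).eq, mul_smul_comm, h1, smul_mul_assoc, smul_smul, add_assoc,
    ← add_smul]
  congr 3
  ring

theorem d_pow_succ_mul_a (hq0 : q ≠ 0) (n : ℕ) :
    d q ^ (n + 1) * a q =
      a q * d q ^ (n + 1) + (q⁻¹ * (q⁻¹ * q⁻¹) ^ n - q) • (b q * c q * d q ^ n) := by
  have h1 : d q ^ n * (b q * c q) = ((q⁻¹ * q⁻¹) ^ n) • (b q * c q * d q ^ n) := by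
    rw [pow_mul_of_skew (d_mul_bc hq0)]
  rw [pow_succ, mul_assoc, d_mul_a, ← pow_succ, pow_succ', ← mul_assoc (a q), a_mul_d, add_mul,
    mul_add, (commute_Δ hq0 (d q ^ n)).eq, mul_smul_comm, h1, smul_mul_assoc, smul_smul, add_assoc,
    ← add_smul]
  congr 3
  ring

end OqM2

/-! ### Homomorphisms to quantum planes -/

namespace QPlane

open Polynomial

variable {D : Type*} [CommRing D] (v : Dˣ)

theorem scaleEquiv_zpow_C (n : ℤ) (s : D) : (scaleEquiv v ^ n) (C s) = C s := by
  simpa using scaleEquiv_zpow_C_mul_X_pow v n s 0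

theorem scaleEquiv_zpow_C_mul_X (n : ℤ) (s : D) :
    (scaleEquiv v ^ n) (C s * X) = C (s * (v ^ n : Dˣ)) * X := by
  simpa using scaleEquiv_zpow_C_mul_X_pow v n s 1

end QPlane

namespace OqM2

open NCRing Polynomial QPlane

variable {k : Type*} [Field k] {q : k}

/-- The image of `q` in a `k`-algebra, as a unit. -/
def unitOf (D : Type*) [CommRing D] [Algebra k D] (hq0 : q ≠ 0) : Dˣ :=
  Units.map (algebraMap k D : k →* D) (Units.mk0 q hq0)

variable {D : Type*} [CommRing D] [Algebra k D]

theorem val_unitOf (hq0 : q ≠ 0) : (unitOf D hq0 : D) = algebraMap k D q := rfl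

theorem val_inv_unitOf (hq0 : q ≠ 0) :
    (((unitOf D hq0)⁻¹ : Dˣ) : D) = algebraMap k D q⁻¹ := rfl

/-- The homomorphism from `O_q(M₂)` to a quantum plane with `a ↦ α x`, `b ↦ β y`, `c ↦ γ y`,
`d ↦ (δ + ε y²) x⁻¹`. -/
def toPlane (hq0 : q ≠ 0) (α β γ δ ε : D) (h : α * ε * algebraMap k D q = β * γ) :
    OqM2 q →ₐ[k] QPlane (unitOf D hq0) :=
  lift q ![![mono _ 1 (C α), mono _ 0 (C β * Polynomial.X)],
      ![mono _ 0 (C γ * Polynomial.X), mono _ (-1) (C δ + C ε * Polynomial.X ^ 2)]]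
    (by
      simp only [Matrix.cons_val_zero, Matrix.cons_val_one]
      rw [mono_mul_mono, mono_zero_mul_mono, smul_mono, scaleEquiv_zpow_C_mul_X, add_zero, zpow_one,
        val_unitOf]
      congr 1
      simp only [C_mul]
      ring)
    (by
      simp only [Matrix.cons_val_zero, Matrix.cons_val_one]
      rw [mono_mul_mono, mono_zero_mul_mono, smul_mono, scaleEquiv_zpow_C_mul_X, add_zero, zpow_one,
        val_unitOf]
      congr 1
      simp only [C_mul]
      ring)
    (by
      simp only [Matrix.cons_val_zero, Matrix.cons_val_one]
      rw [mono_mul_mono _ 0, mono_zero_mul_mono, smul_mono, scaleEquiv_zpow_C_mul_X, add_zero,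
        zpow_neg_one, val_inv_unitOf]
      congr 1
      have : C (algebraMap k D q) * C (algebraMap k D q⁻¹) = 1 := by
        rw [← C_mul, ← map_mul, mul_inv_cancel₀ hq0, map_one, C_1]
      simp only [C_mul]
      linear_combination (-(C δ + C ε * Polynomial.X ^ 2) * C β * Polynomial.X) * this)
    (by
      simp only [Matrix.cons_val_zero, Matrix.cons_val_one]
      rw [mono_mul_mono _ 0, mono_zero_mul_mono, smul_mono, scaleEquiv_zpow_C_mul_X, add_zero,
        zpow_neg_one, val_inv_unitOf]
      congr 1
      have : C (algebraMap k D q) * C (algebraMap k D q⁻¹) = 1 := by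
        rw [← C_mul, ← map_mul, mul_inv_cancel₀ hq0, map_one, C_1]
      simp only [C_mul]
      linear_combination (-(C δ + C ε * Polynomial.X ^ 2) * C γ * Polynomial.X) * this)
    (by
      simp only [Matrix.cons_val_zero, Matrix.cons_val_one]
      rw [mono_zero_mul_mono, mono_zero_mul_mono, mul_comm])
    (by
      simp only [Matrix.cons_val_zero, Matrix.cons_val_one]
      rw [mono_mul_mono, mono_mul_mono, mono_zero_mul_mono, smul_mono, map_add,
        scaleEquiv_zpow_C_mul_X_pow, scaleEquiv_zpow_C, scaleEquiv_zpow_C, zpow_one,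
        Units.val_pow_eq_pow_val, val_unitOf, add_neg_cancel, neg_add_cancel, sub_eq_iff_eq_add,
        ← mono_add]
      congr 1
      have h1 : C (algebraMap k D q) * C (algebraMap k D q⁻¹) = 1 := by
        rw [← C_mul, ← map_mul, mul_inv_cancel₀ hq0, map_one, C_1]
      have h2 : C α * C ε * C (algebraMap k D q) = C β * C γ := by
        rw [← C_mul, ← C_mul, ← C_mul, h]
      simp only [C_mul, map_sub, C_pow]
      linear_combination (C (algebraMap k D q) - C (algebraMap k D q⁻¹)) * Polynomial.X ^ 2 * h2 +
        C α * C ε * Polynomial.X ^ 2 * h1)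

section toPlane

variable (hq0 : q ≠ 0) (α β γ δ ε : D) (h : α * ε * algebraMap k D q = β * γ)

theorem toPlane_a : toPlane hq0 α β γ δ ε h (a q) = mono _ 1 (C α) := by
  rw [a, toPlane, lift_X]; rfl

theorem toPlane_b : toPlane hq0 α β γ δ ε h (b q) = mono _ 0 (C β * Polynomial.X) := by
  rw [b, toPlane, lift_X]; rfl

theorem toPlane_c : toPlane hq0 α β γ δ ε h (c q) = mono _ 0 (C γ * Polynomial.X) := by
  rw [c, toPlane, lift_X]; rfl

theorem toPlane_d :
    toPlane hq0 α β γ δ ε h (d q) = mono _ (-1) (C δ + C ε * Polynomial.X ^ 2) := by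
  rw [d, toPlane, lift_X]; rfl

theorem toPlane_Δ : toPlane hq0 α β γ δ ε h (Δ q) = mono _ 0 (C (α * δ)) := by
  rw [Δ, map_sub, map_smul, map_mul, map_mul, toPlane_a, toPlane_b, toPlane_c, toPlane_d,
    mono_mul_mono, mono_zero_mul_mono, smul_mono, map_add,
    scaleEquiv_zpow_C_mul_X_pow, scaleEquiv_zpow_C, zpow_one,
    Units.val_pow_eq_pow_val, val_unitOf, add_neg_cancel, sub_eq_iff_eq_add, ← mono_add]
  congr 1
  have h2 : C α * C ε * C (algebraMap k D q) = C β * C γ := by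
    rw [← C_mul, ← C_mul, ← C_mul, h]
  simp only [C_mul, C_pow]
  linear_combination (C (algebraMap k D q) * Polynomial.X ^ 2) * h2

theorem toPlane_a_pow (n : ℕ) : toPlane hq0 α β γ δ ε h (a q ^ n) = mono _ n (C (α ^ n)) := by
  rw [map_pow, toPlane_a, mono_C_pow, one_mul]

theorem toPlane_b_pow (n : ℕ) :
    toPlane hq0 α β γ δ ε h (b q ^ n) = mono _ 0 (C (β ^ n) * Polynomial.X ^ n) := by
  rw [map_pow, toPlane_b, mono_zero_pow, mul_pow, C_pow]

theorem toPlane_c_pow (n : ℕ) :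
    toPlane hq0 α β γ δ ε h (c q ^ n) = mono _ 0 (C (γ ^ n) * Polynomial.X ^ n) := by
  rw [map_pow, toPlane_c, mono_zero_pow, mul_pow, C_pow]

end toPlane

/-! ### A normal form -/

variable (q) in
/-- The homogeneous components of the generalized Weyl algebra `O_q(M₂)` over `k[b, c, Δ]`:
`aⁱ` for `i ≥ 0` and `d⁻ⁱ` for `i < 0`. -/
def gwaGen : ℤ → OqM2 q
  | Int.ofNat n => a q ^ n
  | Int.negSucc n => d q ^ (n + 1)

theorem gwaGen_natCast (n : ℕ) : gwaGen q n = a q ^ n := rfl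

theorem gwaGen_neg (n : ℕ) : gwaGen q (-n) = d q ^ n := by
  cases n with
  | zero => exact (pow_zero (a q)).trans (pow_zero (d q)).symm
  | succ n => rfl

variable (q) in
/-- The homogenization, of degree `m` in `b` and `c`, of a polynomial `h ∈ k[Δ][Y]` of degree at
most `m` in `Y`: the element `c ^ m h(Δ, b / c)` of `k[b, c, Δ]`. -/
def homog (m : ℕ) : k[X][X] →ₗ[k] OqM2 q where
  toFun h := ∑ j ∈ Finset.range (m + 1), aeval (Δ q) (h.coeff j) * (b q ^ j * c q ^ (m - j))
  map_add' h h' := by simp only [coeff_add, map_add, add_mul, Finset.sum_add_distrib]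
  map_smul' s h := by
    simp only [coeff_smul, map_smul, smul_mul_assoc, Finset.smul_sum, RingHom.id_apply]

theorem homog_apply (m : ℕ) (h : k[X][X]) : homog q m h =
    ∑ j ∈ Finset.range (m + 1), aeval (Δ q) (h.coeff j) * (b q ^ j * c q ^ (m - j)) := rfl

theorem homog_C_mul_X_pow (l : k[X]) (j m : ℕ) :
    homog q (j + m) (C l * Polynomial.X ^ j) = aeval (Δ q) l * (b q ^ j * c q ^ m) := by
  rw [homog_apply, Finset.sum_eq_single j]
  · simp
  · intro i _ hi
    simp [coeff_X_pow, hi]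
  · intro h
    exact absurd (Finset.mem_range.2 (by omega)) h

theorem commute_aeval_Δ (hq0 : q ≠ 0) (l : k[X]) (x : OqM2 q) : Commute (aeval (Δ q) l) x := by
  induction l using Polynomial.induction_on' with
  | add p r hp hr => rw [map_add]; exact hp.add_left hr
  | monomial n s =>
    rw [aeval_monomial]
    exact (show Commute _ _ from Algebra.commutes s x).mul_left ((commute_Δ hq0 x).pow_left n)

theorem a_mul_homog (hq0 : q ≠ 0) (m : ℕ) (h : k[X][X]) :
    a q * homog q m h = q ^ m • (homog q m h * a q) := by
  rw [homog_apply, Finset.mul_sum, Finset.sum_mul, Finset.smul_sum]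
  refine Finset.sum_congr rfl fun j hj => ?_
  have hj : j + (m - j) = m := by have := Finset.mem_range.1 hj; omega
  rw [← mul_assoc, ← (commute_aeval_Δ hq0 _ (a q)).eq, mul_assoc, a_mul_bc_pow, hj, mul_smul_comm,
    ← mul_assoc]

theorem d_mul_homog (hq0 : q ≠ 0) (m : ℕ) (h : k[X][X]) :
    d q * homog q m h = q⁻¹ ^ m • (homog q m h * d q) := by
  rw [homog_apply, Finset.mul_sum, Finset.sum_mul, Finset.smul_sum]
  refine Finset.sum_congr rfl fun j hj => ?_
  have hj : j + (m - j) = m := by have := Finset.mem_range.1 hj; omega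
  rw [← mul_assoc, ← (commute_aeval_Δ hq0 _ (d q)).eq, mul_assoc, d_mul_bc_pow hq0, hj,
    mul_smul_comm, ← mul_assoc]

theorem commute_b_homog (hq0 : q ≠ 0) (m : ℕ) (h : k[X][X]) : Commute (b q) (homog q m h) := by
  rw [homog_apply]
  exact Commute.sum_right _ _ _ fun j _ => (commute_aeval_Δ hq0 _ _).symm.mul_right
    (((Commute.refl _).pow_right _).mul_right (commute_b_c.pow_right _))

theorem commute_c_homog (hq0 : q ≠ 0) (m : ℕ) (h : k[X][X]) : Commute (c q) (homog q m h) := by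
  rw [homog_apply]
  exact Commute.sum_right _ _ _ fun j _ => (commute_aeval_Δ hq0 _ _).symm.mul_right
    ((commute_b_c.symm.pow_right _).mul_right ((Commute.refl _).pow_right _))

theorem isNormalModulo_homog (hq0 : q ≠ 0) (J : TwoSidedIdeal (OqM2 q)) (m : ℕ) (h : k[X][X]) :
    IsNormalModulo J (homog q m h) := by
  apply isNormalModulo_of_skew
  have hm : q ^ m ≠ 0 := pow_ne_zero _ hq0
  intro i j
  fin_cases i <;> fin_cases j
  · refine ⟨q⁻¹ ^ m, pow_ne_zero _ (inv_ne_zero hq0), ?_⟩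
    change _ * a q - _ • (a q * _) ∈ _
    rw [a_mul_homog hq0, smul_smul, ← mul_pow, inv_mul_cancel₀ hq0, one_pow, one_smul, sub_self]
    exact J.zero_mem
  · refine ⟨1, one_ne_zero, ?_⟩
    change _ * b q - _ • (b q * _) ∈ _
    rw [(commute_b_homog hq0 m h).eq, one_smul, sub_self]
    exact J.zero_mem
  · refine ⟨1, one_ne_zero, ?_⟩
    change _ * c q - _ • (c q * _) ∈ _
    rw [(commute_c_homog hq0 m h).eq, one_smul, sub_self]
    exact J.zero_mem
  · refine ⟨q ^ m, hm, ?_⟩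
    change _ * d q - _ • (d q * _) ∈ _
    rw [d_mul_homog hq0, smul_smul, ← mul_pow, mul_inv_cancel₀ hq0, one_pow, one_smul, sub_self]
    exact J.zero_mem

/-- Left multiplication by `a` raises the index by one, up to a factor in `k[b, c, Δ]`. -/
theorem a_mul_gwaGen (i : ℤ) :
    a q * gwaGen q i = gwaGen q (i + 1) ∨
      a q * gwaGen q i = (Δ q + q • (b q * c q)) * gwaGen q (i + 1) := by
  rcases le_or_gt 0 i with hi | hi
  · obtain ⟨n, rfl⟩ := Int.eq_ofNat_of_zero_le hi
    left
    have : (n : ℤ) + 1 = ((n + 1 : ℕ) : ℤ) := by push_cast; rfl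
    rw [this, gwaGen_natCast, gwaGen_natCast, pow_succ']
  · obtain ⟨n, rfl⟩ : ∃ n : ℕ, i = -((n + 1 : ℕ) : ℤ) := ⟨(-i - 1).toNat, by omega⟩
    right
    have : -((n + 1 : ℕ) : ℤ) + 1 = -(n : ℤ) := by push_cast; ring
    rw [this, gwaGen_neg, gwaGen_neg, pow_succ', ← mul_assoc, a_mul_d]

/-- Left multiplication by `d` lowers the index by one, up to a factor in `k[b, c, Δ]`. -/
theorem d_mul_gwaGen (i : ℤ) :
    d q * gwaGen q i = gwaGen q (i - 1) ∨
      d q * gwaGen q i = (Δ q + q⁻¹ • (b q * c q)) * gwaGen q (i - 1) := by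
  rcases le_or_gt i 0 with hi | hi
  · obtain ⟨n, rfl⟩ : ∃ n : ℕ, i = -(n : ℤ) := ⟨(-i).toNat, by omega⟩
    left
    have : -(n : ℤ) - 1 = -((n + 1 : ℕ) : ℤ) := by push_cast; ring
    rw [this, gwaGen_neg, gwaGen_neg, pow_succ']
  · obtain ⟨n, rfl⟩ : ∃ n : ℕ, i = ((n + 1 : ℕ) : ℤ) := ⟨(i - 1).toNat, by omega⟩
    right
    have : ((n + 1 : ℕ) : ℤ) - 1 = (n : ℤ) := by push_cast; ring
    rw [this, gwaGen_natCast, gwaGen_natCast, pow_succ', ← mul_assoc, d_mul_a]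

theorem span_gwa_eq_top (hq0 : q ≠ 0) : Submodule.span k (Set.range fun e : ℕ × ℕ × ℕ × ℤ =>
    Δ q ^ e.1 * (b q ^ e.2.1 * c q ^ e.2.2.1) * gwaGen q e.2.2.2) = ⊤ := by
  set W := Submodule.span k (Set.range fun e : ℕ × ℕ × ℕ × ℤ =>
    Δ q ^ e.1 * (b q ^ e.2.1 * c q ^ e.2.2.1) * gwaGen q e.2.2.2) with hW
  have hmem : ∀ l j m i, Δ q ^ l * (b q ^ j * c q ^ m) * gwaGen q i ∈ W := fun l j m i =>
    Submodule.subset_span ⟨(l, j, m, i), rfl⟩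
  have hΔ : ∀ l j m i, Δ q ^ l * (b q ^ j * c q ^ m) * (Δ q * gwaGen q i) ∈ W := by
    intro l j m i
    convert hmem (l + 1) j m i using 1
    rw [← mul_assoc, mul_assoc (Δ q ^ l), ← (commute_Δ hq0 (b q ^ j * c q ^ m)).eq, ← mul_assoc,
      ← pow_succ]
  have hbc : ∀ l j m i, Δ q ^ l * (b q ^ j * c q ^ m) * (b q * c q * gwaGen q i) ∈ W := by
    intro l j m i
    convert hmem l (j + 1) (m + 1) i using 1
    rw [← mul_assoc, mul_assoc (Δ q ^ l), pow_succ, pow_succ, mul_assoc (b q ^ j) (c q ^ m),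
      ← mul_assoc (c q ^ m), ← (commute_b_c.pow_right m).eq, mul_assoc (b q) (c q ^ m),
      mul_assoc (b q ^ j)]
  refine submodule_eq_top ?_ fun i j w hw => ?_
  · have h0 : gwaGen q 0 = 1 := pow_zero (a q)
    simpa [h0] using hmem 0 0 0 0
  · induction hw using Submodule.span_induction with
    | zero => rw [mul_zero]; exact W.zero_mem
    | add x y _ _ hx hy => rw [mul_add]; exact W.add_mem hx hy
    | smul s x _ hx => rw [mul_smul_comm]; exact W.smul_mem s hx
    | mem x hx =>
      obtain ⟨⟨l, j', m, i'⟩, rfl⟩ := hx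
      dsimp only
      have key : ∀ {x : OqM2 q} {s : k},
          x * (b q ^ j' * c q ^ m) = s • (b q ^ j' * c q ^ m * x) →
          x * (Δ q ^ l * (b q ^ j' * c q ^ m) * gwaGen q i') =
            s • (Δ q ^ l * (b q ^ j' * c q ^ m) * (x * gwaGen q i')) := by
        intro x s hx
        rw [← mul_assoc, ← mul_assoc, ← ((commute_Δ hq0 x).pow_left l).eq, mul_assoc _ x, hx,
          mul_smul_comm, smul_mul_assoc]
        simp only [mul_assoc]
      fin_cases i <;> fin_cases j
      · change a q * _ ∈ W
        rw [key (a_mul_bc_pow j' m)]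
        refine W.smul_mem _ ?_
        rcases a_mul_gwaGen (q := q) i' with h | h <;> rw [h]
        · exact hmem _ _ _ _
        · rw [add_mul, smul_mul_assoc, mul_add, mul_smul_comm]
          exact W.add_mem (hΔ _ _ _ _) (W.smul_mem _ (hbc _ _ _ _))
      · change b q * _ ∈ W
        convert hmem l (j' + 1) m i' using 1
        rw [← mul_assoc, ← mul_assoc, ← ((commute_Δ hq0 (b q)).pow_left l).eq, mul_assoc _ (b q),
          ← mul_assoc (b q), pow_succ']
      · change c q * _ ∈ W
        convert hmem l j' (m + 1) i' using 1
        rw [← mul_assoc, ← mul_assoc, ← ((commute_Δ hq0 (c q)).pow_left l).eq, mul_assoc _ (c q),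
          ← mul_assoc (c q), ← (commute_b_c.pow_left j').eq, mul_assoc (b q ^ j') (c q), pow_succ']
      · change d q * _ ∈ W
        rw [key (d_mul_bc_pow hq0 j' m)]
        refine W.smul_mem _ ?_
        rcases d_mul_gwaGen (q := q) i' with h | h <;> rw [h]
        · exact hmem _ _ _ _
        · rw [add_mul, smul_mul_assoc, mul_add, mul_smul_comm]
          exact W.add_mem (hΔ _ _ _ _) (W.smul_mem _ (hbc _ _ _ _))

/-- Each element is a sum of terms `s · aⁱ` and `s · dⁱ`, where `s ∈ k[b, c, Δ]` is homogeneous in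
`b` and `c`. -/
theorem exists_normalForm (hq0 : q ≠ 0) (x : OqM2 q) :
    ∃ f : ℤ × ℕ →₀ k[X][X], (∀ p, (f p).natDegree ≤ p.2) ∧
      x = f.sum fun p h => homog q p.2 h * gwaGen q p.1 := by
  have hx : x ∈ Submodule.span k (Set.range fun e : ℕ × ℕ × ℕ × ℤ =>
    Δ q ^ e.1 * (b q ^ e.2.1 * c q ^ e.2.2.1) * gwaGen q e.2.2.2) := by
    rw [span_gwa_eq_top hq0]; trivial
  induction hx using Submodule.span_induction with
  | zero => exact ⟨0, by simp, by simp⟩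
  | add x y _ _ hx hy =>
    obtain ⟨f, hf, rfl⟩ := hx
    obtain ⟨g, hg, rfl⟩ := hy
    refine ⟨f + g, fun p => (natDegree_add_le _ _).trans (max_le (hf p) (hg p)), ?_⟩
    rw [Finsupp.sum_add_index']
    · intro p; rw [map_zero, zero_mul]
    · intro p h h'; rw [map_add, add_mul]
  | smul s x _ hx =>
    obtain ⟨f, hf, rfl⟩ := hx
    refine ⟨s • f, fun p => (natDegree_smul_le _ _).trans (hf p), ?_⟩
    rw [Finsupp.sum_smul_index']
    · simp only [Finsupp.smul_sum, map_smul, smul_mul_assoc]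
    · intro p; rw [map_zero, zero_mul]
  | mem x hx =>
    obtain ⟨⟨l, j, m, i⟩, rfl⟩ := hx
    refine ⟨Finsupp.single (i, j + m) (C (Polynomial.X ^ l) * Polynomial.X ^ j), fun p => ?_, ?_⟩
    · rw [Finsupp.single_apply]
      split_ifs with h
      · subst h
        exact (natDegree_C_mul_X_pow_le _ _).trans (Nat.le_add_right _ _)
      · simp
    · rw [Finsupp.sum_single_index (by rw [map_zero, zero_mul]), homog_C_mul_X_pow, map_pow, aeval_X]

end OqM2

/-! ### Kernels of homomorphisms to quantum planes -/

namespace OqM2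

open NCRing Polynomial QPlane

variable {k : Type*} [Field k] {q : k} {D : Type*} [CommRing D] [Algebra k D]

/-- The homomorphism from `O_q(M₂)` to a quantum plane over `D` with `a ↦ x`, `b ↦ Y y`,
`c ↦ y` and `Δ ↦ δ`. -/
def evalPlane (hq0 : q ≠ 0) (δ Y : D) : OqM2 q →ₐ[k] QPlane (unitOf D hq0) :=
  toPlane hq0 1 Y 1 δ (algebraMap k D q⁻¹ * Y) (by
    have : algebraMap k D q⁻¹ * algebraMap k D q = 1 := by
      rw [← map_mul, inv_mul_cancel₀ hq0, map_one]
    linear_combination Y * this)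

/-- The homomorphism `k[Δ][Y] → D` with `Δ ↦ δ`, `Y ↦ Y`. -/
def specialize (k : Type*) [Field k] {D : Type*} [CommRing D] [Algebra k D] (δ Y : D) :
    k[X][X] →+* D :=
  eval₂RingHom (aeval δ : k[X] →ₐ[k] D).toRingHom Y

variable (hq0 : q ≠ 0) (δ Y : D)

theorem evalPlane_aeval_Δ (l : k[X]) :
    evalPlane hq0 δ Y (aeval (Δ q) l) = mono _ 0 (C (aeval δ l)) := by
  induction l using Polynomial.induction_on' with
  | add p r hp hr => rw [map_add, map_add, map_add, map_add, hp, hr, mono_add]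
  | monomial n s =>
    rw [aeval_monomial, aeval_monomial, map_mul, AlgHom.commutes, map_pow, evalPlane, toPlane_Δ,
      one_mul, mono_zero_pow, algebraMap_eq_mono, mono_zero_mul_mono, C_mul, C_pow]

theorem evalPlane_homog (m : ℕ) (h : k[X][X]) (hh : h.natDegree ≤ m) :
    evalPlane hq0 δ Y (homog q m h) = mono _ 0 (C (specialize k δ Y h) * Polynomial.X ^ m) := by
  have key : ∀ j ∈ Finset.range (m + 1),
      evalPlane hq0 δ Y (aeval (Δ q) (h.coeff j) * (b q ^ j * c q ^ (m - j))) =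
      mono _ 0 (C (aeval δ (h.coeff j) * Y ^ j) * Polynomial.X ^ m) := by
    intro j hj
    have hj : j + (m - j) = m := by have := Finset.mem_range.1 hj; omega
    rw [map_mul, map_mul, evalPlane_aeval_Δ, evalPlane, toPlane_b_pow, toPlane_c_pow,
      mono_zero_mul_mono, mono_zero_mul_mono, one_pow, C_1, one_mul, mul_assoc, ← pow_add, hj,
      ← mul_assoc, ← C_mul]
  have hadd : ∀ (s : Finset ℕ) (p : ℕ → D[X]),
      ∑ j ∈ s, mono (unitOf D hq0) 0 (p j) = mono _ 0 (∑ j ∈ s, p j) := by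
    intro s p
    classical
    induction s using Finset.induction_on with
    | empty => exact (mono_eq_zero.2 rfl).symm
    | insert i s hi ih => rw [Finset.sum_insert hi, Finset.sum_insert hi, ih, mono_add]
  rw [homog_apply, map_sum, Finset.sum_congr rfl key, hadd, ← Finset.sum_mul, ← map_sum]
  congr 3
  rw [specialize, coe_eval₂RingHom, eval₂_eq_sum_range' _ (Nat.lt_succ_of_le hh)]
  rfl

/-- The condition `hδY` ensures that `d`, which goes to `(δ + q⁻¹ Y y²) x⁻¹`, does not vanish. -/
theorem evalPlane_gwaGen [IsDomain D] (hδY : δ ≠ 0 ∨ Y ≠ 0) (i : ℤ) :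
    ∃ t : D[X], t ≠ 0 ∧ evalPlane hq0 δ Y (gwaGen q i) = mono _ i t := by
  have hd : ∀ n : ℕ, ∃ t : D[X], t ≠ 0 ∧ evalPlane hq0 δ Y (d q ^ n) = mono _ (-n) t := by
    intro n
    induction n with
    | zero => exact ⟨1, one_ne_zero, by simp [one_eq_mono]⟩
    | succ n ih =>
      obtain ⟨t, ht, h⟩ := ih
      refine ⟨t * (scaleEquiv (unitOf D hq0) ^ (-n : ℤ))
        (C δ + C (algebraMap k D q⁻¹ * Y) * Polynomial.X ^ 2), mul_ne_zero ht ?_, ?_⟩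
      · rw [Ne, EmbeddingLike.map_eq_zero_iff]
        intro h0
        have hq' : algebraMap k D q⁻¹ ≠ 0 :=
          (map_ne_zero_iff _ (algebraMap k D).injective).2 (inv_ne_zero hq0)
        have h1 := congrArg (fun p => p.coeff 0) h0
        have h2 := congrArg (fun p => p.coeff 2) h0
        simp only [coeff_add, coeff_C_mul, coeff_X_pow, coeff_C] at h1 h2
        simp [hq'] at h1 h2
        rcases hδY with h | h
        · exact h h1
        · exact h h2
      · rw [pow_succ, map_mul, h, evalPlane, toPlane_d, mono_mul_mono]
        congr 1
        push_cast
        ring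
  rcases le_or_gt 0 i with hi | hi
  · obtain ⟨n, rfl⟩ := Int.eq_ofNat_of_zero_le hi
    refine ⟨1, one_ne_zero, ?_⟩
    rw [gwaGen_natCast, evalPlane, toPlane_a_pow, one_pow, C_1]
  · obtain ⟨n, rfl⟩ : ∃ n : ℕ, i = -(n : ℤ) := ⟨(-i).toNat, by omega⟩
    rw [gwaGen_neg]
    exact hd n

/-- The kernel of `evalPlane` in terms of normal forms. -/
theorem evalPlane_normalForm_eq_zero [IsDomain D] (hδY : δ ≠ 0 ∨ Y ≠ 0) (f : ℤ × ℕ →₀ k[X][X])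
    (hf : ∀ p, (f p).natDegree ≤ p.2)
    (h0 : evalPlane hq0 δ Y (f.sum fun p h => homog q p.2 h * gwaGen q p.1) = 0) (p : ℤ × ℕ) :
    specialize k δ Y (f p) = 0 := by
  classical
  choose t ht0 ht using evalPlane_gwaGen hq0 δ Y hδY
  have key : ∀ p, evalPlane hq0 δ Y (homog q p.2 (f p) * gwaGen q p.1) =
      mono _ p.1 (C (specialize k δ Y (f p)) * Polynomial.X ^ p.2 * t p.1) := by
    intro p
    rw [map_mul, evalPlane_homog hq0 δ Y _ _ (hf p), ht, mono_zero_mul_mono]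
  obtain ⟨i, m⟩ := p
  have h1 := congrArg (coeffX i) h0
  rw [Finsupp.sum, map_sum, map_sum, map_zero, Finset.sum_congr rfl fun p _ => by rw [key p]] at h1
  have h2 : (∑ p ∈ f.support, if p.1 = i then C (specialize k δ Y (f p)) * Polynomial.X ^ p.2
      else 0) * t i = 0 := by
    refine Eq.trans ?_ h1
    rw [Finset.sum_mul]
    refine Finset.sum_congr rfl fun p _ => ?_
    rw [coeffX_mono]
    split_ifs with h
    · rw [h]
    · rw [zero_mul]
  have h3 := congrArg (fun p => p.coeff m) ((mul_eq_zero.1 h2).resolve_right (ht0 i))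
  simp only [finsetSum_coeff, coeff_zero] at h3
  rw [← h3, Finset.sum_eq_single (i, m)]
  · simp
  · rintro ⟨i', m'⟩ _ hne
    dsimp only
    split_ifs with hi
    · subst hi
      rw [coeff_C_mul, coeff_X_pow, if_neg, mul_zero]
      rintro rfl
      exact hne rfl
    · rw [coeff_zero]
  · intro h
    rw [Finsupp.notMem_support_iff.1 h, map_zero]
    simp

/-- A criterion for an ideal to be the kernel of `evalPlane`, and hence completely prime. -/
theorem ker_evalPlane [IsDomain D] (hδY : δ ≠ 0 ∨ Y ≠ 0) {J : TwoSidedIdeal (OqM2 q)}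
    (hJ : ∀ x ∈ J, evalPlane hq0 δ Y x = 0)
    (hJ' : ∀ m h, h.natDegree ≤ m → specialize k δ Y h = 0 → homog q m h ∈ J) :
    TwoSidedIdeal.ker (evalPlane hq0 δ Y) = J := by
  apply le_antisymm
  · intro x hx
    rw [TwoSidedIdeal.mem_ker] at hx
    obtain ⟨f, hf, rfl⟩ := exists_normalForm hq0 x
    have := evalPlane_normalForm_eq_zero hq0 δ Y hδY f hf hx
    exact J.finsetSum_mem _ _ fun p _ => J.mul_mem_right _ _ (hJ' _ _ (hf p) (this p))
  · intro x hx
    rw [TwoSidedIdeal.mem_ker]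
    exact hJ x hx

theorem isCompletelyPrime_of_evalPlane [IsDomain D] (hδY : δ ≠ 0 ∨ Y ≠ 0)
    {J : TwoSidedIdeal (OqM2 q)} (hJ : ∀ x ∈ J, evalPlane hq0 δ Y x = 0)
    (hJ' : ∀ m h, h.natDegree ≤ m → specialize k δ Y h = 0 → homog q m h ∈ J) :
    IsCompletelyPrime J := by
  rw [← ker_evalPlane hq0 δ Y hδY hJ hJ']
  exact isCompletelyPrime_ker (evalPlane hq0 δ Y : OqM2 q →+* QPlane (unitOf D hq0))

theorem specialize_self (h : k[X][X]) :
    specialize k (C Polynomial.X : k[X][X]) Polynomial.X h = h := by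
  have : ((aeval (C Polynomial.X : k[X][X]) : k[X] →ₐ[k] k[X][X]).toRingHom) = C := by
    ext
    · simp
    · simp
  rw [specialize, this]
  exact eval₂_C_X

/-- The homomorphism from `O_q(M₂)` to the quantum plane over `k[Δ][Y]` is injective. -/
theorem evalPlane_injective :
    Function.Injective (evalPlane hq0 (C Polynomial.X : k[X][X]) Polynomial.X) := by
  rw [← TwoSidedIdeal.ker_eq_bot]
  refine ker_evalPlane hq0 _ _ (Or.inr X_ne_zero) (fun x hx => ?_) fun m h _ h0 => ?_
  · rw [(TwoSidedIdeal.mem_bot _).1 hx, map_zero]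
  · rw [specialize_self] at h0
    rw [h0, map_zero]
    exact TwoSidedIdeal.zero_mem _

theorem isCompletelyPrime_bot (hq0 : q ≠ 0) : IsCompletelyPrime (⊥ : TwoSidedIdeal (OqM2 q)) := by
  have := evalPlane_injective hq0
  rw [← TwoSidedIdeal.ker_eq_bot] at this
  rw [← this]
  exact isCompletelyPrime_ker (evalPlane hq0 (C Polynomial.X : k[X][X]) Polynomial.X :
    OqM2 q →+* QPlane (unitOf k[X][X] hq0))

theorem homog_mul (hq0 : q ≠ 0) {e m : ℕ} {g h : k[X][X]} (hg : g.natDegree ≤ e) (hh : h.natDegree ≤ m) :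
    homog q (e + m) (g * h) = homog q e g * homog q m h := by
  apply evalPlane_injective hq0
  rw [evalPlane_homog _ _ _ _ _ (natDegree_mul_le.trans (add_le_add hg hh)), map_mul (evalPlane _ _ _),
    evalPlane_homog _ _ _ _ _ hg, evalPlane_homog _ _ _ _ _ hh, mono_zero_mul_mono, map_mul, C_mul,
    pow_add, mul_mul_mul_comm]

variable (q) in
theorem homog_one (m : ℕ) : homog q m 1 = c q ^ m := by
  have := homog_C_mul_X_pow (q := q) 1 0 m
  simpa using this

/-- The homogenization of an irreducible polynomial generates a completely prime ideal: it is the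
kernel of the homomorphism to the quantum plane over `k[Δ][Y] / (g)`. -/
theorem isCompletelyPrime_span_homog (hq0 : q ≠ 0) {g : k[X][X]} (hg : Irreducible g) :
    IsCompletelyPrime (TwoSidedIdeal.span {homog q g.natDegree g}) := by
  have hp : (Ideal.span {g}).IsPrime :=
    (Ideal.span_singleton_prime hg.ne_zero).2 hg.prime
  let π : k[X][X] →ₐ[k] k[X][X] ⧸ Ideal.span {g} := Ideal.Quotient.mkₐ k _
  have hπ : ∀ h, π h = 0 ↔ g ∣ h := fun h => by
    rw [← Ideal.mem_span_singleton]
    exact Ideal.Quotient.eq_zero_iff_mem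
  have hsp : ∀ h, specialize k (π (C Polynomial.X)) (π Polynomial.X) h = π h := by
    intro h
    have : specialize k (π (C Polynomial.X)) (π Polynomial.X) = π.toRingHom := by
      ext z
      · simpa [specialize] using (π.commutes z).symm
      · simp [specialize]
      · simp [specialize]
    rw [this]
    rfl
  refine isCompletelyPrime_of_evalPlane hq0 (π (C Polynomial.X)) (π Polynomial.X) ?_ ?_ ?_
  · -- `g` cannot divide both `Δ` and `Y`, which are coprime
    by_contra! h
    obtain ⟨r, hr⟩ := (hπ _).1 h.1
    obtain ⟨s, hs⟩ := (hπ _).1 h.2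
    have hdeg : g.natDegree = 0 := by
      have hr0 : r ≠ 0 := by
        rintro rfl
        rw [mul_zero, C_eq_zero] at hr
        exact X_ne_zero hr
      have := congrArg natDegree hr
      rw [natDegree_C, natDegree_mul hg.ne_zero hr0] at this
      omega
    rw [eq_C_of_natDegree_eq_zero hdeg] at hs
    have := congrArg (fun p => p.coeff 1) hs
    simp only [coeff_X_one, coeff_C_mul] at this
    refine hg.not_isUnit ?_
    rw [eq_C_of_natDegree_eq_zero hdeg]
    exact (IsUnit.of_mul_eq_one _ this.symm).map C
  · intro x hx
    rw [← TwoSidedIdeal.mem_ker]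
    refine (TwoSidedIdeal.span_le.2 ?_ : _ ≤ TwoSidedIdeal.ker _) hx
    rintro _ rfl
    rw [SetLike.mem_coe, TwoSidedIdeal.mem_ker, evalPlane_homog _ _ _ _ _ le_rfl, hsp,
      (hπ g).2 dvd_rfl, C_0, zero_mul, mono_eq_zero]
  · intro m h hh h0
    rw [hsp, hπ] at h0
    obtain ⟨r, rfl⟩ := h0
    by_cases hr : r = 0
    · rw [hr, mul_zero, map_zero]
      exact TwoSidedIdeal.zero_mem _
    · rw [natDegree_mul hg.ne_zero hr] at hh
      obtain ⟨e, rfl⟩ := Nat.exists_eq_add_of_le (le_of_add_le_left hh)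
      rw [homog_mul hq0 le_rfl (by omega)]
      exact TwoSidedIdeal.mul_mem_right _ _ _ (TwoSidedIdeal.subset_span rfl)

variable (q) in
theorem homog_zero_C_X : homog q 0 (C Polynomial.X) = Δ q := by
  have := homog_C_mul_X_pow (q := q) Polynomial.X 0 0
  simpa using this

variable (q) in
theorem homog_one_X : homog q 1 Polynomial.X = b q := by
  have := homog_C_mul_X_pow (q := q) 1 1 0
  simpa using this

theorem isCompletelyPrime_detIdeal (hq0 : q ≠ 0) : IsCompletelyPrime (detIdeal q) := by
  have h : Irreducible (C Polynomial.X : k[X][X]) :=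
    (Polynomial.prime_C_iff.2 Polynomial.prime_X).irreducible
  have := isCompletelyPrime_span_homog hq0 h
  rwa [natDegree_C, homog_zero_C_X] at this

/-- The ideals `⟨Δ, b - t c⟩` are kernels of homomorphisms to the quantum plane over `k`. -/
theorem ker_evalPlane_zero {t : k} (ht : t ≠ 0) :
    TwoSidedIdeal.ker (evalPlane hq0 0 t) = TwoSidedIdeal.span {Δ q, b q - t • c q} := by
  refine ker_evalPlane hq0 0 t (Or.inr ht) ?_ fun m h hh h0 => ?_
  · intro x hx
    rw [← TwoSidedIdeal.mem_ker]
    refine (TwoSidedIdeal.span_le.2 ?_ : _ ≤ TwoSidedIdeal.ker _) hx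
    rintro _ (rfl | rfl) <;> rw [SetLike.mem_coe, TwoSidedIdeal.mem_ker]
    · rw [evalPlane, toPlane_Δ, mul_zero, C_0, mono_eq_zero]
    · rw [evalPlane, map_sub, map_smul, toPlane_b, toPlane_c, smul_mono, sub_eq_zero]
      simp
  · set J := TwoSidedIdeal.span {Δ q, b q - t • c q}
    have hΔ : J.ringCon.mk' (Δ q) = 0 := mk'_eq_zero.2 (TwoSidedIdeal.subset_span (by simp))
    have hb : J.ringCon.mk' (b q) = J.ringCon.mk' (t • c q) := by
      rw [← sub_eq_zero, ← map_sub, mk'_eq_zero]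
      exact TwoSidedIdeal.subset_span (by simp)
    have hal : ∀ l : k[X], J.ringCon.mk' (aeval (Δ q) l) =
        J.ringCon.mk' (algebraMap k _ (l.coeff 0)) := by
      intro l
      conv_lhs => rw [← X_mul_divX_add l]
      rw [map_add, map_mul, aeval_X, map_add, map_mul, hΔ, zero_mul, zero_add, aeval_C]
    rw [← mk'_eq_zero, homog_apply, map_sum]
    have key : ∀ j ∈ Finset.range (m + 1),
        J.ringCon.mk' (aeval (Δ q) (h.coeff j) * (b q ^ j * c q ^ (m - j))) =
        J.ringCon.mk' (((h.coeff j).coeff 0 * t ^ j) • c q ^ m) := by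
      intro j hj
      have hj : j + (m - j) = m := by have := Finset.mem_range.1 hj; omega
      rw [map_mul, hal, map_mul, map_pow, hb, ← map_pow, ← map_mul, ← map_mul, _root_.smul_pow,
        smul_mul_assoc, ← pow_add, hj, ← Algebra.smul_def, smul_smul]
    rw [Finset.sum_congr rfl key, ← map_sum, ← Finset.sum_smul]
    have h1 : specialize k (0 : k) t h =
        ∑ j ∈ Finset.range (m + 1), (h.coeff j).coeff 0 * t ^ j := by
      rw [specialize, coe_eval₂RingHom, eval₂_eq_sum_range' _ (Nat.lt_succ_of_le hh)]
      refine Finset.sum_congr rfl fun j _ => ?_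
      congr 1
      exact (coeff_zero_eq_aeval_zero _).symm
    rw [← h1, h0, zero_smul, map_zero]

/-- The ideals `⟨b, Δ - t⟩` are completely prime, as kernels of homomorphisms to the quantum plane
over `k`. -/
theorem isCompletelyPrime_span_b (hq0 : q ≠ 0) {t : k} (ht : t ≠ 0) :
    IsCompletelyPrime (TwoSidedIdeal.span {b q, Δ q - algebraMap k _ t}) := by
  refine isCompletelyPrime_of_evalPlane hq0 t (0 : k) (Or.inl ht) ?_ fun m h hh h0 => ?_
  · intro x hx
    rw [← TwoSidedIdeal.mem_ker]
    refine (TwoSidedIdeal.span_le.2 ?_ : _ ≤ TwoSidedIdeal.ker _) hx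
    rintro _ (rfl | rfl) <;> rw [SetLike.mem_coe, TwoSidedIdeal.mem_ker]
    · rw [evalPlane, toPlane_b, C_0, zero_mul, mono_eq_zero]
    · rw [evalPlane, map_sub, AlgHom.commutes, toPlane_Δ, algebraMap_eq_mono, one_mul, Algebra.algebraMap_self_apply,
        sub_self]
  · set J := TwoSidedIdeal.span {b q, Δ q - algebraMap k _ t}
    have hΔ : J.ringCon.mk' (Δ q) = J.ringCon.mk' (algebraMap k _ t) := by
      rw [← sub_eq_zero, ← map_sub, mk'_eq_zero]
      exact TwoSidedIdeal.subset_span (by simp)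
    have hb : J.ringCon.mk' (b q) = 0 := mk'_eq_zero.2 (TwoSidedIdeal.subset_span (by simp))
    have hal : ∀ l : k[X], J.ringCon.mk' (aeval (Δ q) l) =
        J.ringCon.mk' (algebraMap k _ (l.eval t)) := by
      intro l
      induction l using Polynomial.induction_on' with
      | add p r hp hr => rw [map_add, map_add, hp, hr, eval_add, map_add, map_add]
      | monomial n s =>
        rw [aeval_monomial, eval_monomial, map_mul, map_pow, hΔ, map_mul, map_pow, map_mul, map_pow]
    rw [← mk'_eq_zero, homog_apply, map_sum, Finset.sum_range_succ']
    have h1 : (h.coeff 0).eval t = 0 := by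
      have : specialize k t (0 : k) h = (h.coeff 0).eval t := by
        rw [specialize, coe_eval₂RingHom, eval₂_at_zero]
        rfl
      rw [← this, h0]
    rw [map_mul, hal, h1, map_zero, map_zero, zero_mul, add_zero]
    refine Finset.sum_eq_zero fun j _ => ?_
    rw [map_mul, map_mul, map_pow, hb, zero_pow (Nat.succ_ne_zero j), zero_mul, mul_zero]

end OqM2

/-! ### Separating components by twisted commutation -/

section Separation

variable {k V ι : Type*} [Field k] [AddCommGroup V] [Module k V]

/-- Let `L` and `R` be commuting operators that preserve a subspace `P`, and let `xᵢ` be vectors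
with `L xᵢ ≡ μᵢ R xᵢ` modulo `P`, for distinct scalars `μᵢ`. If the sum of the `xᵢ` lies in `P`,
then so do the vectors `Rⁿ xᵢ`, for `n` the number of summands. -/
theorem pow_mem_of_sum_mem (P : Submodule k V) (L R : V →ₗ[k] V) (hL : ∀ v ∈ P, L v ∈ P)
    (hR : ∀ v ∈ P, R v ∈ P) (hLR : ∀ v, L (R v) = R (L v)) (F : Finset ι) (μ : ι → k)
    (hμ : Set.InjOn μ F) (x : ι → V) (hx : ∀ i ∈ F, L (x i) - μ i • R (x i) ∈ P)
    (hs : ∑ i ∈ F, x i ∈ P) : ∀ i ∈ F, (R ^ F.card) (x i) ∈ P := by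
  classical
  have hRn : ∀ n, ∀ v ∈ P, (R ^ n) v ∈ P := by
    intro n
    induction n with
    | zero => exact fun v hv => hv
    | succ n ih =>
      intro v hv
      rw [pow_succ]
      exact ih _ (hR v hv)
  induction F using Finset.induction_on generalizing x with
  | empty => simp
  | insert i₀ F hi ih =>
    rw [Finset.card_insert_of_notMem hi]
    have h1 : ∀ i ∈ F, (R ^ (F.card + 1)) (x i) ∈ P := by
      have hne : ∀ i ∈ F, μ i - μ i₀ ≠ 0 := by
        intro i hiF h
        have := hμ (Finset.mem_insert_of_mem hiF) (Finset.mem_insert_self i₀ F) (sub_eq_zero.1 h)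
        exact hi (this ▸ hiF)
      -- applying `L - μ i₀ • R` removes the summand `x i₀`
      have h2 := ih (hμ.mono (Finset.subset_insert i₀ F)) (fun i => (μ i - μ i₀) • R (x i))
        (fun i hiF => by
          have := P.smul_mem (μ i - μ i₀) (hR _ (hx i (Finset.mem_insert_of_mem hiF)))
          convert this using 1
          rw [map_smul, map_smul, hLR, map_sub, map_smul, smul_sub]
          congr 1
          rw [smul_comm])
        (by
          have e : ∑ i ∈ F, (μ i - μ i₀) • R (x i) =
              (L (∑ i ∈ insert i₀ F, x i) - μ i₀ • R (∑ i ∈ insert i₀ F, x i)) -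
              ∑ i ∈ insert i₀ F, (L (x i) - μ i • R (x i)) := by
            rw [map_sum, map_sum, Finset.smul_sum, ← Finset.sum_sub_distrib,
              ← Finset.sum_sub_distrib, Finset.sum_insert hi]
            have : ∀ i, (L (x i) - μ i₀ • R (x i)) - (L (x i) - μ i • R (x i)) =
                (μ i - μ i₀) • R (x i) := fun i => by rw [sub_smul]; abel
            simp only [this, sub_self, zero_smul, zero_add]
          rw [e]
          exact P.sub_mem (P.sub_mem (hL _ hs) (P.smul_mem _ (hR _ hs))) (P.sum_mem hx))
      intro i hiF
      have h3 := P.smul_mem (μ i - μ i₀)⁻¹ (h2 i hiF)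
      rw [map_smul, smul_smul, inv_mul_cancel₀ (hne i hiF), one_smul] at h3
      rwa [pow_succ]
    intro i hiF
    rcases Finset.mem_insert.1 hiF with rfl | hiF
    · have h4 := hRn (F.card + 1) _ hs
      rw [Finset.sum_insert hi, map_add, map_sum] at h4
      exact (P.add_mem_iff_left (P.sum_mem h1)).1 h4
    · exact h1 i hiF

/-- The version of `pow_mem_of_sum_mem` in which `R` is regular modulo `P`, and the summands are
grouped according to the scalars `μᵢ`. -/
theorem sum_filter_mem_of_sum_mem {κ : Type*} [DecidableEq κ] (P : Submodule k V) (L R : V →ₗ[k] V)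
    (hL : ∀ v ∈ P, L v ∈ P) (hR : ∀ v ∈ P, R v ∈ P) (hLR : ∀ v, L (R v) = R (L v))
    (hR' : ∀ v, R v ∈ P → v ∈ P) (F : Finset ι) (key : ι → κ) (μ : κ → k)
    (hμ : Set.InjOn μ (F.image key)) (x : ι → V)
    (hx : ∀ i ∈ F, L (x i) - μ (key i) • R (x i) ∈ P)
    (hs : ∑ i ∈ F, x i ∈ P) (s : κ) : ∑ i ∈ F with key i = s, x i ∈ P := by
  classical
  by_cases hsF : s ∈ F.image key
  · have hRn : ∀ n, ∀ v, (R ^ n) v ∈ P → v ∈ P := by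
      intro n
      induction n with
      | zero => exact fun v hv => hv
      | succ n ih =>
        intro v hv
        rw [pow_succ] at hv
        exact hR' _ (ih _ hv)
    refine hRn _ _ (pow_mem_of_sum_mem P L R hL hR hLR (F.image key) μ hμ
      (fun s => ∑ i ∈ F with key i = s, x i) (fun s _ => ?_) ?_ s hsF)
    · rw [map_sum, map_sum, Finset.smul_sum, ← Finset.sum_sub_distrib]
      refine P.sum_mem fun i hi => ?_
      obtain ⟨hiF, rfl⟩ := Finset.mem_filter.1 hi
      exact hx i hiF
    · rwa [Finset.sum_fiberwise_of_maps_to fun i hi => Finset.mem_image_of_mem key hi]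
  · rw [Finset.sum_eq_zero]
    · exact P.zero_mem
    · intro i hi
      obtain ⟨hiF, rfl⟩ := Finset.mem_filter.1 hi
      exact absurd (Finset.mem_image_of_mem key hiF) hsF

/-- A variant of `sum_filter_mem_of_sum_mem`: it is enough that each two summands can be separated
by some pair of operators. -/
theorem mem_of_sum_mem_of_separated (P : Submodule k V) (F : Finset ι) (x : ι → V)
    (hsep : ∀ i ∈ F, ∀ j ∈ F, i ≠ j → ∃ (L R : V →ₗ[k] V) (μ : ι → k),
      (∀ v ∈ P, L v ∈ P) ∧ (∀ v ∈ P, R v ∈ P) ∧ (∀ v, R v ∈ P → v ∈ P) ∧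
      (∀ l ∈ F, L (x l) - μ l • R (x l) ∈ P) ∧ μ i ≠ μ j)
    (κ : ι → k) (hs : ∑ i ∈ F, κ i • x i ∈ P) (i : ι) (hi : i ∈ F) (hκ : κ i ≠ 0) : x i ∈ P := by
  classical
  induction F using Finset.strongInduction generalizing κ with
  | H F ih =>
    by_cases hF : ∃ j ∈ F, i ≠ j
    · obtain ⟨j, hj, hij⟩ := hF
      obtain ⟨L, R, μ, hL, hR, hR', hx, hμ⟩ := hsep i hi j hj hij
      refine ih (F.erase j) (Finset.erase_ssubset hj)
        (fun i hi j hj hij => ?_) (fun l => (μ l - μ j) * κ l) (hR' _ ?_)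
        (Finset.mem_erase.2 ⟨hij, hi⟩) (mul_ne_zero (sub_ne_zero.2 hμ) hκ)
      · obtain ⟨L, R, μ, hL, hR, hR', hx, hμ⟩ :=
          hsep i (Finset.mem_of_mem_erase hi) j (Finset.mem_of_mem_erase hj) hij
        exact ⟨L, R, μ, hL, hR, hR', fun l hl => hx l (Finset.mem_of_mem_erase hl), hμ⟩
      · have e : R (∑ l ∈ F.erase j, ((μ l - μ j) * κ l) • x l) =
            (L (∑ l ∈ F, κ l • x l) - μ j • R (∑ l ∈ F, κ l • x l)) -
            ∑ l ∈ F, κ l • (L (x l) - μ l • R (x l)) := by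
          rw [map_sum, map_sum, map_sum, Finset.smul_sum, ← Finset.sum_sub_distrib,
            ← Finset.sum_sub_distrib, ← Finset.add_sum_erase _ _ hj]
          have : ∀ l, (L (κ l • x l) - μ j • R (κ l • x l)) - κ l • (L (x l) - μ l • R (x l)) =
              R (((μ l - μ j) * κ l) • x l) := fun l => by
            simp only [map_smul]
            module
          simp only [this, sub_self, zero_mul, zero_smul, map_zero, zero_add]
        rw [e]
        exact P.sub_mem (P.sub_mem (hL _ hs) (P.smul_mem _ (hR _ hs)))
          (P.sum_mem fun l hl => P.smul_mem _ (hx l hl))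
    · push Not at hF
      have : F = {i} := Finset.eq_singleton_iff_unique_mem.2 ⟨hi, fun j hj => (hF j hj).symm⟩
      rw [this, Finset.sum_singleton] at hs
      have := P.smul_mem (κ i)⁻¹ hs
      rwa [smul_smul, inv_mul_cancel₀ hκ, one_smul] at this

end Separation

theorem zpow_injective_of_pow_ne_one {k : Type*} [Field k] {q : k} (hq0 : q ≠ 0)
    (hq : ∀ n : ℕ, 0 < n → q ^ n ≠ 1) : Function.Injective fun n : ℤ => q ^ n := by
  intro m n hmn
  dsimp only at hmn
  wlog h : m ≤ n generalizing m n with H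
  · exact (H hmn.symm (le_of_not_ge h)).symm
  by_contra hne
  refine hq (n - m).toNat (by omega) ?_
  rw [← zpow_natCast, Int.toNat_of_nonneg (by omega), zpow_sub₀ hq0, hmn, div_self]
  exact zpow_ne_zero _ hq0

theorem pow_injective_of_pow_ne_one {k : Type*} [Field k] {q : k} (hq0 : q ≠ 0)
    (hq : ∀ n : ℕ, 0 < n → q ^ n ≠ 1) : Function.Injective fun n : ℕ => q ^ n := by
  intro m n hmn
  have := zpow_injective_of_pow_ne_one hq0 hq (a₁ := (m : ℤ)) (a₂ := (n : ℤ)) (by simpa using hmn)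
  exact_mod_cast this

theorem inv_pow_ne_one_of_pow_ne_one {k : Type*} [Field k] {q : k}
    (hq : ∀ n : ℕ, 0 < n → q ^ n ≠ 1) (n : ℕ) (hn : 0 < n) : q⁻¹ ^ n ≠ 1 := by
  rw [inv_pow, Ne, inv_eq_one]
  exact hq n hn

namespace OqM2

open NCRing Polynomial

variable {k : Type*} [Field k] {q : k}

/-- A two-sided ideal as a subspace. -/
def subspace (P : TwoSidedIdeal (OqM2 q)) : Submodule k (OqM2 q) :=
  P.asIdeal.restrictScalars k

theorem mem_subspace {P : TwoSidedIdeal (OqM2 q)} {x : OqM2 q} : x ∈ subspace P ↔ x ∈ P :=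
  TwoSidedIdeal.mem_asIdeal

/-! ### Primes that contain neither `b` nor `c` -/

theorem isNormalModulo_b (hq0 : q ≠ 0) (J : TwoSidedIdeal (OqM2 q)) : IsNormalModulo J (b q) := by
  have := isNormalModulo_homog hq0 J 1 Polynomial.X
  rwa [homog_one_X] at this

theorem isNormalModulo_c (hq0 : q ≠ 0) (J : TwoSidedIdeal (OqM2 q)) : IsNormalModulo J (c q) := by
  have := isNormalModulo_homog hq0 J 1 1
  rwa [homog_one, pow_one] at this

theorem isNormalModulo_Δ (hq0 : q ≠ 0) (J : TwoSidedIdeal (OqM2 q)) : IsNormalModulo J (Δ q) := by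
  have := isNormalModulo_homog hq0 J 0 (C Polynomial.X)
  rwa [homog_zero_C_X] at this

theorem c_mul_gwaGen (hq0 : q ≠ 0) (i : ℤ) :
    c q * gwaGen q i = q ^ (-i) • (gwaGen q i * c q) := by
  rcases le_or_gt 0 i with hi | hi
  · obtain ⟨n, rfl⟩ := Int.eq_ofNat_of_zero_le hi
    rw [gwaGen_natCast, mul_pow_of_skew (c_mul_a hq0), zpow_neg, zpow_natCast, inv_pow]
  · obtain ⟨n, rfl⟩ : ∃ n : ℕ, i = -(n : ℤ) := ⟨(-i).toNat, by omega⟩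
    rw [gwaGen_neg, mul_pow_of_skew (c_mul_d q), neg_neg, zpow_natCast]

section Prime

variable {P : TwoSidedIdeal (OqM2 q)}

theorem pow_notMem_of_prime (hP : IsPrimeIdeal P) {w : OqM2 q} (hw : IsNormalModulo P w)
    (hwP : w ∉ P) (n : ℕ) : w ^ n ∉ P := by
  induction n with
  | zero =>
    rw [pow_zero, TwoSidedIdeal.one_mem_iff]
    exact hP.1
  | succ n ih =>
    rw [pow_succ]
    exact fun h => ih (hw.mem_of_mul_mem_right hP hwP h)

theorem mem_of_mul_pow_mem (hP : IsPrimeIdeal P) {w : OqM2 q} (hw : IsNormalModulo P w)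
    (hwP : w ∉ P) (n : ℕ) {x : OqM2 q} (h : x * w ^ n ∈ P) : x ∈ P := by
  induction n with
  | zero => simpa using h
  | succ n ih =>
    rw [pow_succ, ← mul_assoc] at h
    exact ih (hw.mem_of_mul_mem_right hP hwP h)

theorem mem_of_bc_mul_mem (hq0 : q ≠ 0) (hP : IsPrimeIdeal P) (hb : b q ∉ P) (hc : c q ∉ P)
    {x : OqM2 q} (h : b q * c q * x ∈ P) : x ∈ P := by
  rw [mul_assoc] at h
  exact (isNormalModulo_c hq0 P).mem_of_mul_mem_left hP hc
    ((isNormalModulo_b hq0 P).mem_of_mul_mem_left hP hb h)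

/-- If `aⁿ⁺¹` lies in the prime `P`, then so does its commutator with `d`, a nonzero multiple of
`bc aⁿ`. -/
theorem a_pow_notMem (hq0 : q ≠ 0) (hq : ∀ n : ℕ, 0 < n → q ^ n ≠ 1) (hP : IsPrimeIdeal P)
    (hb : b q ∉ P) (hc : c q ∉ P) (n : ℕ) : a q ^ n ∉ P := by
  induction n with
  | zero =>
    rw [pow_zero, TwoSidedIdeal.one_mem_iff]
    exact hP.1
  | succ n ih =>
    intro h
    have h1 : (q⁻¹ - q ^ (2 * n + 1)) • (b q * c q * a q ^ n) ∈ P := by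
      have h2 := d_mul_a_pow_succ hq0 n
      rw [← sub_eq_iff_eq_add'] at h2
      rw [← h2]
      exact P.sub_mem (P.mul_mem_left _ _ h) (P.mul_mem_right _ _ h)
    refine ih (mem_of_bc_mul_mem hq0 hP hb hc (P.mem_of_smul_mem ?_ h1))
    intro h0
    refine hq (2 * n + 2) (by omega) ?_
    rw [pow_succ, ← sub_eq_zero.1 h0, inv_mul_cancel₀ hq0]

/-- If `dⁿ⁺¹` lies in the prime `P`, then so does its commutator with `a`, a nonzero multiple of
`bc dⁿ`. -/
theorem d_pow_notMem (hq0 : q ≠ 0) (hq : ∀ n : ℕ, 0 < n → q ^ n ≠ 1) (hP : IsPrimeIdeal P)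
    (hb : b q ∉ P) (hc : c q ∉ P) (n : ℕ) : d q ^ n ∉ P := by
  induction n with
  | zero =>
    rw [pow_zero, TwoSidedIdeal.one_mem_iff]
    exact hP.1
  | succ n ih =>
    intro h
    have h1 : (q⁻¹ * (q⁻¹ * q⁻¹) ^ n - q) • (b q * c q * d q ^ n) ∈ P := by
      have h2 := d_pow_succ_mul_a hq0 n
      rw [← sub_eq_iff_eq_add'] at h2
      rw [← h2]
      exact P.sub_mem (P.mul_mem_right _ _ h) (P.mul_mem_left _ _ h)
    refine ih (mem_of_bc_mul_mem hq0 hP hb hc (P.mem_of_smul_mem ?_ h1))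
    intro h0
    refine hq (2 * n + 2) (by omega) ?_
    have h3 : q⁻¹ ^ (2 * n + 2) = 1 := by
      rw [pow_succ, pow_succ, pow_mul, pow_two, mul_comm ((q⁻¹ * q⁻¹) ^ n) q⁻¹, sub_eq_zero.1 h0,
        mul_inv_cancel₀ hq0]
    rwa [inv_pow, inv_eq_one] at h3

/-- If a prime ideal contains neither `b` nor `c`, then with each element it contains the
coefficients in `k[b, c, Δ]` of the normal form, component by component: commuting with `c`
separates the powers of `a` and `d`, commuting with `a` or `d` the degrees in `b` and `c`. -/
theorem homog_mem_of_sum_mem (hq0 : q ≠ 0) (hq : ∀ n : ℕ, 0 < n → q ^ n ≠ 1)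
    (hP : IsPrimeIdeal P) (hb : b q ∉ P) (hc : c q ∉ P) (f : ℤ × ℕ →₀ k[X][X])
    (h : f.sum (fun p h => homog q p.2 h * gwaGen q p.1) ∈ P) (p : ℤ × ℕ) :
    homog q p.2 (f p) ∈ P := by
  classical
  by_cases hp : p ∈ f.support
  swap
  · rw [Finsupp.notMem_support_iff.1 hp, map_zero]
    exact P.zero_mem
  have h1 := sum_filter_mem_of_sum_mem (subspace P) (LinearMap.mulLeft k (c q))
    (LinearMap.mulRight k (c q)) (fun v hv => P.mul_mem_left _ _ hv)
    (fun v hv => P.mul_mem_right _ _ hv) (fun v => (mul_assoc _ _ _).symm)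
    (fun v hv => (isNormalModulo_c hq0 P).mem_of_mul_mem_right hP hc hv) f.support
    (fun p => p.1) (fun i => q ^ (-i))
    ((zpow_injective_of_pow_ne_one hq0 hq).comp neg_injective).injOn
    (fun p => homog q p.2 (f p) * gwaGen q p.1)
    (fun p _ => by
      rw [LinearMap.mulLeft_apply, LinearMap.mulRight_apply, ← mul_assoc,
        (commute_c_homog hq0 _ _).eq, mul_assoc, c_mul_gwaGen hq0, mul_smul_comm, mul_assoc,
        sub_self]
      exact Submodule.zero_mem _)
    h p.1
  have hinj : ∀ s : k, s ≠ 0 → (∀ n : ℕ, 0 < n → s ^ n ≠ 1) →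
      Set.InjOn (fun p : ℤ × ℕ => s ^ p.2) (f.support.filter fun p' => p'.1 = p.1) := by
    intro s hs0 hs p1 hp1 p2 hp2 h12
    rw [Finset.mem_coe, Finset.mem_filter] at hp1 hp2
    exact Prod.ext (hp1.2.trans hp2.2.symm) (pow_injective_of_pow_ne_one hs0 hs h12)
  have hq' := inv_pow_ne_one_of_pow_ne_one hq
  by_contra hcon
  rcases le_or_gt 0 p.1 with hi | hi
  · obtain ⟨n, hn⟩ := Int.eq_ofNat_of_zero_le hi
    have h2 := pow_mem_of_sum_mem (subspace P) (LinearMap.mulLeft k (a q))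
      (LinearMap.mulRight k (a q)) (fun v hv => P.mul_mem_left _ _ hv)
      (fun v hv => P.mul_mem_right _ _ hv) (fun v => (mul_assoc _ _ _).symm) _
      (fun p => q ^ p.2) (hinj q hq0 hq) _
      (fun p' hp' => by
        rw [LinearMap.mulLeft_apply, LinearMap.mulRight_apply, (Finset.mem_filter.1 hp').2, hn,
          gwaGen_natCast, ← mul_assoc, a_mul_homog hq0, smul_mul_assoc, mul_assoc, mul_assoc,
          ← pow_succ, ← pow_succ', sub_self]
        exact Submodule.zero_mem _)
      h1 p (Finset.mem_filter.2 ⟨hp, rfl⟩)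
    rw [LinearMap.pow_mulRight, LinearMap.mulRight_apply, mul_assoc, hn, gwaGen_natCast,
      ← pow_add] at h2
    exact a_pow_notMem hq0 hq hP hb hc _
      ((isNormalModulo_homog hq0 P _ _).mem_of_mul_mem_left hP hcon h2)
  · obtain ⟨n, hn⟩ : ∃ n : ℕ, p.1 = -(n : ℤ) := ⟨(-p.1).toNat, by omega⟩
    have h2 := pow_mem_of_sum_mem (subspace P) (LinearMap.mulLeft k (d q))
      (LinearMap.mulRight k (d q)) (fun v hv => P.mul_mem_left _ _ hv)
      (fun v hv => P.mul_mem_right _ _ hv) (fun v => (mul_assoc _ _ _).symm) _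
      (fun p => q⁻¹ ^ p.2) (hinj q⁻¹ (inv_ne_zero hq0) hq') _
      (fun p' hp' => by
        rw [LinearMap.mulLeft_apply, LinearMap.mulRight_apply, (Finset.mem_filter.1 hp').2, hn,
          gwaGen_neg, ← mul_assoc, d_mul_homog hq0, smul_mul_assoc, mul_assoc, mul_assoc,
          ← pow_succ, ← pow_succ', sub_self]
        exact Submodule.zero_mem _)
      h1 p (Finset.mem_filter.2 ⟨hp, rfl⟩)
    rw [LinearMap.pow_mulRight, LinearMap.mulRight_apply, mul_assoc, hn, gwaGen_neg,
      ← pow_add] at h2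
    exact d_pow_notMem hq0 hq hP hb hc _
      ((isNormalModulo_homog hq0 P _ _).mem_of_mul_mem_left hP hcon h2)

/-- A prime ideal that does not contain `c`, but contains the homogenization of a nonzero
polynomial, contains the homogenization of an irreducible polynomial. This is stated for
polynomials that come from a factorial domain `E`, such as `k[Δ][Y]` or `k[Y]`. -/
theorem exists_irreducible_homog_mem (hq0 : q ≠ 0) (hP : IsPrimeIdeal P) (hc : c q ∉ P)
    {E : Type*} [CommRing E] [IsDomain E] [WfDvdMonoid E] (φ : E →+* k[X][X])
    (hφ : Function.Injective φ) (h : E) (h0 : h ≠ 0) (m : ℕ) (hm : (φ h).natDegree ≤ m)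
    (hhP : homog q m (φ h) ∈ P) :
    ∃ g : E, Irreducible g ∧ homog q (φ g).natDegree (φ g) ∈ P := by
  induction h using WfDvdMonoid.induction_on_irreducible generalizing m with
  | zero => exact absurd rfl h0
  | unit u hu =>
    exfalso
    obtain ⟨l, hl, hlu⟩ := Polynomial.isUnit_iff.1 (hu.map φ)
    obtain ⟨s, hs, rfl⟩ := Polynomial.isUnit_iff.1 hl
    rw [← hlu] at hhP
    have h1 := homog_C_mul_X_pow (q := q) (C s) 0 m
    rw [pow_zero, mul_one, zero_add, pow_zero, one_mul, aeval_C, ← Algebra.smul_def] at h1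
    rw [h1] at hhP
    exact pow_notMem_of_prime hP (isNormalModulo_c hq0 P) hc m (P.mem_of_smul_mem hs.ne_zero hhP)
  | mul h i hh hi ih =>
    have hi0 : φ i ≠ 0 := (map_ne_zero_iff φ hφ).2 hi.ne_zero
    have hh0 : φ h ≠ 0 := (map_ne_zero_iff φ hφ).2 hh
    rw [map_mul, natDegree_mul hi0 hh0] at hm
    obtain ⟨e, rfl⟩ := Nat.exists_eq_add_of_le (le_of_add_le_left hm)
    rw [map_mul, homog_mul hq0 le_rfl (by omega)] at hhP
    by_cases hiP : homog q (φ i).natDegree (φ i) ∈ P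
    · exact ⟨i, hi, hiP⟩
    · exact ih hh e (by omega)
        ((isNormalModulo_homog hq0 P _ _).mem_of_mul_mem_left hP hiP hhP)

/-- A nonzero prime ideal contains a nonzero homogeneous element of `k[b, c, Δ]`, unless it
contains `b` or `c`. -/
theorem exists_homog_mem (hq0 : q ≠ 0) (hq : ∀ n : ℕ, 0 < n → q ^ n ≠ 1)
    (hP : IsPrimeIdeal P) (hb : b q ∉ P) (hc : c q ∉ P) (hP0 : P ≠ ⊥) :
    ∃ m, ∃ h : k[X][X], h ≠ 0 ∧ h.natDegree ≤ m ∧ homog q m h ∈ P := by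
  obtain ⟨x, hxP, hx⟩ := SetLike.exists_of_lt (bot_lt_iff_ne_bot.2 hP0)
  rw [TwoSidedIdeal.mem_bot] at hx
  obtain ⟨f, hf, rfl⟩ := exists_normalForm hq0 x
  have : ∃ p, f p ≠ 0 := by
    by_contra! h
    exact hx (Finset.sum_eq_zero fun p _ => by simp only [h p, map_zero, zero_mul])
  obtain ⟨p, hp⟩ := this
  exact ⟨p.2, f p, hp, hf p, homog_mem_of_sum_mem hq0 hq hP hb hc f hxP p⟩

/-- Modulo `Δ`, only the constant terms of the coefficients matter. -/
theorem homog_sub_homog_map_mem_detIdeal (m : ℕ) (h : k[X][X]) :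
    homog q m h - homog q m (mapRingHom C (h.map constantCoeff)) ∈ detIdeal q := by
  rw [← map_sub, homog_apply]
  refine (detIdeal q).finsetSum_mem _ _ fun j _ => (detIdeal q).mul_mem_right _ _ ?_
  rw [coeff_sub, coe_mapRingHom, coeff_map, coeff_map, constantCoeff_apply]
  rw [sub_eq_of_eq_add (X_mul_divX_add (h.coeff j)).symm, map_mul, aeval_X]
  exact (detIdeal q).mul_mem_right _ _ (TwoSidedIdeal.subset_span rfl)

/-- A prime ideal strictly above `⟨Δ⟩` contains some `b - t c` with `t ≠ 0`, unless it contains `b`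
or `c`. -/
theorem exists_sub_mem [IsAlgClosed k] (hq0 : q ≠ 0) (hq : ∀ n : ℕ, 0 < n → q ^ n ≠ 1)
    (hP : IsPrimeIdeal P) (hb : b q ∉ P) (hc : c q ∉ P) (hP0 : detIdeal q < P) :
    ∃ t : k, t ≠ 0 ∧ b q - t • c q ∈ P := by
  obtain ⟨x, hxP, hx⟩ := SetLike.exists_of_lt hP0
  obtain ⟨f, hf, rfl⟩ := exists_normalForm hq0 x
  have : ∃ p, homog q p.2 (f p) ∉ detIdeal q := by
    by_contra! h
    exact hx ((detIdeal q).finsetSum_mem _ _ fun p _ => (detIdeal q).mul_mem_right _ _ (h p))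
  obtain ⟨p, hp⟩ := this
  have hpP := homog_mem_of_sum_mem hq0 hq hP hb hc f hxP p
  set h₀ : k[X] := (f p).map constantCoeff with hh₀
  have hred := homog_sub_homog_map_mem_detIdeal (q := q) p.2 (f p)
  rw [← hh₀] at hred
  have h0P : homog q p.2 (mapRingHom C h₀) ∈ P := by
    simpa using P.sub_mem hpP (hP0.le hred)
  have h₀ne : h₀ ≠ 0 := by
    intro h
    rw [h, map_zero, map_zero, sub_zero] at hred
    exact hp hred
  have hinj : Function.Injective (mapRingHom (C : k →+* k[X])) := map_injective _ C_injective
  have hdeg : (mapRingHom (C : k →+* k[X]) h₀).natDegree ≤ p.2 :=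
    (natDegree_map_le).trans ((natDegree_map_le).trans (hf p))
  obtain ⟨g, hg, hgP⟩ := exists_irreducible_homog_mem hq0 hP hc (mapRingHom C) hinj h₀ h₀ne p.2
    hdeg h0P
  have hg1 : g.natDegree = 1 :=
    natDegree_eq_of_degree_eq_some (IsAlgClosed.degree_eq_one_of_irreducible k hg)
  have hgX : g = C (g.coeff 1) * Polynomial.X + C (g.coeff 0) :=
    eq_X_add_C_of_natDegree_le_one hg1.le
  have hg10 : g.coeff 1 ≠ 0 := by
    rw [← hg1]
    exact leadingCoeff_ne_zero.2 hg.ne_zero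
  have e : homog q 1 (mapRingHom C g) = g.coeff 1 • b q + g.coeff 0 • c q := by
    conv_lhs => rw [hgX]
    rw [map_add, map_add, map_mul, coe_mapRingHom, Polynomial.map_C, Polynomial.map_C, map_X]
    have h1 := homog_C_mul_X_pow (q := q) (C (g.coeff 1)) 1 0
    have h2 := homog_C_mul_X_pow (q := q) (C (g.coeff 0)) 0 1
    simp only [pow_one, pow_zero, mul_one, one_mul, aeval_C, add_zero, zero_add,
      ← Algebra.smul_def] at h1 h2
    rw [h1, h2]
  rw [coe_mapRingHom, natDegree_map_eq_of_injective C_injective, hg1, ← coe_mapRingHom, e] at hgP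
  have hbt : b q - (-(g.coeff 0) / g.coeff 1) • c q ∈ P := by
    have := P.smul_mem_of_algebra (g.coeff 1)⁻¹ hgP
    convert this using 1
    rw [smul_add, smul_smul, smul_smul, inv_mul_cancel₀ hg10, one_smul, neg_div, div_eq_inv_mul]
    module
  refine ⟨_, fun h => hb ?_, hbt⟩
  rwa [h, zero_smul, sub_zero] at hbt

end Prime

/-! ### Torus-stable primes that contain neither `b` nor `c` -/

variable {P : TwoSidedIdeal (OqM2 q)}

theorem torusAction_Δ (h : Torus k) :
    torusAction q h (Δ q) = ((h.1 0 : k) * h.1 1 * h.2 0 * h.2 1) • Δ q := by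
  rw [Δ, map_sub, map_mul, map_smul, map_mul, torusAction_X, torusAction_X, torusAction_X,
    torusAction_X, smul_mul_smul_comm, smul_mul_smul_comm, smul_sub, smul_smul, smul_smul]
  congr 2 <;> ring

/-- The torus-stable primes that contain neither `b` nor `c` are `0` and `⟨Δ⟩`. -/
theorem IsHPrime.eq_bot_or_eq_detIdeal [IsAlgClosed k] (hq0 : q ≠ 0)
    (hq : ∀ n : ℕ, 0 < n → q ^ n ≠ 1) (hP : IsHPrime P) (hb : b q ∉ P) (hc : c q ∉ P) :
    P = ⊥ ∨ P = detIdeal q := by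
  classical
  by_cases hP0 : P = ⊥
  · exact Or.inl hP0
  right
  have hΔP : Δ q ∈ P := by
    obtain ⟨m, h, h0, hm, hhP⟩ := exists_homog_mem hq0 hq hP.1 hb hc hP0
    let u : kˣ := Units.mk0 q hq0
    -- the torus element with `b ↦ q b`, `c ↦ q⁻¹ c` and `Δ ↦ Δ`
    let τ : Torus k := (![u, 1], ![u⁻¹, 1])
    have hτb : torusAction q τ (b q) = q • b q := by
      rw [b, torusAction_X]; simp [τ, u]
    have hτc : torusAction q τ (c q) = q⁻¹ • c q := by
      rw [c, torusAction_X]; simp [τ, u]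
    have hτΔ : torusAction q τ (Δ q) = Δ q := by
      rw [torusAction_Δ]; simp [τ, u, hq0]
    have hterm : ∀ j ∈ Finset.range (m + 1),
        aeval (Δ q) (h.coeff j) * (b q ^ j * c q ^ (m - j)) ∈ P := by
      intro j hj
      have h1 := sum_filter_mem_of_sum_mem (subspace P) (torusAction q τ).toLinearMap
        LinearMap.id (fun v hv => hP.2 τ v hv) (fun v hv => hv) (fun v => rfl) (fun v hv => hv)
        (Finset.range (m + 1)) id (fun j => q ^ (2 * (j : ℤ) - m))
        (fun j₁ _ j₂ _ h12 => by
          have := zpow_injective_of_pow_ne_one hq0 hq h12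
          omega)
        (fun j => aeval (Δ q) (h.coeff j) * (b q ^ j * c q ^ (m - j)))
        (fun j hj => by
          have hj' : (m : ℤ) = j + ((m - j : ℕ) : ℤ) := by
            have := Finset.mem_range.1 hj; omega
          have e : torusAction q τ (aeval (Δ q) (h.coeff j)) = aeval (Δ q) (h.coeff j) := by
            rw [← Polynomial.aeval_algHom_apply, hτΔ]
          rw [AlgEquiv.toLinearMap_apply, map_mul, e, map_mul, map_pow, map_pow, hτb, hτc,
            _root_.smul_pow, _root_.smul_pow, smul_mul_smul_comm, mul_smul_comm, LinearMap.id_apply,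
            id, ← zpow_natCast, ← zpow_natCast, inv_zpow', ← zpow_add₀ hq0, hj']
          rw [show (2 * (j : ℤ) - (j + ((m - j : ℕ) : ℤ))) = j + -((m - j : ℕ) : ℤ) by ring, sub_self]
          exact Submodule.zero_mem _)
        (mem_subspace.2 (by simpa only [homog_apply] using hhP)) j
      have h2 : (Finset.range (m + 1)).filter (fun i => id i = j) = {j} := by
        ext i
        simp only [id, Finset.mem_filter, Finset.mem_singleton]
        exact ⟨fun h => h.2, fun h => ⟨h ▸ hj, h⟩⟩
      rw [h2, Finset.sum_singleton] at h1
      exact h1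
    obtain ⟨j, hj⟩ : ∃ j, h.coeff j ≠ 0 := by
      by_contra! hcon
      exact h0 (Polynomial.ext hcon)
    have hjm : j ∈ Finset.range (m + 1) :=
      Finset.mem_range.2 (Nat.lt_succ_of_le ((le_natDegree_of_ne_zero hj).trans hm))
    have hl : aeval (Δ q) (h.coeff j) ∈ P := by
      have h1 := hterm j hjm
      rw [← mul_assoc] at h1
      exact mem_of_mul_pow_mem hP.1 (isNormalModulo_b hq0 P) hb _
        (mem_of_mul_pow_mem hP.1 (isNormalModulo_c hq0 P) hc _ h1)
    set l := h.coeff j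
    -- a torus element with `Δ ↦ q Δ`
    let σ : Torus k := (![u, 1], 1)
    have hσ : torusAction q σ (Δ q) = q • Δ q := by
      rw [torusAction_Δ]; simp [σ, u]
    obtain ⟨i, hi⟩ : ∃ i, l.coeff i ≠ 0 := by
      by_contra! hcon
      exact hj (Polynomial.ext hcon)
    have h1 := sum_filter_mem_of_sum_mem (subspace P) (torusAction q σ).toLinearMap
        LinearMap.id (fun v hv => hP.2 σ v hv) (fun v hv => hv) (fun v => rfl) (fun v hv => hv)
        (Finset.range (l.natDegree + 1)) id (fun j => q ^ j)
        (pow_injective_of_pow_ne_one hq0 hq).injOn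
        (fun i => l.coeff i • Δ q ^ i)
        (fun i _ => by
          rw [AlgEquiv.toLinearMap_apply, map_smul, map_pow, hσ, _root_.smul_pow,
            LinearMap.id_apply, smul_comm, id, sub_self]
          exact Submodule.zero_mem _)
        (mem_subspace.2 (by rwa [← aeval_eq_sum_range])) i
    have h2 : (Finset.range (l.natDegree + 1)).filter (fun i' => id i' = i) = {i} := by
      ext i'
      simp only [id, Finset.mem_filter, Finset.mem_singleton]
      refine ⟨fun h => h.2, fun h => ⟨?_, h⟩⟩
      rw [h]
      exact Finset.mem_range.2 (Nat.lt_succ_of_le (le_natDegree_of_ne_zero hi))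
    rw [h2, Finset.sum_singleton] at h1
    by_contra hΔ
    exact pow_notMem_of_prime hP.1 (isNormalModulo_Δ hq0 P) hΔ i (P.mem_of_smul_mem hi h1)
  have hle : detIdeal q ≤ P := TwoSidedIdeal.span_le.2 (by rintro _ rfl; exact hΔP)
  by_contra hne
  obtain ⟨t, -, htP⟩ := exists_sub_mem hq0 hq hP.1 hb hc (lt_of_le_of_ne hle (Ne.symm hne))
  -- the torus element with `b ↦ q b` and `c ↦ c` moves `b - t c` to `q b - t c`
  let u : kˣ := Units.mk0 q hq0
  let σ : Torus k := (![u, 1], 1)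
  have h1 := P.sub_mem (hP.2 σ _ htP) htP
  rw [map_sub, map_smul, b, c, torusAction_X, torusAction_X] at h1
  have e : ((σ.1 0 : k) * (σ.2 1 : k)) • X q 0 1 - t • ((σ.1 1 : k) * (σ.2 0 : k)) • X q 1 0 -
      (X q 0 1 - t • X q 1 0) = (q - 1) • b q := by
    simp only [σ, u, Matrix.cons_val_zero, Matrix.cons_val_one, Pi.one_apply, Units.val_mk0,
      Units.val_one, mul_one, one_smul, b]
    module
  rw [e] at h1
  exact hb (P.mem_of_smul_mem (sub_ne_zero.2 fun h => hq 1 one_pos (by rw [pow_one, h])) h1)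

end OqM2

namespace OqM2

open NCRing Polynomial QPlane

variable {k : Type*} [Field k] {q : k}

/-! ### Ideals generated by generators of the algebra -/

variable (q) in
/-- The ideal generated by a set of the generators `X i j`. -/
def genIdeal (G : Set (Fin 2 × Fin 2)) : TwoSidedIdeal (OqM2 q) :=
  TwoSidedIdeal.span ((fun p => X q p.1 p.2) '' G)

variable (q) in
/-- The ordered monomial `bʲ cᵏ aⁱ dˡ`. -/
def ordMonomial (e : Fin 2 × Fin 2 →₀ ℕ) : OqM2 q :=
  b q ^ e (0, 1) * c q ^ e (1, 0) * a q ^ e (0, 0) * d q ^ e (1, 1)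

theorem X_mem_genIdeal {G : Set (Fin 2 × Fin 2)} {p : Fin 2 × Fin 2} (hp : p ∈ G) :
    X q p.1 p.2 ∈ genIdeal q G :=
  TwoSidedIdeal.subset_span ⟨p, hp, rfl⟩

theorem genIdeal_le {G : Set (Fin 2 × Fin 2)} {P : TwoSidedIdeal (OqM2 q)}
    (h : ∀ p ∈ G, X q p.1 p.2 ∈ P) : genIdeal q G ≤ P := by
  refine TwoSidedIdeal.span_le.2 ?_
  rintro _ ⟨p, hp, rfl⟩
  exact h p hp

theorem genIdeal_insert (G : Set (Fin 2 × Fin 2)) (p : Fin 2 × Fin 2) :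
    genIdeal q (insert p G) = genIdeal q G ⊔ TwoSidedIdeal.span {X q p.1 p.2} := by
  apply le_antisymm
  · refine genIdeal_le fun r hr => ?_
    rcases hr with rfl | hr
    · exact TwoSidedIdeal.mem_sup_right (TwoSidedIdeal.subset_span rfl)
    · exact TwoSidedIdeal.mem_sup_left (X_mem_genIdeal hr)
  · refine sup_le (genIdeal_le fun r hr => X_mem_genIdeal (Set.mem_insert_of_mem _ hr))
      (TwoSidedIdeal.span_le.2 ?_)
    rintro _ rfl
    exact X_mem_genIdeal (Set.mem_insert _ _)

theorem span_ordMonomial (hq0 : q ≠ 0) :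
    Submodule.span k (Set.range (ordMonomial q)) = ⊤ := by
  set W := Submodule.span k (Set.range (ordMonomial q)) with hW
  have hmem : ∀ j m i l, b q ^ j * c q ^ m * a q ^ i * d q ^ l ∈ W := fun j m i l =>
    Submodule.subset_span
      ⟨Finsupp.equivFunOnFinite.symm fun p => ![![i, j], ![m, l]] p.1 p.2, by simp [ordMonomial]⟩
  refine submodule_eq_top (by simpa using hmem 0 0 0 0) fun i j w hw => ?_
  induction hw using Submodule.span_induction with
  | zero => rw [mul_zero]; exact W.zero_mem
  | add x y _ _ hx hy => rw [mul_add]; exact W.add_mem hx hy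
  | smul s x _ hx => rw [mul_smul_comm]; exact W.smul_mem s hx
  | mem x hx =>
    obtain ⟨e, rfl⟩ := hx
    rw [ordMonomial]
    generalize e (0, 1) = j₁, e (1, 0) = m₁, e (0, 0) = i₁, e (1, 1) = l₁
    fin_cases i <;> fin_cases j
    · change a q * _ ∈ W
      rw [mul_assoc (b q ^ j₁ * c q ^ m₁), ← mul_assoc (a q), a_mul_bc_pow, smul_mul_assoc]
      refine W.smul_mem _ ?_
      convert hmem j₁ m₁ (i₁ + 1) l₁ using 1
      simp only [pow_succ', mul_assoc]
    · change b q * _ ∈ W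
      convert hmem (j₁ + 1) m₁ i₁ l₁ using 1
      simp only [pow_succ', mul_assoc]
    · change c q * _ ∈ W
      convert hmem j₁ (m₁ + 1) i₁ l₁ using 1
      simp only [pow_succ', mul_assoc]
      rw [← mul_assoc, ← (commute_b_c.pow_left j₁).eq, mul_assoc]
    · change d q * _ ∈ W
      rw [mul_assoc (b q ^ j₁ * c q ^ m₁), ← mul_assoc (d q), d_mul_bc_pow hq0, smul_mul_assoc]
      refine W.smul_mem _ ?_
      cases i₁ with
      | zero =>
        convert hmem j₁ m₁ 0 (l₁ + 1) using 1
        simp only [pow_succ', mul_assoc, pow_zero, one_mul]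
      | succ i₁ =>
        rw [mul_assoc _ (d q), ← mul_assoc (d q), d_mul_a_pow_succ hq0, add_mul, mul_add,
          smul_mul_assoc, mul_smul_comm]
        refine W.add_mem ?_ (W.smul_mem _ ?_)
        · convert hmem j₁ m₁ (i₁ + 1) (l₁ + 1) using 1
          simp only [pow_succ' (d q), mul_assoc]
        · convert hmem (j₁ + 1) (m₁ + 1) i₁ l₁ using 1
          simp only [pow_succ (b q), pow_succ (c q), mul_assoc]
          rw [← mul_assoc (c q ^ m₁) (b q), ← (commute_b_c.pow_right m₁).eq, mul_assoc]

theorem ordMonomial_mem_genIdeal {G : Set (Fin 2 × Fin 2)} {e : Fin 2 × Fin 2 →₀ ℕ}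
    {p : Fin 2 × Fin 2} (hp : p ∈ G) (he : e p ≠ 0) : ordMonomial q e ∈ genIdeal q G := by
  have hX := X_mem_genIdeal (q := q) hp
  have hpow : X q p.1 p.2 ^ e p ∈ genIdeal q G := by
    rw [← Nat.succ_pred_eq_of_ne_zero he, pow_succ]
    exact TwoSidedIdeal.mul_mem_left _ _ _ hX
  set J := genIdeal q G
  obtain ⟨i, j⟩ := p
  rw [ordMonomial]
  fin_cases i <;> fin_cases j
  · exact J.mul_mem_right _ _ (J.mul_mem_left _ _ hpow)
  · exact J.mul_mem_right _ _ (J.mul_mem_right _ _ (J.mul_mem_right _ _ hpow))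
  · exact J.mul_mem_right _ _ (J.mul_mem_right _ _ (J.mul_mem_left _ _ hpow))
  · exact J.mul_mem_left _ _ hpow

/-- Modulo `genIdeal q G`, each element is a combination of the monomials in the generators outside
`G`. -/
theorem exists_sub_sum_ordMonomial_mem (hq0 : q ≠ 0) (G : Set (Fin 2 × Fin 2)) (x : OqM2 q) :
    ∃ g : (Fin 2 × Fin 2 →₀ ℕ) →₀ k, (∀ e ∈ g.support, ∀ p ∈ G, e p = 0) ∧
      x - g.sum (fun e s => s • ordMonomial q e) ∈ genIdeal q G := by
  classical
  have hx : x ∈ Submodule.span k (Set.range (ordMonomial q)) := by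
    rw [span_ordMonomial hq0]; trivial
  obtain ⟨g, rfl⟩ := Finsupp.mem_span_range_iff_exists_finsupp.1 hx
  refine ⟨g.filter fun e => ∀ p ∈ G, e p = 0, fun e he => ?_, ?_⟩
  · rw [Finsupp.support_filter, Finset.mem_filter] at he
    exact he.2
  · have hsum : g.sum (fun e s => s • ordMonomial q e) =
        (g.filter fun e => ∀ p ∈ G, e p = 0).sum (fun e s => s • ordMonomial q e) +
        (g.filter fun e => ¬ ∀ p ∈ G, e p = 0).sum (fun e s => s • ordMonomial q e) := by
      rw [← Finsupp.sum_add_index' (h := fun e s => s • ordMonomial q e) (fun _ => zero_smul _ _)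
        (fun _ _ _ => add_smul _ _ _), Finsupp.filter_add_filter_not]
    rw [hsum, add_sub_cancel_left]
    refine TwoSidedIdeal.finsetSum_mem _ _ _ fun e he => ?_
    rw [Finsupp.support_filter, Finset.mem_filter] at he
    have := he.2
    push Not at this
    obtain ⟨p, hp, hep⟩ := this
    exact TwoSidedIdeal.smul_mem_of_algebra _ _ (ordMonomial_mem_genIdeal hp hep)

/-- A homomorphism that vanishes on `G`, and under which the monomials in the generators outside `G`
have independent images, has kernel `genIdeal q G`. -/
theorem ker_eq_genIdeal (hq0 : q ≠ 0) {G : Set (Fin 2 × Fin 2)} {B : Type*} [Ring B] [Algebra k B]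
    (f : OqM2 q →ₐ[k] B) (hf : ∀ p ∈ G, f (X q p.1 p.2) = 0)
    (hsep : ∀ e : Fin 2 × Fin 2 →₀ ℕ, (∀ p ∈ G, e p = 0) → ∃ φ : B →ₗ[k] k,
      φ (f (ordMonomial q e)) ≠ 0 ∧ ∀ e' : Fin 2 × Fin 2 →₀ ℕ, (∀ p ∈ G, e' p = 0) → e' ≠ e →
        φ (f (ordMonomial q e')) = 0) :
    TwoSidedIdeal.ker f = genIdeal q G := by
  have hle : genIdeal q G ≤ TwoSidedIdeal.ker f :=
    genIdeal_le fun p hp => (TwoSidedIdeal.mem_ker f).2 (hf p hp)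
  refine le_antisymm (fun x hx => ?_) hle
  obtain ⟨g, hg, hxg⟩ := exists_sub_sum_ordMonomial_mem hq0 G x
  have h0 : f (g.sum fun e s => s • ordMonomial q e) = 0 := by
    have h1 := (TwoSidedIdeal.mem_ker f).1 (hle hxg)
    rw [map_sub, (TwoSidedIdeal.mem_ker f).1 hx, zero_sub, neg_eq_zero] at h1
    exact h1
  have hg0 : g = 0 := by
    by_contra hne
    obtain ⟨e, he⟩ := Finsupp.support_nonempty_iff.2 hne
    obtain ⟨φ, hφ, hφ'⟩ := hsep e (hg e he)
    have h2 := congrArg φ h0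
    rw [Finsupp.sum, map_sum, map_sum, map_zero, Finset.sum_eq_single e] at h2
    · rw [map_smul, map_smul, smul_eq_zero] at h2
      exact h2.elim (Finsupp.mem_support_iff.1 he) hφ
    · intro e' he' hee'
      rw [map_smul, map_smul, hφ' e' (hg e' he') hee', smul_zero]
    · intro h
      exact absurd he h
  rwa [hg0, Finsupp.sum_zero_index, sub_zero] at hxg

theorem toPlane_ordMonomial (hq0 : q ≠ 0) {D : Type*} [CommRing D] [Algebra k D]
    (α β γ δ : D) (h : α * 0 * algebraMap k D q = β * γ) (e : Fin 2 × Fin 2 →₀ ℕ) :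
    toPlane hq0 α β γ δ 0 h (ordMonomial q e) = mono _ ((e (0, 0) : ℤ) - e (1, 1))
      (C (α ^ e (0, 0) * β ^ e (0, 1) * γ ^ e (1, 0) * δ ^ e (1, 1)) *
        Polynomial.X ^ (e (0, 1) + e (1, 0))) := by
  have h1 : mono (unitOf D hq0) (-1) (C δ + C 0 * Polynomial.X ^ 2) = mono _ (-1) (C δ) := by
    rw [C_0, zero_mul, add_zero]
  have h2 : (C β * Polynomial.X) ^ e (0, 1) * ((C γ * Polynomial.X) ^ e (1, 0) *
      (C (α ^ e (0, 0)) * C (δ ^ e (1, 1)))) =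
      C (α ^ e (0, 0) * β ^ e (0, 1) * γ ^ e (1, 0) * δ ^ e (1, 1)) *
        Polynomial.X ^ (e (0, 1) + e (1, 0)) := by
    simp only [C_mul, C_pow]
    ring
  have h3 : 1 * (e (0, 0) : ℤ) + -1 * e (1, 1) = (e (0, 0) : ℤ) - e (1, 1) := by ring
  rw [ordMonomial, map_mul, map_mul, map_mul, map_pow, map_pow, map_pow, map_pow, toPlane_a,
    toPlane_b, toPlane_c, toPlane_d, h1, mono_zero_pow, mono_zero_pow,
    mono_C_pow, mono_C_pow, mul_assoc, mul_assoc, mono_mul_mono (1 * _),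
    scaleEquiv_zpow_C, mono_zero_mul_mono, mono_zero_mul_mono, h2, h3]

/-- The coefficient of `Tⁿ yᵐ xⁱ` on the quantum plane over `k[T]`. -/
def planeCoeff (v : k[X]ˣ) (i : ℤ) (m n : ℕ) : QPlane v →ₗ[k] k where
  toFun x := ((coeffX i x).coeff m).coeff n
  map_add' x y := by rw [map_add, coeff_add, coeff_add]
  map_smul' s x := by
    have : coeffX i (s • x) = s • coeffX i x := rfl
    rw [this, coeff_smul, coeff_smul]
    rfl

theorem planeCoeff_mono (v : k[X]ˣ) (i i' : ℤ) (m n : ℕ) (p : k[X][X]) :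
    planeCoeff v i m n (mono v i' p) = if i' = i then (p.coeff m).coeff n else 0 := by
  change ((coeffX i (mono v i' p)).coeff m).coeff n = _
  rw [coeffX_mono]
  split_ifs <;> simp

open Classical in
/-- If `G` contains `b` or `c`, then `genIdeal q G` is the kernel of a homomorphism to the quantum
plane over `k[T]`, with `a ↦ x`, `d ↦ T x⁻¹` and `b ↦ y` or `c ↦ y`, except that the elements of `G`
are sent to zero. -/
theorem exists_toPlane_ker_eq_genIdeal (hq0 : q ≠ 0) {G : Set (Fin 2 × Fin 2)}
    (hG : (0, 1) ∈ G ∨ (1, 0) ∈ G) :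
    ∃ f : OqM2 q →ₐ[k] QPlane (unitOf k[X] hq0), TwoSidedIdeal.ker f = genIdeal q G ∧
      ∀ p ∉ G, f (X q p.1 p.2) ≠ 0 := by
  let α : k[X] := if (0, 0) ∈ G then 0 else 1
  let β : k[X] := if (0, 1) ∈ G then 0 else 1
  let γ : k[X] := if (1, 0) ∈ G then 0 else 1
  let δ : k[X] := if (1, 1) ∈ G then 0 else Polynomial.X
  have hβγ : α * 0 * algebraMap k k[X] q = β * γ := by
    rcases hG with h | h <;> simp [β, γ, h]
  let f := toPlane hq0 α β γ δ 0 hβγ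
  have hfa : f (a q) = mono _ 1 (C α) := toPlane_a ..
  have hfb : f (b q) = mono _ 0 (C β * Polynomial.X) := toPlane_b ..
  have hfc : f (c q) = mono _ 0 (C γ * Polynomial.X) := toPlane_c ..
  have hfd : f (d q) = mono _ (-1) (C δ) := by
    rw [show f (d q) = _ from toPlane_d .., C_0, zero_mul, add_zero]
  refine ⟨f, ker_eq_genIdeal hq0 f ?_ ?_, ?_⟩
  · rintro ⟨i, j⟩ hp
    fin_cases i <;> fin_cases j
    · change f (a q) = 0
      rw [hfa, mono_eq_zero]
      simpa [α] using hp
    · change f (b q) = 0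
      rw [hfb, mono_eq_zero]
      simpa [β] using hp
    · change f (c q) = 0
      rw [hfc, mono_eq_zero]
      simpa [γ] using hp
    · change f (d q) = 0
      rw [hfd, mono_eq_zero]
      simpa [δ] using hp
  · have hM : ∀ e : Fin 2 × Fin 2 →₀ ℕ, (∀ p ∈ G, e p = 0) → f (ordMonomial q e) =
        mono _ ((e (0, 0) : ℤ) - e (1, 1))
          (C (Polynomial.X ^ e (1, 1)) * Polynomial.X ^ (e (0, 1) + e (1, 0))) := by
      intro e he
      have h1 : α ^ e (0, 0) = 1 := by
        by_cases h : (0, 0) ∈ G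
        · rw [he _ h, pow_zero]
        · simp [α, h]
      have h2 : β ^ e (0, 1) = 1 := by
        by_cases h : (0, 1) ∈ G
        · rw [he _ h, pow_zero]
        · simp [β, h]
      have h3 : γ ^ e (1, 0) = 1 := by
        by_cases h : (1, 0) ∈ G
        · rw [he _ h, pow_zero]
        · simp [γ, h]
      have h4 : δ ^ e (1, 1) = Polynomial.X ^ e (1, 1) := by
        by_cases h : (1, 1) ∈ G
        · rw [he _ h, pow_zero, pow_zero]
        · simp [δ, h]
      rw [show f (ordMonomial q e) = _ from toPlane_ordMonomial .., h1, h2, h3, h4, one_mul, one_mul,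
        one_mul]
    intro e he
    refine ⟨planeCoeff _ ((e (0, 0) : ℤ) - e (1, 1)) (e (0, 1) + e (1, 0)) (e (1, 1)), ?_, ?_⟩
    · rw [hM e he, planeCoeff_mono, if_pos rfl, coeff_C_mul_X_pow, if_pos rfl, coeff_X_pow_self]
      exact one_ne_zero
    · intro e' he' hne
      rw [hM e' he', planeCoeff_mono, coeff_C_mul_X_pow]
      split_ifs with h h'
      · rw [coeff_X_pow, if_neg]
        intro h''
        apply hne
        have hbc : (e (0, 1) = 0 ∧ e' (0, 1) = 0) ∨ (e (1, 0) = 0 ∧ e' (1, 0) = 0) :=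
          hG.imp (fun h => ⟨he _ h, he' _ h⟩) (fun h => ⟨he _ h, he' _ h⟩)
        ext ⟨i, j⟩
        fin_cases i <;> fin_cases j <;> simp only [Fin.zero_eta, Fin.mk_one] <;> omega
      · exact coeff_zero _
      · rfl
  · rintro ⟨i, j⟩ hp
    fin_cases i <;> fin_cases j
    · change f (a q) ≠ 0
      rw [hfa, Ne, mono_eq_zero]
      simpa [α] using hp
    · change f (b q) ≠ 0
      rw [hfb, Ne, mono_eq_zero]
      simpa [β] using hp
    · change f (c q) ≠ 0
      rw [hfc, Ne, mono_eq_zero]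
      simpa [γ] using hp
    · change f (d q) ≠ 0
      rw [hfd, Ne, mono_eq_zero]
      simpa [δ] using hp

theorem isCompletelyPrime_genIdeal (hq0 : q ≠ 0) {G : Set (Fin 2 × Fin 2)}
    (hG : (0, 1) ∈ G ∨ (1, 0) ∈ G) : IsCompletelyPrime (genIdeal q G) := by
  obtain ⟨f, hf, -⟩ := exists_toPlane_ker_eq_genIdeal hq0 hG
  rw [← hf]
  exact isCompletelyPrime_ker (f : OqM2 q →+* QPlane (unitOf k[X] hq0))

theorem X_mem_genIdeal_iff (hq0 : q ≠ 0) {G : Set (Fin 2 × Fin 2)}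
    (hG : (0, 1) ∈ G ∨ (1, 0) ∈ G) {p : Fin 2 × Fin 2} : X q p.1 p.2 ∈ genIdeal q G ↔ p ∈ G := by
  refine ⟨fun h => ?_, X_mem_genIdeal⟩
  obtain ⟨f, hf, hf'⟩ := exists_toPlane_ker_eq_genIdeal hq0 hG
  by_contra hp
  rw [← hf, TwoSidedIdeal.mem_ker] at h
  exact hf' p hp h

/-- The factor algebras in which both `b` and `c`, or `a`, `d` and one of `b`, `c`, vanish are
commutative polynomial rings. -/
theorem exists_ker_eq_genIdeal_of_comm (hq0 : q ≠ 0) {G : Set (Fin 2 × Fin 2)}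
    (hG : (0, 1) ∈ G ∨ (1, 0) ∈ G)
    (hG' : ((0, 1) ∈ G ∧ (1, 0) ∈ G) ∨ ((0, 0) ∈ G ∧ (1, 1) ∈ G)) :
    ∃ f : OqM2 q →ₐ[k] MvPolynomial {p // p ∉ G} k, Function.Surjective f ∧
      TwoSidedIdeal.ker f = genIdeal q G := by
  classical
  let g : Fin 2 × Fin 2 → MvPolynomial {p // p ∉ G} k := fun p =>
    if h : p ∈ G then 0 else MvPolynomial.X ⟨p, h⟩
  have hg0 : ∀ p ∈ G, g p = 0 := fun p hp => by simp [g, hp]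
  have hbc : g (0, 1) * g (1, 0) = 0 := by
    rcases hG with h | h <;> simp [hg0 _ h]
  have hx : ∀ p r, (p = (0, 0) ∨ p = (1, 1)) → (r = (0, 1) ∨ r = (1, 0)) → g p * g r = 0 := by
    intro p r hp hr
    rcases hG' with ⟨h1, h2⟩ | ⟨h1, h2⟩
    · rcases hr with rfl | rfl <;> simp [hg0 _ h1, hg0 _ h2]
    · rcases hp with rfl | rfl <;> simp [hg0 _ h1, hg0 _ h2]
  let f : OqM2 q →ₐ[k] MvPolynomial {p // p ∉ G} k := lift q (fun i j => g (i, j))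
    (by rw [mul_comm (g (0, 1)), hx (0, 0) (0, 1) (by simp) (by simp), smul_zero])
    (by rw [mul_comm (g (1, 0)), hx (0, 0) (1, 0) (by simp) (by simp), smul_zero])
    (by rw [mul_comm (g (0, 1)), hx (1, 1) (0, 1) (by simp) (by simp), smul_zero])
    (by rw [mul_comm (g (1, 0)), hx (1, 1) (1, 0) (by simp) (by simp), smul_zero])
    (mul_comm _ _)
    (by rw [hbc, smul_zero, mul_comm, sub_self])
  have hf : ∀ p : Fin 2 × Fin 2, f (X q p.1 p.2) = g p := fun p => lift_X ..
  refine ⟨f, ?_, ker_eq_genIdeal hq0 f (fun p hp => (hf p).trans (hg0 p hp)) ?_⟩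
  · rw [← AlgHom.range_eq_top, eq_top_iff, ← MvPolynomial.adjoin_range_X, Algebra.adjoin_le_iff]
    rintro _ ⟨⟨p, hp⟩, rfl⟩
    exact ⟨X q p.1 p.2, (hf p).trans (by simp [g, hp])⟩
  · have hM : ∀ e : Fin 2 × Fin 2 →₀ ℕ, (∀ p ∈ G, e p = 0) →
        f (ordMonomial q e) = MvPolynomial.monomial (e.subtypeDomain fun p => p ∉ G) 1 := by
      intro e he
      have h1 : f (ordMonomial q e) = ∏ p, g p ^ e p := by
        have hfa : f (a q) = g (0, 0) := hf (0, 0)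
        have hfb : f (b q) = g (0, 1) := hf (0, 1)
        have hfc : f (c q) = g (1, 0) := hf (1, 0)
        have hfd : f (d q) = g (1, 1) := hf (1, 1)
        rw [ordMonomial, map_mul, map_mul, map_mul, map_pow, map_pow, map_pow, map_pow, hfa, hfb,
          hfc, hfd, Fintype.prod_prod_type, Fin.prod_univ_two, Fin.prod_univ_two, Fin.prod_univ_two]
        ring
      rw [h1, MvPolynomial.monomial_eq, map_one, one_mul,
        Finsupp.prod_fintype _ _ (fun _ => pow_zero _),
        ← Fintype.prod_subtype_mul_prod_subtype (fun p => p ∉ G)]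
      have h2 : ∏ p : {p // ¬ p ∉ G}, g p ^ e p = 1 :=
        Finset.prod_eq_one fun p _ => by rw [he p.1 (not_not.1 p.2), pow_zero]
      rw [h2, mul_one]
      refine Finset.prod_congr rfl fun p _ => ?_
      simp [g, p.2]
    intro e he
    refine ⟨MvPolynomial.lcoeff k (e.subtypeDomain fun p => p ∉ G), ?_, fun e' he' hne => ?_⟩
    · rw [hM e he, MvPolynomial.lcoeff_apply, MvPolynomial.coeff_monomial, if_pos rfl]
      exact one_ne_zero
    · rw [hM e' he', MvPolynomial.lcoeff_apply, MvPolynomial.coeff_monomial, if_neg]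
      intro h
      apply hne
      ext p
      by_cases hp : p ∈ G
      · rw [he p hp, he' p hp]
      · exact DFunLike.congr_fun h ⟨p, hp⟩

end OqM2

namespace OqM2

open NCRing Polynomial

variable {k : Type*} [Field k] {q : k}

/-! ### Primes that contain `b` or `c` -/

section Prime

variable {P : TwoSidedIdeal (OqM2 q)}

theorem bc_mem (h : b q ∈ P ∨ c q ∈ P) : b q * c q ∈ P :=
  h.elim (P.mul_mem_right _ _) (P.mul_mem_left _ _)

/-- Modulo `b` or `c`, the four generators commute up to nonzero scalars. -/
theorem isNormalModulo_X (hq0 : q ≠ 0) (h : b q ∈ P ∨ c q ∈ P) (p : Fin 2 × Fin 2) :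
    IsNormalModulo P (X q p.1 p.2) := by
  have hbc := bc_mem h
  have key : ∀ {x y : OqM2 q} {s : k}, x * y = s • (y * x) → x * y - s • (y * x) ∈ P :=
    fun h => by rw [sub_eq_zero_of_eq h]; exact P.zero_mem
  obtain ⟨i, j⟩ := p
  fin_cases i <;> fin_cases j
  · refine isNormalModulo_of_skew fun i j => ?_
    fin_cases i <;> fin_cases j
    · exact ⟨1, one_ne_zero, by rw [one_smul, sub_self]; exact P.zero_mem⟩
    · exact ⟨q, hq0, key (a_mul_b q)⟩
    · exact ⟨q, hq0, key (a_mul_c q)⟩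
    · refine ⟨1, one_ne_zero, ?_⟩
      rw [one_smul]
      change a q * d q - d q * a q ∈ P
      rw [a_mul_d_sub]
      exact P.smul_mem_of_algebra _ hbc
  · exact isNormalModulo_b hq0 P
  · exact isNormalModulo_c hq0 P
  · refine isNormalModulo_of_skew fun i j => ?_
    fin_cases i <;> fin_cases j
    · refine ⟨1, one_ne_zero, ?_⟩
      rw [one_smul]
      change d q * a q - a q * d q ∈ P
      rw [← neg_sub, a_mul_d_sub]
      exact P.neg_mem (P.smul_mem_of_algebra _ hbc)
    · exact ⟨q⁻¹, inv_ne_zero hq0, key (d_mul_b hq0)⟩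
    · exact ⟨q⁻¹, inv_ne_zero hq0, key (d_mul_c hq0)⟩
    · exact ⟨1, one_ne_zero, by rw [one_smul, sub_self]; exact P.zero_mem⟩

theorem ordMonomial_notMem (hq0 : q ≠ 0) (hP : IsPrimeIdeal P) (h : b q ∈ P ∨ c q ∈ P)
    {e : Fin 2 × Fin 2 →₀ ℕ} (he : ∀ p : Fin 2 × Fin 2, X q p.1 p.2 ∈ P → e p = 0) :
    ordMonomial q e ∉ P := by
  have key : ∀ (p : Fin 2 × Fin 2) (x : OqM2 q), x * X q p.1 p.2 ^ e p ∈ P → x ∈ P := by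
    intro p x hx
    by_cases hp : X q p.1 p.2 ∈ P
    · simpa [he p hp] using hx
    · exact mem_of_mul_pow_mem hP (isNormalModulo_X hq0 h p) hp _ hx
  intro hM
  have h1 := key (0, 1) 1 (by
    rw [one_mul]; exact key (1, 0) _ (key (0, 0) _ (key (1, 1) _ hM)))
  exact hP.1 ((TwoSidedIdeal.one_mem_iff _).1 h1)

/-- If the monomials in the generators outside a prime `P` can be separated by operators that
preserve `P`, then `P` is generated by generators of the algebra. -/
theorem eq_genIdeal_of_separated (hq0 : q ≠ 0) (hP : IsPrimeIdeal P) (h : b q ∈ P ∨ c q ∈ P)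
    (hsep : ∀ i j : Fin 2 × Fin 2 →₀ ℕ, (∀ p : Fin 2 × Fin 2, X q p.1 p.2 ∈ P → i p = 0) →
      (∀ p : Fin 2 × Fin 2, X q p.1 p.2 ∈ P → j p = 0) → i ≠ j →
      ∃ (L R : OqM2 q →ₗ[k] OqM2 q) (μ : (Fin 2 × Fin 2 →₀ ℕ) → k),
      (∀ v ∈ P, L v ∈ P) ∧ (∀ v ∈ P, R v ∈ P) ∧ (∀ v, R v ∈ P → v ∈ P) ∧
      (∀ l : Fin 2 × Fin 2 →₀ ℕ, (∀ p : Fin 2 × Fin 2, X q p.1 p.2 ∈ P → l p = 0) →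
        L (ordMonomial q l) - μ l • R (ordMonomial q l) ∈ P) ∧ μ i ≠ μ j) :
    P = genIdeal q {p | X q p.1 p.2 ∈ P} := by
  have hle : genIdeal q {p | X q p.1 p.2 ∈ P} ≤ P := genIdeal_le fun p hp => hp
  refine le_antisymm (fun x hx => ?_) hle
  obtain ⟨g, hg, hxg⟩ := exists_sub_sum_ordMonomial_mem hq0 {p | X q p.1 p.2 ∈ P} x
  have hsum : g.sum (fun e s => s • ordMonomial q e) ∈ P := by
    simpa using P.sub_mem hx (hle hxg)
  have hg0 : g = 0 := by
    by_contra hne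
    obtain ⟨e, he⟩ := Finsupp.support_nonempty_iff.2 hne
    refine ordMonomial_notMem hq0 hP h (hg e he) ?_
    refine mem_subspace.1 (mem_of_sum_mem_of_separated (subspace P) g.support (ordMonomial q)
      (fun i hi j hj hij => ?_) g hsum e he (Finsupp.mem_support_iff.1 he))
    obtain ⟨L, R, μ, h1, h2, h3, h4, h5⟩ := hsep i j (hg i hi) (hg j hj) hij
    exact ⟨L, R, μ, h1, h2, h3, fun l hl => h4 l (hg l hl), h5⟩
  rwa [hg0, Finsupp.sum_zero_index, sub_zero] at hxg

theorem torusAction_ordMonomial (h : Torus k) (e : Fin 2 × Fin 2 →₀ ℕ) :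
    torusAction q h (ordMonomial q e) =
      (((h.1 0 : k) * h.2 1) ^ e (0, 1) * ((h.1 1 : k) * h.2 0) ^ e (1, 0) *
        ((h.1 0 : k) * h.2 0) ^ e (0, 0) * ((h.1 1 : k) * h.2 1) ^ e (1, 1)) •
        ordMonomial q e := by
  rw [ordMonomial, map_mul, map_mul, map_mul, map_pow, map_pow, map_pow, map_pow, torusAction_X,
    torusAction_X, torusAction_X, torusAction_X, _root_.smul_pow, _root_.smul_pow, _root_.smul_pow,
    _root_.smul_pow, smul_mul_smul_comm, smul_mul_smul_comm, smul_mul_smul_comm]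

/-- Once `b` or `c` is absent, the torus separates the exponents of each of the other
generators. -/
theorem exists_torusAction_ordMonomial (hq0 : q ≠ 0) {G : Set (Fin 2 × Fin 2)}
    (hG : (0, 1) ∈ G ∨ (1, 0) ∈ G) {p : Fin 2 × Fin 2} (hp : p ∉ G) :
    ∃ h : Torus k, ∀ e : Fin 2 × Fin 2 →₀ ℕ, (∀ r ∈ G, e r = 0) →
      torusAction q h (ordMonomial q e) = q ^ e p • ordMonomial q e := by
  let u : kˣ := Units.mk0 q hq0
  have key : ∀ h : Torus k, (∀ e : Fin 2 × Fin 2 →₀ ℕ, (∀ r ∈ G, e r = 0) →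
      ((h.1 0 : k) * h.2 1) ^ e (0, 1) * ((h.1 1 : k) * h.2 0) ^ e (1, 0) *
        ((h.1 0 : k) * h.2 0) ^ e (0, 0) * ((h.1 1 : k) * h.2 1) ^ e (1, 1) = q ^ e p) →
      ∃ h : Torus k, ∀ e : Fin 2 × Fin 2 →₀ ℕ, (∀ r ∈ G, e r = 0) →
      torusAction q h (ordMonomial q e) = q ^ e p • ordMonomial q e := fun h hh =>
    ⟨h, fun e he => by rw [torusAction_ordMonomial, hh e he]⟩
  obtain ⟨i, j⟩ := p
  rcases hG with hG | hG <;> fin_cases i <;> fin_cases j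
  · exact key (![u, 1], 1) fun e he => by simp [he _ hG, u]
  · exact absurd hG hp
  · exact key (![1, u], ![1, u⁻¹]) fun e he => by simp [he _ hG, u, hq0]
  · exact key (1, ![1, u]) fun e he => by simp [he _ hG, u]
  · exact key (1, ![u, 1]) fun e he => by simp [he _ hG, u]
  · exact key (![u, 1], ![u⁻¹, 1]) fun e he => by simp [he _ hG, u, hq0]
  · exact absurd hG hp
  · exact key (![1, u], 1) fun e he => by simp [he _ hG, u]

/-- The torus-stable primes that contain `b` or `c` are generated by generators of the algebra. -/
theorem IsHPrime.eq_genIdeal (hq0 : q ≠ 0) (hq : ∀ n : ℕ, 0 < n → q ^ n ≠ 1) (hP : IsHPrime P)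
    (h : b q ∈ P ∨ c q ∈ P) : P = genIdeal q {p | X q p.1 p.2 ∈ P} := by
  refine eq_genIdeal_of_separated hq0 hP.1 h fun i j hi hj hij => ?_
  obtain ⟨p, hp⟩ := DFunLike.ne_iff.1 hij
  have hpG : p ∉ {p : Fin 2 × Fin 2 | X q p.1 p.2 ∈ P} := fun hpP =>
    hp ((hi p hpP).trans (hj p hpP).symm)
  obtain ⟨τ, hτ⟩ := exists_torusAction_ordMonomial hq0 h hpG
  refine ⟨(torusAction q τ).toLinearMap, LinearMap.id, fun e => q ^ e p, fun v hv => hP.2 τ v hv,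
    fun v hv => hv, fun v hv => hv, fun l hl => ?_,
    fun he => hp (pow_injective_of_pow_ne_one hq0 hq he)⟩
  rw [AlgEquiv.toLinearMap_apply, hτ l hl, LinearMap.id_apply, sub_self]
  exact P.zero_mem

/-- If exactly two generators lie outside the prime `P`, and these two commute up to a factor that
is not a root of unity, then `P` is generated by the other two. -/
theorem eq_genIdeal_of_skew (hq0 : q ≠ 0) (hP : IsPrimeIdeal P) (h : b q ∈ P ∨ c q ∈ P)
    {u : k} (hu0 : u ≠ 0) (hu : ∀ n : ℕ, 0 < n → u ^ n ≠ 1) {r s : Fin 2 × Fin 2}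
    (hr : X q r.1 r.2 ∉ P) (hs : X q s.1 s.2 ∉ P) (hrs : ∀ p, p ≠ r → p ≠ s → X q p.1 p.2 ∈ P)
    (hskew : X q s.1 s.2 * X q r.1 r.2 = u • (X q r.1 r.2 * X q s.1 s.2))
    (hM : ∀ e : Fin 2 × Fin 2 →₀ ℕ, (∀ p : Fin 2 × Fin 2, X q p.1 p.2 ∈ P → e p = 0) →
      ordMonomial q e = X q r.1 r.2 ^ e r * X q s.1 s.2 ^ e s) :
    P = genIdeal q {p | X q p.1 p.2 ∈ P} := by
  refine eq_genIdeal_of_separated hq0 hP h fun i j hi hj hij => ?_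
  by_cases her : i r = j r
  · have hes : i s ≠ j s := fun hes => hij <| Finsupp.ext fun p => by
      by_cases hp : p = r
      · rw [hp, her]
      · by_cases hp' : p = s
        · rw [hp', hes]
        · rw [hi p (hrs p hp hp'), hj p (hrs p hp hp')]
    have hskew' : X q r.1 r.2 * X q s.1 s.2 = u⁻¹ • (X q s.1 s.2 * X q r.1 r.2) := by
      rw [hskew, smul_smul, inv_mul_cancel₀ hu0, one_smul]
    refine ⟨LinearMap.mulLeft k (X q r.1 r.2), LinearMap.mulRight k (X q r.1 r.2),
      fun e => u⁻¹ ^ e s, fun v hv => P.mul_mem_left _ _ hv, fun v hv => P.mul_mem_right _ _ hv,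
      fun v hv => (isNormalModulo_X hq0 h r).mem_of_mul_mem_right hP hr hv, fun e he => ?_,
      fun he => hes (pow_injective_of_pow_ne_one hu0 hu ?_)⟩
    · rw [LinearMap.mulLeft_apply, LinearMap.mulRight_apply, hM e he, ← mul_assoc, ← pow_succ',
        pow_succ, mul_assoc, mul_pow_of_skew hskew', mul_smul_comm, mul_assoc, sub_self]
      exact P.zero_mem
    · simpa using he
  · refine ⟨LinearMap.mulLeft k (X q s.1 s.2), LinearMap.mulRight k (X q s.1 s.2),
      fun e => u ^ e r, fun v hv => P.mul_mem_left _ _ hv, fun v hv => P.mul_mem_right _ _ hv,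
      fun v hv => (isNormalModulo_X hq0 h s).mem_of_mul_mem_right hP hs hv, fun e he => ?_,
      fun he => her (pow_injective_of_pow_ne_one hu0 hu he)⟩
    rw [LinearMap.mulLeft_apply, LinearMap.mulRight_apply, hM e he, ← mul_assoc,
      mul_pow_of_skew hskew, smul_mul_assoc, mul_assoc, mul_assoc, ← pow_succ', ← pow_succ,
      sub_self]
    exact P.zero_mem

/-- The factor algebras in which exactly one of `b`, `c` and one of `a`, `d` survive are quantum
planes; their only primes avoiding these two generators are zero. -/
theorem eq_genIdeal_of_xor (hq0 : q ≠ 0) (hq : ∀ n : ℕ, 0 < n → q ^ n ≠ 1) (hP : IsPrimeIdeal P)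
    (hbc : Xor (b q ∈ P) (c q ∈ P)) (had : Xor (a q ∈ P) (d q ∈ P)) :
    P = genIdeal q {p | X q p.1 p.2 ∈ P} := by
  have hq' := inv_pow_ne_one_of_pow_ne_one hq
  have hq0' := inv_ne_zero hq0
  rcases hbc with ⟨h1, h2⟩ | ⟨h1, h2⟩ <;> rcases had with ⟨h3, h4⟩ | ⟨h3, h4⟩
  · exact eq_genIdeal_of_skew hq0 hP (Or.inl h1) hq0' hq' (r := (1, 0)) (s := (1, 1)) h2 h4
      (by rintro ⟨i, j⟩; fin_cases i <;> fin_cases j <;> simp [h1, h3]) (d_mul_c hq0)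
      fun e he => by rw [ordMonomial, he (0, 1) h1, he (0, 0) h3]; simp
  · exact eq_genIdeal_of_skew hq0 hP (Or.inl h1) hq0 hq (r := (1, 0)) (s := (0, 0)) h2 h4
      (by rintro ⟨i, j⟩; fin_cases i <;> fin_cases j <;> simp [h1, h3]) (a_mul_c q)
      fun e he => by rw [ordMonomial, he (0, 1) h1, he (1, 1) h3]; simp
  · exact eq_genIdeal_of_skew hq0 hP (Or.inr h1) hq0' hq' (r := (0, 1)) (s := (1, 1)) h2 h4
      (by rintro ⟨i, j⟩; fin_cases i <;> fin_cases j <;> simp [h1, h3]) (d_mul_b hq0)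
      fun e he => by rw [ordMonomial, he (1, 0) h1, he (0, 0) h3]; simp
  · exact eq_genIdeal_of_skew hq0 hP (Or.inr h1) hq0 hq (r := (0, 1)) (s := (0, 0)) h2 h4
      (by rintro ⟨i, j⟩; fin_cases i <;> fin_cases j <;> simp [h1, h3]) (a_mul_b q)
      fun e he => by rw [ordMonomial, he (1, 0) h1, he (1, 1) h3]; simp

theorem a_mul_gwaGen_sub_mem (hq0 : q ≠ 0) (h : b q ∈ P ∨ c q ∈ P) (i : ℤ) :
    a q * gwaGen q i - gwaGen q i * a q ∈ P := by
  rcases le_or_gt 0 i with hi | hi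
  · obtain ⟨n, rfl⟩ := Int.eq_ofNat_of_zero_le hi
    rw [gwaGen_natCast, ← pow_succ, ← pow_succ', sub_self]
    exact P.zero_mem
  · obtain ⟨n, rfl⟩ : ∃ n : ℕ, i = -((n + 1 : ℕ) : ℤ) := ⟨(-i - 1).toNat, by omega⟩
    rw [gwaGen_neg, d_pow_succ_mul_a hq0, sub_add_cancel_left]
    exact P.neg_mem (P.smul_mem_of_algebra _ (P.mul_mem_right _ _ (bc_mem h)))

/-- Over a prime that contains `b` but no other generator there is some `Δ - t` with `t ≠ 0`, unless
the prime is `⟨b⟩`. -/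
theorem exists_Δ_sub_mem [IsAlgClosed k] (hq0 : q ≠ 0) (hq : ∀ n : ℕ, 0 < n → q ^ n ≠ 1)
    (hP : IsPrimeIdeal P) (ha : a q ∉ P) (hc : c q ∉ P) (hd : d q ∉ P)
    (hlt : TwoSidedIdeal.span {b q} < P) : ∃ t : k, t ≠ 0 ∧ Δ q - algebraMap k _ t ∈ P := by
  have hb : b q ∈ P := hlt.le (TwoSidedIdeal.subset_span rfl)
  have hbJ : b q ∈ TwoSidedIdeal.span {b q} := TwoSidedIdeal.subset_span rfl
  obtain ⟨x, hxP, hx⟩ := SetLike.exists_of_lt hlt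
  obtain ⟨f, hf, rfl⟩ := exists_normalForm hq0 x
  set J := TwoSidedIdeal.span {b q}
  have : ∃ p, homog q p.2 (f p) ∉ J := by
    by_contra! h
    exact hx (J.finsetSum_mem _ _ fun p _ => J.mul_mem_right _ _ (h p))
  obtain ⟨p, hp⟩ := this
  have hps : p ∈ f.support := by
    rw [Finsupp.mem_support_iff]
    intro h
    rw [h, map_zero] at hp
    exact hp J.zero_mem
  have h1 : homog q p.2 (f p) * gwaGen q p.1 ∈ P := by
    refine mem_subspace.1 (mem_of_sum_mem_of_separated (subspace P) f.support
      (fun p => homog q p.2 (f p) * gwaGen q p.1) (fun i _ j _ hij => ?_) (fun _ => 1)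
      (by simp only [one_smul]; exact hxP) p hps one_ne_zero)
    by_cases h1 : i.1 = j.1
    · have h2 : i.2 ≠ j.2 := fun h2 => hij (Prod.ext h1 h2)
      refine ⟨LinearMap.mulLeft k (a q), LinearMap.mulRight k (a q), fun p => q ^ p.2,
        fun v hv => P.mul_mem_left _ _ hv, fun v hv => P.mul_mem_right _ _ hv,
        fun v hv => (isNormalModulo_X hq0 (Or.inl hb) (0, 0)).mem_of_mul_mem_right hP ha hv,
        fun p _ => ?_, fun he => h2 (pow_injective_of_pow_ne_one hq0 hq he)⟩
      rw [LinearMap.mulLeft_apply, LinearMap.mulRight_apply, ← mul_assoc, a_mul_homog hq0,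
        smul_mul_assoc, mul_assoc, mul_assoc]
      have h3 := P.smul_mem_of_algebra (q ^ p.2) (P.mul_mem_left (homog q p.2 (f p)) _
        (a_mul_gwaGen_sub_mem hq0 (Or.inl hb) p.1))
      convert! h3 using 1
      rw [mul_sub]
      module
    · refine ⟨LinearMap.mulLeft k (c q), LinearMap.mulRight k (c q), fun p => q ^ (-p.1),
        fun v hv => P.mul_mem_left _ _ hv, fun v hv => P.mul_mem_right _ _ hv,
        fun v hv => (isNormalModulo_c hq0 P).mem_of_mul_mem_right hP hc hv,
        fun p _ => ?_, fun he => h1 (neg_injective (zpow_injective_of_pow_ne_one hq0 hq he))⟩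
      rw [LinearMap.mulLeft_apply, LinearMap.mulRight_apply, ← mul_assoc,
        (commute_c_homog hq0 _ _).eq, mul_assoc, c_mul_gwaGen hq0, mul_smul_comm, mul_assoc,
        sub_self]
      exact Submodule.zero_mem _
  have h2 : homog q p.2 (f p) ∈ P := by
    rcases le_or_gt 0 p.1 with hi | hi
    · obtain ⟨n, hn⟩ := Int.eq_ofNat_of_zero_le hi
      rw [hn, gwaGen_natCast] at h1
      exact mem_of_mul_pow_mem hP (isNormalModulo_X hq0 (Or.inl hb) (0, 0)) ha _ h1
    · obtain ⟨n, hn⟩ : ∃ n : ℕ, p.1 = -(n : ℤ) := ⟨(-p.1).toNat, by omega⟩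
      rw [hn, gwaGen_neg] at h1
      exact mem_of_mul_pow_mem hP (isNormalModulo_X hq0 (Or.inl hb) (1, 1)) hd _ h1
  -- modulo `b`, only the constant term in `Y` survives
  have hred : homog q p.2 (f p) - homog q p.2 (C ((f p).coeff 0)) ∈ J := by
    rw [← map_sub, homog_apply]
    refine J.finsetSum_mem _ _ fun j _ => ?_
    cases j with
    | zero => simp
    | succ j =>
      refine J.mul_mem_left _ _ (J.mul_mem_right _ _ ?_)
      rw [pow_succ]
      exact J.mul_mem_left _ _ hbJ
  have h0P : homog q p.2 (C ((f p).coeff 0)) ∈ P := by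
    simpa using P.sub_mem h2 (hlt.le hred)
  have hne : (f p).coeff 0 ≠ 0 := by
    intro h
    rw [h, C_0, map_zero, sub_zero] at hred
    exact hp hred
  obtain ⟨g, hg, hgP⟩ := exists_irreducible_homog_mem hq0 hP hc (C : k[X] →+* k[X][X]) C_injective
    _ hne p.2 (by rw [natDegree_C]; exact Nat.zero_le _) h0P
  have hg1 : g.natDegree = 1 :=
    natDegree_eq_of_degree_eq_some (IsAlgClosed.degree_eq_one_of_irreducible k hg)
  have hgX : g = C (g.coeff 1) * Polynomial.X + C (g.coeff 0) :=
    eq_X_add_C_of_natDegree_le_one hg1.le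
  have hg10 : g.coeff 1 ≠ 0 := by
    rw [← hg1]
    exact leadingCoeff_ne_zero.2 hg.ne_zero
  have e : homog q 0 (C g) = g.coeff 1 • Δ q + algebraMap k _ (g.coeff 0) := by
    have h1 := homog_C_mul_X_pow (q := q) g 0 0
    simp only [pow_zero, mul_one] at h1
    rw [h1]
    conv_lhs => rw [hgX]
    rw [map_add, map_mul, aeval_C, aeval_C, aeval_X, Algebra.smul_def]
  rw [natDegree_C, e] at hgP
  have hΔt : Δ q - algebraMap k _ (-(g.coeff 0) / g.coeff 1) ∈ P := by
    have := P.smul_mem_of_algebra (g.coeff 1)⁻¹ hgP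
    convert this using 1
    rw [smul_add, smul_smul, inv_mul_cancel₀ hg10, one_smul, neg_div, div_eq_inv_mul, map_neg,
      sub_neg_eq_add, map_mul, ← Algebra.smul_def]
  refine ⟨_, fun h => ?_, hΔt⟩
  rw [h, map_zero, sub_zero] at hΔt
  have had : a q * d q ∈ P := by
    rw [a_mul_d]
    exact P.add_mem hΔt (P.smul_mem_of_algebra _ (bc_mem (Or.inl hb)))
  exact hd ((isNormalModulo_X hq0 (Or.inl hb) (0, 0)).mem_of_mul_mem_left hP ha had)

end Prime

end OqM2

namespace OqM2

open NCRing Polynomial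

variable {k : Type*} [Field k] {q : k}

/-! ### The transposition -/

variable (q) in
/-- The transposition `X i j ↦ X j i`, an involutive automorphism. -/
def transpose : OqM2 q →ₐ[k] OqM2 q :=
  lift q (fun i j => X q j i) (a_mul_c q) (a_mul_b q) (c_mul_d q) (b_mul_d q) (b_mul_c q).symm
    (by rw [← b_mul_c q]; exact a_mul_d_sub q)

theorem transpose_X (i j : Fin 2) : transpose q (X q i j) = X q j i := lift_X ..

theorem transpose_transpose (x : OqM2 q) : transpose q (transpose q x) = x := by
  have : (transpose q).comp (transpose q) = AlgHom.id k _ :=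
    hom_ext q fun i j => by
      rw [AlgHom.comp_apply, transpose_X, transpose_X, AlgHom.id_apply]
  exact DFunLike.congr_fun this x

theorem transpose_Δ : transpose q (Δ q) = Δ q := by
  rw [Δ, map_sub, map_mul, map_smul, map_mul, transpose_X, transpose_X, transpose_X, transpose_X,
    ← b_mul_c]

theorem transpose_surjective : Function.Surjective (transpose q) :=
  fun x => ⟨_, transpose_transpose x⟩

/-- The ideal `P` transposed. -/
def transposeIdeal (P : TwoSidedIdeal (OqM2 q)) : TwoSidedIdeal (OqM2 q) :=
  P.comap (transpose q)

theorem mem_transposeIdeal {P : TwoSidedIdeal (OqM2 q)} {x : OqM2 q} :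
    x ∈ transposeIdeal P ↔ transpose q x ∈ P := TwoSidedIdeal.mem_comap _

theorem transposeIdeal_span (s : Set (OqM2 q)) :
    transposeIdeal (TwoSidedIdeal.span s) = TwoSidedIdeal.span (transpose q '' s) := by
  apply le_antisymm
  · intro x hx
    have h : TwoSidedIdeal.span s ≤ transposeIdeal (TwoSidedIdeal.span (transpose q '' s)) := by
      refine TwoSidedIdeal.span_le.2 fun y hy => mem_transposeIdeal.2 ?_
      exact TwoSidedIdeal.subset_span ⟨y, hy, rfl⟩
    have := mem_transposeIdeal.1 (h (mem_transposeIdeal.1 hx))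
    rwa [transpose_transpose] at this
  · refine TwoSidedIdeal.span_le.2 ?_
    rintro _ ⟨y, hy, rfl⟩
    refine mem_transposeIdeal.2 ?_
    rw [transpose_transpose]
    exact TwoSidedIdeal.subset_span hy

theorem isCompletelyPrime_span_c (hq0 : q ≠ 0) {t : k} (ht : t ≠ 0) :
    IsCompletelyPrime (TwoSidedIdeal.span {c q, Δ q - algebraMap k _ t}) := by
  have h := (isCompletelyPrime_span_b hq0 ht).comap (transpose q : OqM2 q →+* OqM2 q)
  have e : TwoSidedIdeal.comap (transpose q : OqM2 q →+* OqM2 q)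
      (TwoSidedIdeal.span {b q, Δ q - algebraMap k _ t}) = _ :=
    transposeIdeal_span {b q, Δ q - algebraMap k _ t}
  rw [Set.image_pair, transpose_X, map_sub, transpose_Δ, AlgHom.commutes] at e
  rwa [e] at h

/-! ### The torus-stable primes -/

theorem genIdeal_singleton (p : Fin 2 × Fin 2) :
    genIdeal q {p} = TwoSidedIdeal.span {X q p.1 p.2} := by
  rw [genIdeal, Set.image_singleton]

theorem isHPrime_genIdeal (hq0 : q ≠ 0) {G : Set (Fin 2 × Fin 2)}
    (hG : (0, 1) ∈ G ∨ (1, 0) ∈ G) : IsHPrime (genIdeal q G) := by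
  refine ⟨(isCompletelyPrime_genIdeal hq0 hG).isPrimeIdeal, fun h x hx => ?_⟩
  have hle : genIdeal q G ≤ (genIdeal q G).comap (torusAction q h) :=
    genIdeal_le fun p hp => (TwoSidedIdeal.mem_comap _).2 <| by
      rw [torusAction_X]
      exact TwoSidedIdeal.smul_mem_of_algebra _ _ (X_mem_genIdeal hp)
  exact (TwoSidedIdeal.mem_comap _).1 (hle hx)

theorem isHPrime_detIdeal (hq0 : q ≠ 0) : IsHPrime (detIdeal q) := by
  refine ⟨(isCompletelyPrime_detIdeal hq0).isPrimeIdeal, fun h x hx => ?_⟩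
  have hle : detIdeal q ≤ (detIdeal q).comap (torusAction q h) := by
    refine TwoSidedIdeal.span_le.2 ?_
    rintro _ rfl
    refine (TwoSidedIdeal.mem_comap _).2 ?_
    rw [torusAction_Δ]
    exact TwoSidedIdeal.smul_mem_of_algebra _ _ (TwoSidedIdeal.subset_span rfl)
  exact (TwoSidedIdeal.mem_comap _).1 (hle hx)

/-- The torus-stable primes are `0`, `⟨Δ⟩` and the ideals generated by `b` or `c` and further
generators. -/
theorem IsHPrime.classification [IsAlgClosed k] (hq0 : q ≠ 0)
    (hq : ∀ n : ℕ, 0 < n → q ^ n ≠ 1) {P : TwoSidedIdeal (OqM2 q)} (hP : IsHPrime P) :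
    P = ⊥ ∨ P = detIdeal q ∨
      ∃ G : Set (Fin 2 × Fin 2), ((0, 1) ∈ G ∨ (1, 0) ∈ G) ∧ P = genIdeal q G := by
  by_cases h : b q ∈ P ∨ c q ∈ P
  · exact Or.inr (Or.inr ⟨_, h, hP.eq_genIdeal hq0 hq h⟩)
  · rw [not_or] at h
    exact (hP.eq_bot_or_eq_detIdeal hq0 hq h.1 h.2).imp id Or.inl

theorem Δ_ne_zero (hq0 : q ≠ 0) : Δ q ≠ 0 := by
  intro h
  have h1 := congrArg (evalPlane hq0 (1 : k) 1) h
  rw [map_zero, evalPlane, toPlane_Δ, QPlane.mono_eq_zero] at h1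
  simp at h1

theorem X_ne_zero (hq0 : q ≠ 0) {p : Fin 2 × Fin 2} (hp : p = (0, 1) ∨ p = (1, 0)) :
    X q p.1 p.2 ≠ 0 := by
  intro h
  have hG : (0, 1) ∈ ({p}ᶜ : Set (Fin 2 × Fin 2)) ∨ (1, 0) ∈ ({p}ᶜ : Set (Fin 2 × Fin 2)) := by
    rcases hp with rfl | rfl <;> simp
  have h1 := (X_mem_genIdeal_iff hq0 hG (p := p)).1 (h ▸ TwoSidedIdeal.zero_mem _)
  exact h1 rfl

/-! ### Unique factorization -/

theorem isNormalModulo_Δ_sub (hq0 : q ≠ 0) (J : TwoSidedIdeal (OqM2 q)) (t : k) :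
    IsNormalModulo J (Δ q - algebraMap k _ t) := by
  intro r
  have h : Commute (Δ q - algebraMap k _ t) r :=
    (commute_Δ hq0 r).sub_left (Algebra.commutes t r)
  refine ⟨⟨r, ?_⟩, r, ?_⟩
  · rw [h.eq, sub_self]
    exact J.zero_mem
  · rw [h.eq, sub_self]
    exact J.zero_mem

theorem Δ_mem {P : TwoSidedIdeal (OqM2 q)} (h : b q ∈ P ∨ c q ∈ P) (h' : a q ∈ P ∨ d q ∈ P) :
    Δ q ∈ P :=
  P.sub_mem (h'.elim (P.mul_mem_right _ _) (P.mul_mem_left _ _))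
    (P.smul_mem_of_algebra _ (bc_mem h))

theorem Δ_sub_notMem_genIdeal (hq0 : q ≠ 0) {G : Set (Fin 2 × Fin 2)}
    (hG : (0, 1) ∈ G ∨ (1, 0) ∈ G) {t : k} (ht : t ≠ 0) :
    Δ q - algebraMap k _ t ∉ genIdeal q G := by
  intro h
  -- after adjoining `a`, the determinant vanishes, and `t` would lie in a proper ideal
  set G' := insert (0, 0) G
  have hG' : (0, 1) ∈ G' ∨ (1, 0) ∈ G' :=
    hG.imp (Set.mem_insert_of_mem _) (Set.mem_insert_of_mem _)
  have hle : genIdeal q G ≤ genIdeal q G' :=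
    genIdeal_le fun p hp => X_mem_genIdeal (Set.mem_insert_of_mem _ hp)
  have hΔ : Δ q ∈ genIdeal q G' :=
    Δ_mem (hG'.imp (fun h => X_mem_genIdeal h) (fun h => X_mem_genIdeal h))
      (Or.inl (X_mem_genIdeal (p := (0, 0)) (Set.mem_insert _ _)))
  have h1 := (genIdeal q G').sub_mem hΔ (hle h)
  rw [sub_sub_cancel, Algebra.algebraMap_eq_smul_one] at h1
  exact (isCompletelyPrime_genIdeal hq0 hG').1
    ((TwoSidedIdeal.one_mem_iff _).1 (TwoSidedIdeal.mem_of_smul_mem _ ht h1))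

theorem isNoncommUFD_factor_bot (hq0 : q ≠ 0) (hq : ∀ n : ℕ, 0 < n → q ^ n ≠ 1) :
    IsNoncommUFD (Factor (⊥ : TwoSidedIdeal (OqM2 q))) := by
  refine isNoncommUFD_factor (isCompletelyPrime_bot hq0) fun P hP hlt => ?_
  simp only [bot_sup_eq, TwoSidedIdeal.mem_bot]
  by_cases hb : b q ∈ P
  · refine ⟨_, hb, X_ne_zero hq0 (Or.inl rfl), isNormalModulo_b hq0 _, ?_⟩
    rw [← genIdeal_singleton (0, 1)]
    exact isCompletelyPrime_genIdeal hq0 (Or.inl rfl)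
  by_cases hc : c q ∈ P
  · refine ⟨_, hc, X_ne_zero hq0 (Or.inr rfl), isNormalModulo_c hq0 _, ?_⟩
    rw [← genIdeal_singleton (1, 0)]
    exact isCompletelyPrime_genIdeal hq0 (Or.inr rfl)
  obtain ⟨m, h, h0, hm, hhP⟩ := exists_homog_mem hq0 hq hP hb hc hlt.ne'
  obtain ⟨g, hg, hgP⟩ := exists_irreducible_homog_mem hq0 hP hc (RingHom.id _)
    Function.injective_id h h0 m hm hhP
  refine ⟨_, hgP, fun h1 => ?_, isNormalModulo_homog hq0 _ _ _, isCompletelyPrime_span_homog hq0 hg⟩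
  have h2 := congrArg (evalPlane hq0 (C Polynomial.X : k[X][X]) Polynomial.X) h1
  rw [map_zero, RingHom.id_apply, evalPlane_homog _ _ _ _ _ le_rfl, specialize_self,
    QPlane.mono_eq_zero] at h2
  exact mul_ne_zero (C_ne_zero.2 hg.ne_zero) (pow_ne_zero _ Polynomial.X_ne_zero) h2

/-- The factor algebra by an ideal generated by generators has enough prime elements: generators
suffice unless the factor algebra is commutative or is generated by one of `b`, `c` together with
`a` and `d`, in which case the elements `Δ - t` come in addition. -/
theorem isNoncommUFD_factor_genIdeal [IsAlgClosed k] (hq0 : q ≠ 0)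
    (hq : ∀ n : ℕ, 0 < n → q ^ n ≠ 1) {G : Set (Fin 2 × Fin 2)} (hG : (0, 1) ∈ G ∨ (1, 0) ∈ G) :
    IsNoncommUFD (Factor (genIdeal q G)) := by
  refine isNoncommUFD_factor (isCompletelyPrime_genIdeal hq0 hG) fun P hP hlt => ?_
  have hbcJ : b q ∈ genIdeal q G ∨ c q ∈ genIdeal q G :=
    hG.imp (fun h => X_mem_genIdeal h) (fun h => X_mem_genIdeal h)
  by_cases hX : ∃ p : Fin 2 × Fin 2, X q p.1 p.2 ∈ P ∧ p ∉ G
  · obtain ⟨p, hpP, hpG⟩ := hX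
    refine ⟨_, hpP, fun h => hpG ((X_mem_genIdeal_iff hq0 hG).1 h), isNormalModulo_X hq0 hbcJ p, ?_⟩
    rw [← genIdeal_insert]
    exact isCompletelyPrime_genIdeal hq0 (hG.imp (Set.mem_insert_of_mem _) (Set.mem_insert_of_mem _))
  have hGP : ∀ p : Fin 2 × Fin 2, X q p.1 p.2 ∈ P ↔ p ∈ G := by
    push Not at hX
    exact fun p => ⟨hX p, fun h => hlt.le (X_mem_genIdeal h)⟩
  have hbcP : b q ∈ P ∨ c q ∈ P := hG.imp (hGP (0, 1)).2 (hGP (1, 0)).2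
  by_cases hcomm : ((0, 1) ∈ G ∧ (1, 0) ∈ G) ∨ ((0, 0) ∈ G ∧ (1, 1) ∈ G)
  · obtain ⟨f, hf, hker⟩ := exists_ker_eq_genIdeal_of_comm hq0 hG hcomm
    exact exists_prime_of_surjective_commUFD (f : OqM2 q →+* MvPolynomial {p // p ∉ G} k) hf hker
      hP hlt
  rw [not_or, not_and_or, not_and_or] at hcomm
  have hxor : Xor (b q ∈ P) (c q ∈ P) := by
    rw [show b q ∈ P ↔ _ from hGP (0, 1), show c q ∈ P ↔ _ from hGP (1, 0)]
    rcases hG with h | h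
    · exact Or.inl ⟨h, fun h' => hcomm.1.elim (· h) (· h')⟩
    · exact Or.inr ⟨h, fun h' => hcomm.1.elim (· h') (· h)⟩
  by_cases had : a q ∈ P ∨ d q ∈ P
  · -- this factor algebra is a quantum plane and `P` has to be its zero ideal
    exfalso
    have hxor' : Xor (a q ∈ P) (d q ∈ P) := by
      rw [show a q ∈ P ↔ _ from hGP (0, 0), show d q ∈ P ↔ _ from hGP (1, 1)] at had ⊢
      rcases had with h | h
      · exact Or.inl ⟨h, fun h' => hcomm.2.elim (· h) (· h')⟩
      · exact Or.inr ⟨h, fun h' => hcomm.2.elim (· h') (· h)⟩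
    have h1 := eq_genIdeal_of_xor hq0 hq hP hxor hxor'
    rw [show {p : Fin 2 × Fin 2 | X q p.1 p.2 ∈ P} = G from Set.ext hGP] at h1
    exact hlt.ne' h1
  rw [not_or] at had
  have hGeq : ∀ r : Fin 2 × Fin 2, (∀ p, X q p.1 p.2 ∈ P ↔ p = r) → G = {r} := fun r hr =>
    Set.ext fun p => (hGP p).symm.trans (hr p)
  rcases hxor with ⟨hb, hc⟩ | ⟨hc, hb⟩
  · have hGb : G = {(0, 1)} := hGeq _ (by
      rintro ⟨i, j⟩; fin_cases i <;> fin_cases j <;> simp [hb, hc, had.1, had.2])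
    rw [hGb, genIdeal_singleton] at hlt ⊢
    obtain ⟨t, ht, htP⟩ := exists_Δ_sub_mem hq0 hq hP had.1 hc had.2 hlt
    refine ⟨_, htP, ?_, isNormalModulo_Δ_sub hq0 _ t, by
      rw [span_singleton_sup_span_singleton]; exact isCompletelyPrime_span_b hq0 ht⟩
    rw [← genIdeal_singleton (0, 1)]
    exact Δ_sub_notMem_genIdeal hq0 (Or.inl (Set.mem_singleton _)) ht
  · have hGc : G = {(1, 0)} := hGeq _ (by
      rintro ⟨i, j⟩; fin_cases i <;> fin_cases j <;> simp [hb, hc, had.1, had.2])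
    rw [hGc, genIdeal_singleton] at hlt ⊢
    have hmem : ∀ i j, X q i j ∈ transposeIdeal P ↔ X q j i ∈ P := fun i j => by
      rw [mem_transposeIdeal, transpose_X]
    have hlt' : TwoSidedIdeal.span {b q} < transposeIdeal P := by
      refine SetLike.lt_iff_le_and_exists.2 ⟨TwoSidedIdeal.span_le.2 ?_, ?_⟩
      · rintro _ rfl
        exact (hmem 0 1).2 hc
      · obtain ⟨x, hxP, hx⟩ := SetLike.exists_of_lt hlt
        refine ⟨transpose q x, mem_transposeIdeal.2 (by rwa [transpose_transpose]), fun h => hx ?_⟩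
        have h1 := mem_transposeIdeal.2 h
        rwa [transposeIdeal_span, Set.image_singleton, transpose_X] at h1
    obtain ⟨t, ht, htP⟩ := exists_Δ_sub_mem hq0 hq
      (hP.comap (transpose q : OqM2 q →+* OqM2 q) transpose_surjective)
      (fun h => had.1 ((hmem 0 0).1 h)) (fun h => hb ((hmem 1 0).1 h))
      (fun h => had.2 ((hmem 1 1).1 h)) hlt'
    have htP : Δ q - algebraMap k _ t ∈ P := by
      have h1 := mem_transposeIdeal.1 htP
      rwa [map_sub, transpose_Δ, AlgHom.commutes] at h1
    refine ⟨_, htP, ?_, isNormalModulo_Δ_sub hq0 _ t, by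
      rw [span_singleton_sup_span_singleton]; exact isCompletelyPrime_span_c hq0 ht⟩
    rw [← genIdeal_singleton (1, 0)]
    exact Δ_sub_notMem_genIdeal hq0 (Or.inr (Set.mem_singleton _)) ht

/-! ### Polynormal regular sequences -/

theorem hasPolynormalRegularSeq_detIdeal (hq0 : q ≠ 0) :
    HasPolynormalRegularSeq (detIdeal q) := by
  have h := hasPolynormalRegularSeq_bot.sup_span (isCompletelyPrime_bot hq0) (v := Δ q)
    (by rw [TwoSidedIdeal.mem_bot]; exact Δ_ne_zero hq0) (isNormalModulo_Δ hq0 _)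
  rwa [bot_sup_eq] at h

/-- The generators in `G`, beginning with `b` or `c`, form a polynormal regular sequence: the ideals
generated on the way are completely prime. -/
theorem hasPolynormalRegularSeq_genIdeal (hq0 : q ≠ 0) (G : Set (Fin 2 × Fin 2))
    (hG : (0, 1) ∈ G ∨ (1, 0) ∈ G) : HasPolynormalRegularSeq (genIdeal q G) := by
  classical
  obtain ⟨r, hr, hrG⟩ : ∃ r : Fin 2 × Fin 2, (r = (0, 1) ∨ r = (1, 0)) ∧ r ∈ G :=
    hG.elim (fun h => ⟨_, Or.inl rfl, h⟩) (fun h => ⟨_, Or.inr rfl, h⟩)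
  have h0 : HasPolynormalRegularSeq (genIdeal q {r}) := by
    have h := hasPolynormalRegularSeq_bot.sup_span (isCompletelyPrime_bot hq0) (v := X q r.1 r.2)
      (by rw [TwoSidedIdeal.mem_bot]; exact X_ne_zero hq0 hr)
      (by rcases hr with rfl | rfl; exacts [isNormalModulo_b hq0 _, isNormalModulo_c hq0 _])
    rwa [bot_sup_eq, ← genIdeal_singleton] at h
  have key : ∀ S : Finset (Fin 2 × Fin 2),
      HasPolynormalRegularSeq (genIdeal q (insert r (S : Set (Fin 2 × Fin 2)))) := by
    intro S
    induction S using Finset.induction_on with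
    | empty => simpa using h0
    | insert p S hp ih =>
      rw [Finset.coe_insert, Set.insert_comm]
      by_cases hpr : p ∈ insert r (S : Set (Fin 2 × Fin 2))
      · rwa [Set.insert_eq_of_mem hpr]
      · have hG' : (0, 1) ∈ insert r (S : Set (Fin 2 × Fin 2)) ∨
            (1, 0) ∈ insert r (S : Set (Fin 2 × Fin 2)) :=
          hr.imp (fun h => Or.inl h.symm) (fun h => Or.inl h.symm)
        rw [genIdeal_insert]
        exact ih.sup_span (isCompletelyPrime_genIdeal hq0 hG')
          (fun h => hpr ((X_mem_genIdeal_iff hq0 hG').1 h))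
          (isNormalModulo_X hq0 (hG'.imp (fun h => X_mem_genIdeal h) (fun h => X_mem_genIdeal h)) p)
  have h := key G.toFinset
  rwa [Set.coe_toFinset, Set.insert_eq_of_mem hrG] at h

end OqM2

namespace OqM2

open NCRing Polynomial QPlane

variable {k : Type*} [Field k] {q : k}

/-! ### The primes of height one over the quantum determinant -/

variable (q) in
/-- The ideal `⟨Δ, b - t c⟩`. -/
def lineIdeal (t : k) : TwoSidedIdeal (OqM2 q) := TwoSidedIdeal.span {Δ q, b q - t • c q}

/-- The rows and the columns of a `2 × 2` matrix, as sets of indices. -/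
def rowsAndColumns : Set (Set (Fin 2 × Fin 2)) :=
  {{(0, 0), (0, 1)}, {(0, 1), (1, 1)}, {(0, 0), (1, 0)}, {(1, 0), (1, 1)}}

section LineIdeal

variable {t : k}

theorem lineIdeal_eq_sup (t : k) :
    lineIdeal q t = detIdeal q ⊔ TwoSidedIdeal.span {b q - t • c q} :=
  (span_singleton_sup_span_singleton _ _).symm

theorem sub_mem_lineIdeal (t : k) : b q - t • c q ∈ lineIdeal q t :=
  TwoSidedIdeal.subset_span (Or.inr rfl)

theorem detIdeal_le_lineIdeal (t : k) : detIdeal q ≤ lineIdeal q t :=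
  lineIdeal_eq_sup (q := q) t ▸ le_sup_left

theorem isCompletelyPrime_lineIdeal (hq0 : q ≠ 0) (ht : t ≠ 0) :
    IsCompletelyPrime (lineIdeal q t) := by
  rw [lineIdeal, ← ker_evalPlane_zero hq0 ht]
  exact isCompletelyPrime_ker (evalPlane hq0 0 t : OqM2 q →+* QPlane (unitOf k hq0))

theorem b_notMem_lineIdeal (hq0 : q ≠ 0) (ht : t ≠ 0) : b q ∉ lineIdeal q t := by
  rw [lineIdeal, ← ker_evalPlane_zero hq0 ht, TwoSidedIdeal.mem_ker, evalPlane, toPlane_b,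
    mono_eq_zero]
  exact mul_ne_zero (C_ne_zero.2 ht) Polynomial.X_ne_zero

theorem c_notMem_lineIdeal (hq0 : q ≠ 0) (ht : t ≠ 0) : c q ∉ lineIdeal q t := by
  rw [lineIdeal, ← ker_evalPlane_zero hq0 ht, TwoSidedIdeal.mem_ker, evalPlane, toPlane_c,
    mono_eq_zero]
  exact mul_ne_zero (C_ne_zero.2 one_ne_zero) Polynomial.X_ne_zero

theorem eq_of_lineIdeal_le (hq0 : q ≠ 0) {s : k} (hs : s ≠ 0) (h : lineIdeal q t ≤ lineIdeal q s) :
    t = s := by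
  have h1 := (lineIdeal q s).sub_mem (sub_mem_lineIdeal s) (h (sub_mem_lineIdeal t))
  rw [sub_sub_sub_cancel_left] at h1
  have h2 : (t - s) • c q ∈ lineIdeal q s := by
    convert! h1 using 1
    module
  by_contra hne
  exact c_notMem_lineIdeal hq0 hs (TwoSidedIdeal.mem_of_smul_mem _ (sub_ne_zero.2 hne) h2)

theorem detIdeal_lt_lineIdeal (hq0 : q ≠ 0) (t : k) : detIdeal q < lineIdeal q t := by
  refine SetLike.lt_iff_le_and_exists.2 ⟨detIdeal_le_lineIdeal t, _, sub_mem_lineIdeal t, fun h => ?_⟩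
  -- under `Δ ↦ 0`, `b ↦ Y y`, `c ↦ y` the element `b - t c` goes to `(Y - t) y`
  have hle : detIdeal q ≤ TwoSidedIdeal.ker (evalPlane hq0 (0 : k[X]) Polynomial.X) := by
    refine TwoSidedIdeal.span_le.2 ?_
    rintro _ rfl
    refine (TwoSidedIdeal.mem_ker _).2 ?_
    rw [evalPlane, toPlane_Δ, mul_zero, C_0, mono_eq_zero]
  have h1 := (TwoSidedIdeal.mem_ker _).1 (hle h)
  rw [map_sub, map_smul, sub_eq_zero, evalPlane, toPlane_b, toPlane_c, smul_mono] at h1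
  have h2 := congrArg (coeffX 0) h1
  rw [coeffX_mono, coeffX_mono, if_pos rfl, if_pos rfl] at h2
  have h3 := congrArg (coeff · 1) h2
  simp only [coeff_C_mul, coeff_X_one, mul_one] at h3
  exact Polynomial.X_ne_C t h3

theorem isNormalModulo_sub (hq0 : q ≠ 0) (J : TwoSidedIdeal (OqM2 q)) (t : k) :
    IsNormalModulo J (b q - t • c q) := by
  have h1 := homog_C_mul_X_pow (q := q) (C t) 0 1
  simp only [pow_one, pow_zero, mul_one, one_mul, aeval_C, zero_add, ← Algebra.smul_def] at h1
  have h2 := isNormalModulo_homog hq0 J 1 (Polynomial.X - C (C t))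
  rwa [map_sub, homog_one_X, h1] at h2

theorem isGeneratedByNormal_lineIdeal (hq0 : q ≠ 0) (t : k) :
    IsGeneratedByNormal (factorIdeal (detIdeal q) (lineIdeal q t)) := by
  refine ⟨_, isNormalElement_mk' (isNormalModulo_sub hq0 _ t), ?_⟩
  rw [lineIdeal_eq_sup, factorIdeal_sup_span]

/-- The torus permutes the ideals `⟨Δ, b - t c⟩`, `t ≠ 0`, transitively. -/
theorem exists_torusAction_mem_lineIdeal {s : k} (hs : s ≠ 0) (ht : t ≠ 0) :
    ∃ h : Torus k, ∀ x ∈ lineIdeal q t, torusAction q h x ∈ lineIdeal q s := by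
  let u : kˣ := Units.mk0 (t / s) (div_ne_zero ht hs)
  let τ : Torus k := (![u, 1], 1)
  refine ⟨τ, fun x hx => ?_⟩
  have hle : lineIdeal q t ≤ (lineIdeal q s).comap (torusAction q τ) := by
    refine TwoSidedIdeal.span_le.2 ?_
    rintro _ (rfl | rfl) <;> refine (TwoSidedIdeal.mem_comap _).2 ?_
    · rw [torusAction_Δ]
      exact TwoSidedIdeal.smul_mem_of_algebra _ _
        (detIdeal_le_lineIdeal s (TwoSidedIdeal.subset_span rfl))
    · rw [map_sub, map_smul, torusAction_X, torusAction_X]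
      convert! TwoSidedIdeal.smul_mem_of_algebra _ (t / s) (sub_mem_lineIdeal (q := q) s) using 1
      have e : t = t / s * s := (div_mul_cancel₀ t hs).symm
      simp only [τ, u, Matrix.cons_val_zero, Matrix.cons_val_one, Pi.one_apply, Units.val_mk0,
        Units.val_one, mul_one, one_smul]
      generalize t / s = r at e
      rw [e]
      module
  exact (TwoSidedIdeal.mem_comap _).1 (hle hx)

/-- The `J`-stratum consists of the primes whose largest torus-stable subset is `J`. -/
theorem mem_stratum_iff_of_isPrimeIdeal {P J : TwoSidedIdeal (OqM2 q)} (hP : IsPrimeIdeal P) :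
    P ∈ stratum J ↔ ∀ x, (∀ h : Torus k, torusAction q h x ∈ P) ↔ x ∈ J := by
  have key : ∀ x, x ∈ ⨅ h : Torus k, P.comap (torusAction q h⁻¹) ↔
      ∀ h : Torus k, torusAction q h x ∈ P := by
    intro x
    rw [TwoSidedIdeal.mem_iInf]
    simp only [TwoSidedIdeal.mem_comap]
    exact ⟨fun h g => by simpa using h g⁻¹, fun h g => h g⁻¹⟩
  rw [stratum, Set.mem_ofPred_eq, and_iff_right hP]
  constructor
  · rintro rfl x
    exact (key x).symm
  · intro h
    exact TwoSidedIdeal.ext fun x => (key x).trans (h x)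

theorem IsHPrime.eq_of_mem_stratum {P J : TwoSidedIdeal (OqM2 q)} (hP : IsHPrime P)
    (h : P ∈ stratum J) : P = J := by
  rw [mem_stratum_iff_of_isPrimeIdeal hP.1] at h
  refine TwoSidedIdeal.ext fun x => Iff.trans ?_ (h x)
  exact ⟨fun hx g => hP.2 g x hx, fun hx => by simpa using hx 1⟩

/-- An element that lies in all translates of `⟨Δ, b - t c⟩` is a multiple of `Δ`: a polynomial over
an infinite field that vanishes on the nonzero elements is zero. -/
theorem lineIdeal_mem_stratum [Infinite k] (hq0 : q ≠ 0) (ht : t ≠ 0) :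
    lineIdeal q t ∈ stratum (detIdeal q) := by
  rw [mem_stratum_iff_of_isPrimeIdeal (isCompletelyPrime_lineIdeal hq0 ht).isPrimeIdeal]
  refine fun x => ⟨fun hx => ?_, fun hx h =>
    detIdeal_le_lineIdeal t ((isHPrime_detIdeal hq0).2 h x hx)⟩
  have hx' : ∀ s : k, s ≠ 0 → evalPlane hq0 0 s x = 0 := by
    intro s hs
    obtain ⟨h, hh⟩ := exists_torusAction_mem_lineIdeal (q := q) hs ht
    have h1 := hh _ (hx h⁻¹)
    rw [← AlgEquiv.mul_apply, ← map_mul, mul_inv_cancel, map_one, AlgEquiv.one_apply, lineIdeal,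
      ← ker_evalPlane_zero hq0 hs] at h1
    exact (TwoSidedIdeal.mem_ker _).1 h1
  obtain ⟨f, hf, rfl⟩ := exists_normalForm hq0 x
  refine (detIdeal q).finsetSum_mem _ _ fun p _ => (detIdeal q).mul_mem_right _ _ ?_
  have h0 : (f p).map constantCoeff = 0 := by
    refine eq_zero_of_infinite_isRoot _ (Set.Infinite.mono (s := {0}ᶜ) (fun s hs => ?_)
      (Set.finite_singleton 0).infinite_compl)
    have h1 := evalPlane_normalForm_eq_zero hq0 0 s (Or.inr hs) f hf (hx' s hs) p
    rw [Set.mem_ofPred_eq, IsRoot, eval_map, ← h1, specialize, coe_eval₂RingHom]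
    congr 1
    ext <;> simp
  have h1 := homog_sub_homog_map_mem_detIdeal (q := q) p.2 (f p)
  rwa [h0, map_zero, map_zero, sub_zero] at h1

end LineIdeal

section RowsAndColumns

variable {G G' : Set (Fin 2 × Fin 2)}

theorem genIdeal_pair (p r : Fin 2 × Fin 2) :
    genIdeal q {p, r} = TwoSidedIdeal.span {X q p.1 p.2, X q r.1 r.2} := by
  rw [genIdeal, Set.image_pair]

variable (q) in
theorem genIdeal_image_rowsAndColumns :
    genIdeal q '' rowsAndColumns = {TwoSidedIdeal.span {a q, b q}, TwoSidedIdeal.span {b q, d q},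
      TwoSidedIdeal.span {a q, c q}, TwoSidedIdeal.span {c q, d q}} := by
  simp only [rowsAndColumns, Set.image_insert_eq, Set.image_singleton, genIdeal_pair]

/-- A row or column consists of one of `a`, `d` and one of `b`, `c`. -/
theorem xor_mem_of_mem_rowsAndColumns (hG : G ∈ rowsAndColumns) :
    Xor ((0, 1) ∈ G) ((1, 0) ∈ G) ∧ Xor ((0, 0) ∈ G) ((1, 1) ∈ G) := by
  rcases hG with rfl | rfl | rfl | rfl <;> simp [Xor]

theorem or_mem_of_mem_rowsAndColumns (hG : G ∈ rowsAndColumns) : (0, 1) ∈ G ∨ (1, 0) ∈ G :=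
  (xor_mem_of_mem_rowsAndColumns hG).1.or

theorem eq_of_subset_of_mem_rowsAndColumns (hG : G ∈ rowsAndColumns) (hG' : G' ∈ rowsAndColumns)
    (h : G ⊆ G') : G = G' := by
  rcases hG with rfl | rfl | rfl | rfl <;> rcases hG' with rfl | rfl | rfl | rfl <;>
    first
    | rfl
    | simp [Set.insert_subset_iff] at h

theorem encard_rowsAndColumns : rowsAndColumns.encard = 4 := by
  rw [rowsAndColumns, Set.encard_insert_of_notMem, Set.encard_insert_of_notMem,
    Set.encard_insert_of_notMem, Set.encard_singleton]
  · norm_num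
  all_goals simp [Set.pair_eq_pair_iff]

theorem genIdeal_le_genIdeal_iff (hq0 : q ≠ 0) (hG' : (0, 1) ∈ G' ∨ (1, 0) ∈ G') :
    genIdeal q G ≤ genIdeal q G' ↔ G ⊆ G' :=
  ⟨fun h _ hp => (X_mem_genIdeal_iff hq0 hG').1 (h (X_mem_genIdeal hp)),
    fun h => genIdeal_le fun _ hp => X_mem_genIdeal (h hp)⟩

theorem detIdeal_lt_genIdeal (hq0 : q ≠ 0) (hG : G ∈ rowsAndColumns) :
    detIdeal q < genIdeal q G := by
  obtain ⟨hbc, had⟩ := xor_mem_of_mem_rowsAndColumns hG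
  refine SetLike.lt_iff_le_and_exists.2 ⟨TwoSidedIdeal.span_le.2 ?_, ?_⟩
  · rintro _ rfl
    exact Δ_mem (hbc.or.imp (fun h => X_mem_genIdeal h) (fun h => X_mem_genIdeal h))
      (had.or.imp (fun h => X_mem_genIdeal h) (fun h => X_mem_genIdeal h))
  · exact hbc.or.elim
      (fun h => ⟨b q, X_mem_genIdeal h, fun h' =>
        b_notMem_lineIdeal hq0 one_ne_zero (detIdeal_le_lineIdeal 1 h')⟩)
      (fun h => ⟨c q, X_mem_genIdeal h, fun h' =>
        c_notMem_lineIdeal hq0 one_ne_zero (detIdeal_le_lineIdeal 1 h')⟩)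

variable (q) in
/-- The homomorphism to the square-zero extension of `k` by the space spanned by the generators:
it picks out the constant term and the linear terms. -/
def linearPart : OqM2 q →ₐ[k] TrivSqZeroExt k (Fin 2 × Fin 2 → k) :=
  lift q (fun i j => TrivSqZeroExt.inr (Pi.single (i, j) 1)) (by simp) (by simp) (by simp) (by simp)
    (by simp) (by simp)

theorem linearPart_X (p : Fin 2 × Fin 2) :
    linearPart q (X q p.1 p.2) = TrivSqZeroExt.inr (Pi.single p 1) := lift_X ..

/-- Two generators have independent linear parts, whereas the multiples of a single element
without constant term have proportional linear parts. -/
theorem not_isGeneratedByNormal_genIdeal_pair {p r : Fin 2 × Fin 2} (hpr : p ≠ r)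
    (hle : detIdeal q ≤ genIdeal q {p, r}) :
    ¬ IsGeneratedByNormal (factorIdeal (detIdeal q) (genIdeal q {p, r})) := by
  rintro ⟨u, hu, hspan⟩
  obtain ⟨u, rfl⟩ := (detIdeal q).ringCon.mk'_surjective u
  have hu0 : (linearPart q u).fst = 0 := by
    have h1 : u ∈ genIdeal q {p, r} := by
      rw [← mk'_mem_factorIdeal hle, ← hspan]
      exact TwoSidedIdeal.subset_span rfl
    have h2 : genIdeal q {p, r} ≤ TwoSidedIdeal.ker
        ((TrivSqZeroExt.fstHom k k (Fin 2 × Fin 2 → k)).comp (linearPart q)) :=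
      genIdeal_le fun s _ => (TwoSidedIdeal.mem_ker _).2 <| by
        rw [AlgHom.comp_apply, linearPart_X]
        rfl
    exact (TwoSidedIdeal.mem_ker _).1 (h2 h1)
  have hdet : ∀ x ∈ detIdeal q, linearPart q x = 0 := by
    have h1 : detIdeal q ≤ TwoSidedIdeal.ker (linearPart q) := by
      refine TwoSidedIdeal.span_le.2 ?_
      rintro _ rfl
      refine (TwoSidedIdeal.mem_ker _).2 ?_
      rw [Δ, map_sub, map_mul, map_smul, map_mul]
      simp only [linearPart, lift_X, TrivSqZeroExt.inr_mul_inr, smul_zero, sub_zero]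
    exact fun x hx => (TwoSidedIdeal.mem_ker _).1 (h1 hx)
  have key : ∀ s ∈ ({p, r} : Set (Fin 2 × Fin 2)), ∃ z : k,
      Pi.single s 1 = z • (linearPart q u).snd := by
    intro s hs
    have h1 : (detIdeal q).ringCon.mk' (X q s.1 s.2) ∈
        TwoSidedIdeal.span {(detIdeal q).ringCon.mk' u} := by
      rw [hspan, mk'_mem_factorIdeal hle]
      exact X_mem_genIdeal hs
    obtain ⟨z, hz⟩ := hu.exists_of_mem_span h1
    obtain ⟨z, rfl⟩ := (detIdeal q).ringCon.mk'_surjective z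
    rw [← map_mul, ← sub_eq_zero, ← map_sub, mk'_eq_zero] at hz
    have h2 := hdet _ hz
    rw [map_sub, linearPart_X, map_mul, sub_eq_zero] at h2
    have h3 := congrArg TrivSqZeroExt.snd h2
    rw [TrivSqZeroExt.snd_inr, TrivSqZeroExt.snd_mul, hu0, zero_smul, zero_add,
      op_smul_eq_smul] at h3
    exact ⟨_, h3⟩
  obtain ⟨z, hz⟩ := key p (Or.inl rfl)
  obtain ⟨w, hw⟩ := key r (Or.inr rfl)
  have h1 := congrFun hz p
  have h2 := congrFun hz r
  have h4 := congrFun hw r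
  simp only [Pi.single_eq_same, Pi.single_eq_of_ne hpr.symm, Pi.smul_apply, smul_eq_mul] at h1 h2 h4
  rcases mul_eq_zero.1 h2.symm with h | h
  · rw [h, zero_mul] at h1
    exact one_ne_zero h1
  · rw [h, mul_zero] at h4
    exact one_ne_zero h4

theorem not_isGeneratedByNormal_genIdeal (hq0 : q ≠ 0) (hG : G ∈ rowsAndColumns) :
    ¬ IsGeneratedByNormal (factorIdeal (detIdeal q) (genIdeal q G)) := by
  have hle := (detIdeal_lt_genIdeal hq0 hG).le
  rcases hG with rfl | rfl | rfl | rfl <;>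
    exact not_isGeneratedByNormal_genIdeal_pair (by decide) hle

end RowsAndColumns

variable (q) in
/-- The minimal elements among the primes strictly above `⟨Δ⟩`. -/
def minimalOverDet : Set (TwoSidedIdeal (OqM2 q)) :=
  {K | ∃ t : k, t ≠ 0 ∧ K = lineIdeal q t} ∪ genIdeal q '' rowsAndColumns

theorem detIdeal_lt_of_mem_minimalOverDet (hq0 : q ≠ 0) {K : TwoSidedIdeal (OqM2 q)}
    (hK : K ∈ minimalOverDet q) : detIdeal q < K := by
  rcases hK with ⟨t, ht, rfl⟩ | ⟨G, hG, rfl⟩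
  · exact detIdeal_lt_lineIdeal hq0 t
  · exact detIdeal_lt_genIdeal hq0 hG

/-- Modulo a prime above `Δ` that contains `b` or `c`, the product `a d` vanishes. -/
theorem exists_mem_minimalOverDet_le [IsAlgClosed k] (hq0 : q ≠ 0)
    (hq : ∀ n : ℕ, 0 < n → q ^ n ≠ 1) {P : TwoSidedIdeal (OqM2 q)} (hP : IsPrimeIdeal P)
    (hlt : detIdeal q < P) : ∃ K ∈ minimalOverDet q, K ≤ P := by
  have hΔ : Δ q ∈ P := hlt.le (TwoSidedIdeal.subset_span rfl)
  by_cases hbc : b q ∈ P ∨ c q ∈ P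
  · have had : a q ∈ P ∨ d q ∈ P := by
      by_contra h
      rw [not_or] at h
      have h1 : a q * d q ∈ P := by
        rw [a_mul_d]
        exact P.add_mem hΔ (P.smul_mem_of_algebra _ (bc_mem hbc))
      exact h.2 ((isNormalModulo_X hq0 hbc (0, 0)).mem_of_mul_mem_left hP h.1 h1)
    have key : ∀ p r : Fin 2 × Fin 2, {p, r} ∈ rowsAndColumns → X q p.1 p.2 ∈ P →
        X q r.1 r.2 ∈ P → ∃ K ∈ minimalOverDet q, K ≤ P := fun p r h hp hr =>
      ⟨_, Or.inr ⟨_, h, rfl⟩, genIdeal_le (by rintro s (rfl | rfl); exacts [hp, hr])⟩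
    rcases hbc with hb | hc <;> rcases had with ha | hd
    · exact key (0, 0) (0, 1) (by simp [rowsAndColumns]) ha hb
    · exact key (0, 1) (1, 1) (by simp [rowsAndColumns]) hb hd
    · exact key (0, 0) (1, 0) (by simp [rowsAndColumns]) ha hc
    · exact key (1, 0) (1, 1) (by simp [rowsAndColumns]) hc hd
  · rw [not_or] at hbc
    obtain ⟨t, ht, htP⟩ := exists_sub_mem hq0 hq hP hbc.1 hbc.2 hlt
    refine ⟨_, Or.inl ⟨t, ht, rfl⟩, TwoSidedIdeal.span_le.2 ?_⟩
    rintro _ (rfl | rfl)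
    exacts [hΔ, htP]

theorem heightOnePrimes_factor_detIdeal [IsAlgClosed k] (hq0 : q ≠ 0)
    (hq : ∀ n : ℕ, 0 < n → q ^ n ≠ 1) :
    heightOnePrimes (Factor (detIdeal q)) = factorIdeal (detIdeal q) '' minimalOverDet q := by
  refine heightOnePrimes_factor_eq (isCompletelyPrime_detIdeal hq0).isPrimeIdeal _ ?_
    (fun K hK => detIdeal_lt_of_mem_minimalOverDet hq0 hK) ?_
    (fun P hP hlt => exists_mem_minimalOverDet_le hq0 hq hP hlt)
  · rintro _ (⟨t, ht, rfl⟩ | ⟨G, hG, rfl⟩)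
    · exact (isCompletelyPrime_lineIdeal hq0 ht).isPrimeIdeal
    · exact (isCompletelyPrime_genIdeal hq0 (or_mem_of_mem_rowsAndColumns hG)).isPrimeIdeal
  · rintro _ (⟨t, ht, rfl⟩ | ⟨G, hG, rfl⟩) _ (⟨s, hs, rfl⟩ | ⟨G', hG', rfl⟩) h
    · rw [eq_of_lineIdeal_le hq0 hs h]
    · -- together with `b - t c`, one of `b`, `c` would bring the other one into the ideal
      exfalso
      have hor := or_mem_of_mem_rowsAndColumns hG'
      have h1 := h (sub_mem_lineIdeal t)
      rcases (xor_mem_of_mem_rowsAndColumns hG').1 with ⟨hb, hc⟩ | ⟨hc, hb⟩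
      · have h2 := (genIdeal q G').sub_mem (X_mem_genIdeal (q := q) hb) h1
        rw [sub_sub_cancel] at h2
        exact hc ((X_mem_genIdeal_iff hq0 hor).1 (TwoSidedIdeal.mem_of_smul_mem _ ht h2))
      · have h2 := (genIdeal q G').add_mem h1
          (TwoSidedIdeal.smul_mem_of_algebra _ t (X_mem_genIdeal (q := q) hc))
        rw [sub_add_cancel] at h2
        exact hb ((X_mem_genIdeal_iff hq0 hor).1 h2)
    · exfalso
      rcases or_mem_of_mem_rowsAndColumns hG with hb | hc
      · exact b_notMem_lineIdeal hq0 hs (h (X_mem_genIdeal hb))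
      · exact c_notMem_lineIdeal hq0 hs (h (X_mem_genIdeal hc))
    · rw [genIdeal_le_genIdeal_iff hq0 (or_mem_of_mem_rowsAndColumns hG')] at h
      rw [eq_of_subset_of_mem_rowsAndColumns hG hG' h]

theorem factorIdeal_mem_heightOnePrimes_iff [IsAlgClosed k] (hq0 : q ≠ 0)
    (hq : ∀ n : ℕ, 0 < n → q ^ n ≠ 1) {K : TwoSidedIdeal (OqM2 q)} (hK : detIdeal q ≤ K) :
    factorIdeal (detIdeal q) K ∈ heightOnePrimes (Factor (detIdeal q)) ↔ K ∈ minimalOverDet q := by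
  rw [heightOnePrimes_factor_detIdeal hq0 hq]
  refine ⟨?_, fun h => ⟨K, h, rfl⟩⟩
  rintro ⟨L, hL, h⟩
  rwa [← factorIdeal_inj (detIdeal_lt_of_mem_minimalOverDet hq0 hL).le hK h]

theorem mem_stratum_detIdeal_and_height_iff [IsAlgClosed k] (hq0 : q ≠ 0)
    (hq : ∀ n : ℕ, 0 < n → q ^ n ≠ 1) (P : TwoSidedIdeal (OqM2 q)) :
    (P ∈ stratum (detIdeal q) ∧ height (factorIdeal (detIdeal q) P) = 1) ↔
      ∃ t : k, t ≠ 0 ∧ P = lineIdeal q t := by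
  have : Infinite k := IsAlgClosed.instInfinite
  constructor
  · rintro ⟨hP, hht⟩
    have hle : detIdeal q ≤ P := fun x hx => by
      simpa using ((mem_stratum_iff_of_isPrimeIdeal hP.1).1 hP x).2 hx 1
    have h1 := (factorIdeal_mem_heightOnePrimes_iff hq0 hq hle).1
      ⟨(isPrimeIdeal_factorIdeal hle).2 hP.1, hht⟩
    refine h1.resolve_right ?_
    rintro ⟨G, hG, rfl⟩
    exact (detIdeal_lt_genIdeal hq0 hG).ne'
      ((isHPrime_genIdeal hq0 (or_mem_of_mem_rowsAndColumns hG)).eq_of_mem_stratum hP)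
  · rintro ⟨t, ht, rfl⟩
    exact ⟨lineIdeal_mem_stratum hq0 ht, ((factorIdeal_mem_heightOnePrimes_iff hq0 hq
      (detIdeal_le_lineIdeal t)).2 (Or.inl ⟨t, ht, rfl⟩)).2⟩

theorem heightOnePrimes_not_isGeneratedByNormal [IsAlgClosed k] (hq0 : q ≠ 0)
    (hq : ∀ n : ℕ, 0 < n → q ^ n ≠ 1) :
    {Q ∈ heightOnePrimes (Factor (detIdeal q)) | ¬ IsGeneratedByNormal Q} =
      factorIdeal (detIdeal q) '' (genIdeal q '' rowsAndColumns) := by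
  rw [heightOnePrimes_factor_detIdeal hq0 hq]
  ext Q
  constructor
  · rintro ⟨⟨_, ⟨t, ht, rfl⟩ | hK, rfl⟩, hQ⟩
    · exact absurd (isGeneratedByNormal_lineIdeal hq0 t) hQ
    · exact ⟨_, hK, rfl⟩
  · rintro ⟨_, ⟨G, hG, rfl⟩, rfl⟩
    exact ⟨⟨_, Or.inr ⟨G, hG, rfl⟩, rfl⟩, not_isGeneratedByNormal_genIdeal hq0 hG⟩

theorem encard_factorIdeal_image_genIdeal (hq0 : q ≠ 0) :
    (factorIdeal (detIdeal q) '' (genIdeal q '' rowsAndColumns)).encard = 4 := by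
  rw [Set.InjOn.encard_image, Set.InjOn.encard_image, encard_rowsAndColumns]
  · intro G hG G' hG' h
    exact eq_of_subset_of_mem_rowsAndColumns hG hG'
      ((genIdeal_le_genIdeal_iff hq0 (or_mem_of_mem_rowsAndColumns hG')).1 h.le)
  · rintro _ ⟨G, hG, rfl⟩ _ ⟨G', hG', rfl⟩ h
    exact factorIdeal_inj (detIdeal_lt_genIdeal hq0 hG).le (detIdeal_lt_genIdeal hq0 hG').le h

theorem infinite_heightOnePrimes_factor_detIdeal [IsAlgClosed k] (hq0 : q ≠ 0)
    (hq : ∀ n : ℕ, 0 < n → q ^ n ≠ 1) : (heightOnePrimes (Factor (detIdeal q))).Infinite := by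
  have : Infinite k := IsAlgClosed.instInfinite
  refine Set.infinite_of_injOn_mapsTo (s := {0}ᶜ)
    (f := fun t : k => factorIdeal (detIdeal q) (lineIdeal q t)) (fun t _ s hs h => ?_)
    (fun t ht => ?_) (Set.finite_singleton 0).infinite_compl
  · exact eq_of_lineIdeal_le hq0 hs
      (factorIdeal_inj (detIdeal_le_lineIdeal t) (detIdeal_le_lineIdeal s) h).le
  · exact (factorIdeal_mem_heightOnePrimes_iff hq0 hq (detIdeal_le_lineIdeal t)).2
      (Or.inl ⟨t, ht, rfl⟩)

theorem IsHPrime.isNoncommUFD_factor [IsAlgClosed k] (hq0 : q ≠ 0)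
    (hq : ∀ n : ℕ, 0 < n → q ^ n ≠ 1) {J : TwoSidedIdeal (OqM2 q)} (hJ : IsHPrime J)
    (hne : J ≠ detIdeal q) : IsNoncommUFD (Factor J) := by
  rcases hJ.classification hq0 hq with rfl | rfl | ⟨G, hG, rfl⟩
  · exact isNoncommUFD_factor_bot hq0 hq
  · exact absurd rfl hne
  · exact isNoncommUFD_factor_genIdeal hq0 hq hG

theorem IsHPrime.hasPolynormalRegularSeq [IsAlgClosed k] (hq0 : q ≠ 0)
    (hq : ∀ n : ℕ, 0 < n → q ^ n ≠ 1) {J : TwoSidedIdeal (OqM2 q)} (hJ : IsHPrime J) :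
    HasPolynormalRegularSeq J := by
  rcases hJ.classification hq0 hq with rfl | rfl | ⟨G, hG, rfl⟩
  · exact hasPolynormalRegularSeq_bot
  · exact hasPolynormalRegularSeq_detIdeal hq0
  · exact hasPolynormalRegularSeq_genIdeal hq0 G hG

theorem isGeneratedByNormal_factorIdeal_iff [IsAlgClosed k] (hq0 : q ≠ 0)
    (hq : ∀ n : ℕ, 0 < n → q ^ n ≠ 1) {J K : TwoSidedIdeal (OqM2 q)} (hJ : IsHPrime J)
    (hK : IsHPrime K) (hlt : J < K) (hht : height (factorIdeal J K) = 1) :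
    IsGeneratedByNormal (factorIdeal J K) ↔ J ≠ detIdeal q := by
  have : Infinite k := IsAlgClosed.instInfinite
  have hprime : IsPrimeIdeal (factorIdeal J K) := (isPrimeIdeal_factorIdeal hlt.le).2 hK.1
  constructor
  · rintro hgen rfl
    rcases (factorIdeal_mem_heightOnePrimes_iff hq0 hq hlt.le).1 ⟨hprime, hht⟩ with
      ⟨t, ht, rfl⟩ | ⟨G, hG, rfl⟩
    · exact hlt.ne' (hK.eq_of_mem_stratum (lineIdeal_mem_stratum hq0 ht))
    · exact not_isGeneratedByNormal_genIdeal hq0 hG hgen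
  · intro hne
    exact (hJ.isNoncommUFD_factor hq0 hq hne).isGeneratedByNormal hprime
      (fun h => hlt.ne' ((factorIdeal_eq_bot_iff hlt.le).1 h)) hht

end OqM2

end

theorem mainTheorem12 {k : Type*} [Field k] [IsAlgClosed k] (q : k) (hq0 : q ≠ 0)
    (hq : ∀ n : ℕ, 0 < n → q ^ n ≠ 1) :
    -- `⟨Δ⟩` is itself an `H`-prime
    OqM2.IsHPrime (OqM2.detIdeal q) ∧
    -- (a)
    (∀ J K : TwoSidedIdeal (OqM2 q), OqM2.IsHPrime J → OqM2.IsHPrime K → J < K →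
      NCRing.height (NCRing.factorIdeal J K) = 1 →
        (NCRing.IsGeneratedByNormal (NCRing.factorIdeal J K) ↔ J ≠ OqM2.detIdeal q)) ∧
    -- (b)
    (∀ J : TwoSidedIdeal (OqM2 q), OqM2.IsHPrime J → J ≠ OqM2.detIdeal q →
      NCRing.IsNoncommUFD (NCRing.Factor J)) ∧
    -- (c)
    (∀ J : TwoSidedIdeal (OqM2 q), OqM2.IsHPrime J →
      ∃ (n : ℕ) (u : Fin n → OqM2 q),
        NCRing.IsPolynormalRegularSeq u ∧ TwoSidedIdeal.span (Set.range u) = J) ∧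
    -- (d) the height one primes `P/⟨Δ⟩` with `P` in the `⟨Δ⟩`-stratum, all of them principal
    (∀ P : TwoSidedIdeal (OqM2 q),
      (P ∈ OqM2.stratum (OqM2.detIdeal q) ∧
          NCRing.height (NCRing.factorIdeal (OqM2.detIdeal q) P) = 1) ↔
        ∃ t : k, t ≠ 0 ∧
          P = TwoSidedIdeal.span {OqM2.Δ q, OqM2.b q - t • OqM2.c q}) ∧
    (∀ t : k, t ≠ 0 →
      NCRing.IsGeneratedByNormal (NCRing.factorIdeal (OqM2.detIdeal q)
        (TwoSidedIdeal.span {OqM2.Δ q, OqM2.b q - t • OqM2.c q}))) ∧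
    -- (e) the four exceptional `H`-primes, and all height one primes of `A/⟨Δ⟩`
    (∀ K ∈ ({TwoSidedIdeal.span {OqM2.a q, OqM2.b q},
        TwoSidedIdeal.span {OqM2.b q, OqM2.d q},
        TwoSidedIdeal.span {OqM2.a q, OqM2.c q},
        TwoSidedIdeal.span {OqM2.c q, OqM2.d q}} : Set (TwoSidedIdeal (OqM2 q))),
      OqM2.IsHPrime K ∧ OqM2.detIdeal q < K) ∧
    NCRing.heightOnePrimes (NCRing.Factor (OqM2.detIdeal q)) =
      {Q | ∃ t : k, t ≠ 0 ∧ Q = NCRing.factorIdeal (OqM2.detIdeal q)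
        (TwoSidedIdeal.span {OqM2.Δ q, OqM2.b q - t • OqM2.c q})} ∪
      NCRing.factorIdeal (OqM2.detIdeal q) ''
        {TwoSidedIdeal.span {OqM2.a q, OqM2.b q},
          TwoSidedIdeal.span {OqM2.b q, OqM2.d q},
          TwoSidedIdeal.span {OqM2.a q, OqM2.c q},
          TwoSidedIdeal.span {OqM2.c q, OqM2.d q}} ∧
    -- (f) infinitely many height one primes, all principal except exactly four
    (NCRing.heightOnePrimes (NCRing.Factor (OqM2.detIdeal q))).Infinite ∧
    {Q ∈ NCRing.heightOnePrimes (NCRing.Factor (OqM2.detIdeal q)) |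
        ¬ NCRing.IsGeneratedByNormal Q} =
      NCRing.factorIdeal (OqM2.detIdeal q) ''
        {TwoSidedIdeal.span {OqM2.a q, OqM2.b q},
          TwoSidedIdeal.span {OqM2.b q, OqM2.d q},
          TwoSidedIdeal.span {OqM2.a q, OqM2.c q},
          TwoSidedIdeal.span {OqM2.c q, OqM2.d q}} ∧
    {Q ∈ NCRing.heightOnePrimes (NCRing.Factor (OqM2.detIdeal q)) |
        ¬ NCRing.IsGeneratedByNormal Q}.encard = 4 := by
  rw [← OqM2.genIdeal_image_rowsAndColumns]
  refine ⟨OqM2.isHPrime_detIdeal hq0,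
    fun J K hJ hK hlt hht => OqM2.isGeneratedByNormal_factorIdeal_iff hq0 hq hJ hK hlt hht,
    fun J hJ hne => hJ.isNoncommUFD_factor hq0 hq hne,
    fun J hJ => hJ.hasPolynormalRegularSeq hq0 hq,
    OqM2.mem_stratum_detIdeal_and_height_iff hq0 hq,
    fun t _ => OqM2.isGeneratedByNormal_lineIdeal hq0 t, ?_, ?_,
    OqM2.infinite_heightOnePrimes_factor_detIdeal hq0 hq,
    OqM2.heightOnePrimes_not_isGeneratedByNormal hq0 hq, ?_⟩
  · rintro _ ⟨G, hG, rfl⟩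
    exact ⟨OqM2.isHPrime_genIdeal hq0 (OqM2.or_mem_of_mem_rowsAndColumns hG),
      OqM2.detIdeal_lt_genIdeal hq0 hG⟩
  · rw [OqM2.heightOnePrimes_factor_detIdeal hq0 hq, OqM2.minimalOverDet, Set.image_union]
    congr 1
    ext Q
    constructor
    · rintro ⟨_, ⟨t, ht, rfl⟩, rfl⟩
      exact ⟨t, ht, rfl⟩
    · rintro ⟨t, ht, rfl⟩
      exact ⟨_, ⟨t, ht, rfl⟩, rfl⟩
  · rw [OqM2.heightOnePrimes_not_isGeneratedByNormal hq0 hq]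
    exact OqM2.encard_factorIdeal_image_genIdeal hq0
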